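/- Let $k$ be a field of characteristic $0$ and let $\mathcal C$ be a $k$-linear abelian braided monoidal category with braiding $c$, whose tensor product $\otimes$ is $k$-linear and right exact in each argument, such that: (PF) $\mathcal C$ has a projective object $P$ with $\dim_k \mathrm{End}(P)<\infty$ such that every object of $\mathcal C$ is a quotient of $P^{\oplus m}$ for some $m\in\mathbb N$; (C) $\mathcal C$ is equipped with a $k$-linear contravariant functor $(-)^*:\mathcal C\to\mathcal C$, natural isomorphisms $\delta_U:U\to U^{**}$ with $(\delta_U)^*=(\delta_{U^*})^{-1}$, and isomorphisms $\pi_{U,V}:\mathcal C(U,V^*)\to\mathcal C(U\otimes V,\mathbf 1^*)$ natural in $U$ and $V$. *The category $\mathcal C\boxtimes\mathcal C^{\mathrm{rev}}$.* A Deligne product of $\mathcal C$ with itself is a $k$-linear abelian category $\mathcal C\boxtimes\mathcal C$ with a functor $\boxtimes:\mathcal C\times\mathcal C\to\mathcal C\boxtimes\mathcal C$, $k$-linear and right exact in each argument, such that for every $k$-linear abelian category $\mathcal B$ composition with $\boxtimes$ is an equivalence from the category of $k$-linear right exact functors $\mathcal C\boxtimes\mathcal C\to\mathcal B$ to the category of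 functors $\mathcal C\times\mathcal C\to\mathcal B$ that are $k$-linear and right exact in each argument. $\mathcal C\boxtimes\mathcal C^{\mathrm{rev}}$ denotes such a product with a braided monoidal structure whose tensor product is $k$-linear and right exact in each argument, for which $\boxtimes$ is strong monoidal, $(A\boxtimes B)\otimes(U\boxtimes V)\cong(A\otimes U)\boxtimes(B\otimes V)$, and whose braiding on product objects is $c_{A\boxtimes B,U\boxtimes V}=c_{A,U}\boxtimes c_{V,B}^{-1}$. *The functor $T$.* $T:\mathcal C\boxtimes\mathcal C^{\mathrm{rev}}\to\mathcal C$ is the $k$-linear right exact functor with $T(A\boxtimes B)\cong A\otimes B$ (naturally in $A,B$), strong monoidal with $T_0:\mathbf 1\to\mathbf 1\otimes\mathbf 1$ the inverse unit isomorphism and with $T_2:(A\otimes B)\otimes(U\otimes V)\to(A\otimes U)\otimes(B\otimes V)$ on product objects given by $\mathrm{id}_A\otimes c_{U,B}^{-1}\otimes\mathrm{id}_V$ (up to associators). The mixed braiding $\varphi_{X,U}:T(X)\otimes U\to U\otimes T(X)$ is the natural transformation determined by $\varphi_{A\boxtimes B,U}=(c_{A,U}\otimes\mathrm{id}_B)\circ(\mathrm{id}_A\otimes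 c_{U,B}^{-1})$ (up to associators). *Centres.* An algebra is an object $A$ with an associative multiplication $\mu_A:A\otimes A\to A$ (no unit is required). For an algebra $B$ in a braided monoidal category, the left centre $e:C_l(B)\to B$ is the terminal object among arrows $u:U\to B$ with $\mu_B\circ(u\otimes\mathrm{id}_B)=\mu_B\circ(\mathrm{id}_B\otimes u)\circ c_{U,B}$. For an algebra $A$ in $\mathcal C$, the full centre of $A$ is the terminal object among pairs $(X,\;x:T(X)\to A)$ with $X\in\mathcal C\boxtimes\mathcal C^{\mathrm{rev}}$ and $\mu_A\circ(x\otimes\mathrm{id}_A)=\mu_A\circ(\mathrm{id}_A\otimes x)\circ\varphi_{X,A}$, a morphism $(X,x)\to(Y,y)$ being an arrow $f:X\to Y$ with $y\circ T(f)=x$. **Theorem.** A braided monoidal category $\mathcal C\boxtimes\mathcal C^{\mathrm{rev}}$ and a monoidal functor $T$ as above exist. For every choice of them, $T$ has a right adjoint. Let $R$ be any right adjoint of $T$, let $\varepsilon:TR\Rightarrow\mathrm{Id}$ be the counit of the adjunction, and give $R$ the lax monoidal structure induced by the monoidal structure of $T$, so that $R(A)$ is an algebra in $\mathcal C\boxtimes\mathcal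 C^{\mathrm{rev}}$ for every algebra $A$ in $\mathcal C$. Then for every algebra $A$ in $\mathcal C$ a left centre of $R(A)$ exists, and for every left centre $e:C_l(R(A))\to R(A)$ the pair $$Z=C_l(R(A)),\qquad z=\Big[T(C_l(R(A)))\xrightarrow{T(e)}T(R(A))\xrightarrow{\varepsilon_A}A\Big]$$ is the full centre of $A$. In particular every algebra in $\mathcal C$ has a full centre. -/

import Mathlib

open CategoryTheory Category Limits MonoidalCategory

universe w v v₁ v₂ v₃ u u₁ u₂ u₃

noncomputable section

namespace FullCentre

section Linear

/-- A functor between `k`-linear abelian categories is `k`-linear and right exact. -/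
def IsRightExact (k : Type w) [Field k]
    {D : Type u₁} [Category.{v₁} D] [Abelian D] [Linear k D]
    {B : Type u₂} [Category.{v₂} B] [Abelian B] [Linear k B] : ObjectProperty (D ⥤ B) :=
  fun F => F.Additive ∧ F.Linear k ∧ PreservesFiniteColimits F

/-- A functor of two variables is `k`-linear and right exact in each variable. -/
def IsBiRightExact (k : Type w) [Field k]
    {A : Type u₁} [Category.{v₁} A] [Abelian A] [Linear k A]
    {A' : Type u₂} [Category.{v₂} A'] [Abelian A'] [Linear k A']
    {B : Type u₃} [Category.{v₃} B] [Abelian B] [Linear k B] : ObjectProperty (A × A' ⥤ B) :=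
  fun F => (∀ Y : A', IsRightExact k (Prod.sectL A Y ⋙ F)) ∧
    (∀ X : A, IsRightExact k (Prod.sectR X A' ⋙ F))

theorem IsRightExact.comp {k : Type w} [Field k]
    {A : Type u₁} [Category.{v₁} A] [Abelian A] [Linear k A]
    {D : Type u₂} [Category.{v₂} D] [Abelian D] [Linear k D]
    {B : Type u₃} [Category.{v₃} B] [Abelian B] [Linear k B]
    {F : A ⥤ D} {G : D ⥤ B} (hF : IsRightExact k F) (hG : IsRightExact k G) :
    IsRightExact k (F ⋙ G) := by
  obtain ⟨_, _, _⟩ := hF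
  obtain ⟨_, _, _⟩ := hG
  exact ⟨inferInstance, inferInstance, comp_preservesFiniteColimits F G⟩

/-- Restriction along a functor `box : A × A' ⥤ D`, sending a `k`-linear right exact
functor `F : D ⥤ B` to the functor `box ⋙ F`, which is `k`-linear and right exact in each variable. -/
def restrict (k : Type w) [Field k]
    {A : Type u₁} [Category.{v₁} A] [Abelian A] [Linear k A]
    {A' : Type u₂} [Category.{v₂} A'] [Abelian A'] [Linear k A']
    {D : Type u} [Category.{v} D] [Abelian D] [Linear k D]
    (box : A × A' ⥤ D) (hbox : IsBiRightExact k box)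
    (B : Type u₃) [Category.{v₃} B] [Abelian B] [Linear k B] :
    (IsRightExact k (D := D) (B := B)).FullSubcategory ⥤
      (IsBiRightExact k (A := A) (A' := A') (B := B)).FullSubcategory :=
  ObjectProperty.lift _ (ObjectProperty.ι _ ⋙ (Functor.whiskeringLeft (A × A') D B).obj box)
    (fun F => ⟨fun Y => (hbox.1 Y).comp F.property, fun X => (hbox.2 X).comp F.property⟩)

/-- `box : A × A' ⥤ D` exhibits `D` as the Deligne product of the `k`-linear abelian categories
`A` and `A'`: it is `k`-linear and right exact in each variable, and restriction along it is an
equivalence from `k`-linear right exact functors `D ⥤ B` to functors `A × A' ⥤ B` which are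
`k`-linear and right exact in each variable, for every `k`-linear abelian category `B`. -/
structure IsDeligneProduct (k : Type w) [Field k]
    {A : Type u₁} [Category.{v₁} A] [Abelian A] [Linear k A]
    {A' : Type u₂} [Category.{v₂} A'] [Abelian A'] [Linear k A']
    {D : Type u} [Category.{v} D] [Abelian D] [Linear k D]
    (box : A × A' ⥤ D) : Prop where
  biRightExact : IsBiRightExact k box
  isEquivalence_restrict : ∀ (B : Type u) [Category.{v} B] [Abelian B] [Linear k B],
    (restrict k box biRightExact B).IsEquivalence

/-- The unique extension of a natural transformation given on product objects to a natural
transformation between `k`-linear right exact functors on a Deligne product. -/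
def IsDeligneProduct.extend {k : Type w} [Field k]
    {A : Type u₁} [Category.{v₁} A] [Abelian A] [Linear k A]
    {A' : Type u₂} [Category.{v₂} A'] [Abelian A'] [Linear k A']
    {D : Type u} [Category.{v} D] [Abelian D] [Linear k D]
    {box : A × A' ⥤ D} (h : IsDeligneProduct k box)
    {B : Type u} [Category.{v} B] [Abelian B] [Linear k B]
    {F G : D ⥤ B} (hF : IsRightExact k F) (hG : IsRightExact k G)
    (α : box ⋙ F ⟶ box ⋙ G) : F ⟶ G :=
  haveI := h.isEquivalence_restrict B
  let F' : (IsRightExact k (D := D) (B := B)).FullSubcategory := ⟨F, hF⟩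
  let G' : (IsRightExact k (D := D) (B := B)).FullSubcategory := ⟨G, hG⟩
  let α' : (restrict k box h.biRightExact B).obj F' ⟶ (restrict k box h.biRightExact B).obj G' :=
    ObjectProperty.homMk α
  ((restrict k box h.biRightExact B).preimage α').hom

theorem IsDeligneProduct.extend_app {k : Type w} [Field k]
    {A : Type u₁} [Category.{v₁} A] [Abelian A] [Linear k A]
    {A' : Type u₂} [Category.{v₂} A'] [Abelian A'] [Linear k A']
    {D : Type u} [Category.{v} D] [Abelian D] [Linear k D]
    {box : A × A' ⥤ D} (h : IsDeligneProduct k box)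
    {B : Type u} [Category.{v} B] [Abelian B] [Linear k B]
    {F G : D ⥤ B} (hF : IsRightExact k F) (hG : IsRightExact k G)
    (α : box ⋙ F ⟶ box ⋙ G) (X : A × A') :
    (h.extend hF hG α).app (box.obj X) = α.app X := by
  have := h.isEquivalence_restrict B
  let F' : (IsRightExact k (D := D) (B := B)).FullSubcategory := ⟨F, hF⟩
  let G' : (IsRightExact k (D := D) (B := B)).FullSubcategory := ⟨G, hG⟩
  let α' : (restrict k box h.biRightExact B).obj F' ⟶ (restrict k box h.biRightExact B).obj G' :=
    ObjectProperty.homMk α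
  have key := (restrict k box h.biRightExact B).map_preimage α'
  exact congrArg (fun f => f.hom.app X) key

/-- Condition (PF): there is a projective generator `P` (every object is a quotient of a finite
direct sum of copies of `P`) whose endomorphism space is finite-dimensional. -/
def ConditionPF (k : Type w) [Field k] (C : Type u) [Category.{v} C] [Abelian C] [Linear k C] :
    Prop :=
  haveI : HasFiniteBiproducts C := Abelian.hasFiniteBiproducts
  ∃ P : C, Projective P ∧
    (∀ U : C, ∃ (m : ℕ) (f : (⨁ fun _ : Fin m => P) ⟶ U), Epi f) ∧
    Module.Finite k (P ⟶ P)

/-- Condition (C): conjugates on a `k`-linear abelian monoidal category. -/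
structure Conjugates (k : Type w) [Field k] (C : Type u) [Category.{v} C] [Abelian C]
    [Linear k C] [MonoidalCategory C] where
  /-- the contragredient functor `U ↦ U*` -/
  star : Cᵒᵖ ⥤ C
  star_add : ∀ {U V : C} (f g : U ⟶ V), star.map (f + g).op = star.map f.op + star.map g.op
  star_smul : ∀ {U V : C} (a : k) (f : U ⟶ V), star.map (a • f).op = a • star.map f.op
  /-- the natural isomorphisms `U ≅ U**` -/
  δ : 𝟭 C ≅ star.rightOp ⋙ star
  star_δ : ∀ U : C, star.map (δ.hom.app U).op = δ.inv.app (star.obj (.op U))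
  /-- the isomorphisms `C(U, V*) ≅ C(U ⊗ V, 𝟙*)`, natural in `U` and `V` -/
  π : ∀ U V : C, (U ⟶ star.obj (.op V)) ≃ (U ⊗ V ⟶ star.obj (.op (𝟙_ C)))
  π_natural_left : ∀ {X U : C} (V : C) (a : X ⟶ U) (q : U ⟶ star.obj (.op V)),
    π X V (a ≫ q) = (a ▷ V) ≫ π U V q
  π_natural_right : ∀ (U : C) {Y V : C} (b : Y ⟶ V) (q : U ⟶ star.obj (.op V)),
    π U Y (q ≫ star.map b.op) = (U ◁ b) ≫ π U V q

end Linear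

section Algebras

/-- An algebra in a monoidal category: associative, not necessarily unital. -/
structure Alg (C : Type u) [Category.{v} C] [MonoidalCategory C] where
  obj : C
  mul : obj ⊗ obj ⟶ obj
  mul_assoc : (mul ▷ obj) ≫ mul = (α_ obj obj obj).hom ≫ (obj ◁ mul) ≫ mul

/-- The image of an algebra under a lax monoidal functor. -/
def Alg.map {C : Type u₁} [Category.{v₁} C] [MonoidalCategory C]
    {D : Type u₂} [Category.{v₂} D] [MonoidalCategory D]
    (F : C ⥤ D) [F.LaxMonoidal] (A : Alg C) : Alg D where
  obj := F.obj A.obj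
  mul := Functor.LaxMonoidal.μ F A.obj A.obj ≫ F.map A.mul
  mul_assoc := by
    have h := congrArg (fun f => F.map f) A.mul_assoc
    simp only [Functor.map_comp] at h
    simp only [comp_whiskerRight, MonoidalCategory.whiskerLeft_comp, assoc,
      Functor.LaxMonoidal.μ_natural_left_assoc, Functor.LaxMonoidal.μ_natural_right_assoc]
    rw [h, Functor.LaxMonoidal.associativity_assoc]

/-- The condition defining the left centre: `u : U ⟶ B` satisfies
`μ ∘ (u ⊗ id) = μ ∘ (id ⊗ u) ∘ c_{U,B}`. -/
def LeftCentral {D : Type u} [Category.{v} D] [MonoidalCategory D] [BraidedCategory D]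
    (B : Alg D) {U : D} (u : U ⟶ B.obj) : Prop :=
  (u ▷ B.obj) ≫ B.mul = (β_ U B.obj).hom ≫ (B.obj ◁ u) ≫ B.mul

/-- `e : L ⟶ B` is a left centre of the algebra `B`: it is terminal among the arrows into `B`
which satisfy the left centre condition. -/
structure IsLeftCentre {D : Type u} [Category.{v} D] [MonoidalCategory D] [BraidedCategory D]
    (B : Alg D) {L : D} (e : L ⟶ B.obj) : Prop where
  central : LeftCentral B e
  existsUnique : ∀ {U : D} (u : U ⟶ B.obj), LeftCentral B u → ∃! u' : U ⟶ L, u' ≫ e = u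

end Algebras

section Deligne

variable (k : Type w) [Field k] (C : Type u) [Category.{v} C] [Abelian C] [Linear k C]
  [MonoidalCategory C] [BraidedCategory C]

/-- The braided monoidal category `C ⊠ C^rev`: a Deligne product `box : C × C ⥤ D` of `C` with
itself, together with the braided monoidal structure on `D` whose tensor product is `k`-linear
and right exact in each variable, with `(A ⊠ B) ⊗ (U ⊠ V) = (A ⊗ U) ⊠ (B ⊗ V)` (compatibly with
associators and units, that is, `box` is strong monoidal), and whose braiding is
`c_{A,U} ⊠ c_{V,B}⁻¹` on product objects. -/
structure DeligneRev where
  D : Type u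
  [category : Category.{v} D]
  [abelian : Abelian D]
  [linear : Linear k D]
  [monoidal : MonoidalCategory D]
  [braided : BraidedCategory D]
  [monoidalPreadditive : MonoidalPreadditive D]
  [monoidalLinear : MonoidalLinear k D]
  tensorLeft_rightExact : ∀ X : D, PreservesFiniteColimits (tensorLeft X)
  tensorRight_rightExact : ∀ X : D, PreservesFiniteColimits (tensorRight X)
  box : C × C ⥤ D
  isDeligneProduct : IsDeligneProduct k box
  [boxMonoidal : box.Monoidal]
  braiding_box : ∀ A B U V : C,
    (β_ (box.obj (A, B)) (box.obj (U, V))).hom ≫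
        Functor.LaxMonoidal.μ box (U, V) (A, B) =
      Functor.LaxMonoidal.μ box (A, B) (U, V) ≫
        box.map (Prod.mkHom (β_ A U).hom (β_ V B).inv)

attribute [instance] DeligneRev.category DeligneRev.abelian DeligneRev.linear
  DeligneRev.monoidal DeligneRev.braided DeligneRev.monoidalPreadditive
  DeligneRev.monoidalLinear DeligneRev.boxMonoidal

variable {C}

/-- The isomorphism `(A ⊗ B) ⊗ (U ⊗ V) ⟶ (A ⊗ U) ⊗ (B ⊗ V)` given by `c_{U,B}⁻¹` in the middle. -/
def interchange (A B U V : C) : (A ⊗ B) ⊗ (U ⊗ V) ⟶ (A ⊗ U) ⊗ (B ⊗ V) :=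
  (α_ A B (U ⊗ V)).hom ≫ (A ◁ (α_ B U V).inv) ≫ (A ◁ ((β_ U B).inv ▷ V)) ≫
    (A ◁ (α_ U B V).hom) ≫ (α_ A U (B ⊗ V)).inv

/-- The mixed braiding on product objects, `(A ⊗ B) ⊗ U ⟶ U ⊗ (A ⊗ B)`, moving `U` past `B` by
`c_{U,B}⁻¹` and past `A` by `c_{A,U}`. -/
def mixedBraidingProd (A B U : C) : (A ⊗ B) ⊗ U ⟶ U ⊗ (A ⊗ B) :=
  (α_ A B U).hom ≫ (A ◁ (β_ U B).inv) ≫ (α_ A U B).inv ≫ ((β_ A U).hom ▷ B) ≫ (α_ U A B).hom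

theorem mixedBraidingProd_natural {A B A' B' : C} (f : A ⟶ A') (g : B ⟶ B') (U : C) :
    ((f ⊗ₘ g) ▷ U) ≫ mixedBraidingProd A' B' U =
      mixedBraidingProd A B U ≫ (U ◁ (f ⊗ₘ g)) := by
  have hf : ((f ▷ B) ▷ U) ≫ mixedBraidingProd A' B U =
      mixedBraidingProd A B U ≫ (U ◁ (f ▷ B)) := by
    simp only [mixedBraidingProd, assoc, associator_naturality_left_assoc]
    rw [← whisker_exchange_assoc, associator_inv_naturality_left_assoc,
      ← comp_whiskerRight_assoc, BraidedCategory.braiding_naturality_left,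
      comp_whiskerRight_assoc, associator_naturality_middle]
  have hg : ((A' ◁ g) ▷ U) ≫ mixedBraidingProd A' B' U =
      mixedBraidingProd A' B U ≫ (U ◁ (A' ◁ g)) := by
    simp only [mixedBraidingProd, assoc, associator_naturality_middle_assoc]
    rw [← MonoidalCategory.whiskerLeft_comp_assoc, BraidedCategory.braiding_inv_naturality_left,
      MonoidalCategory.whiskerLeft_comp_assoc, associator_inv_naturality_right_assoc,
      whisker_exchange_assoc, associator_naturality_right]
  rw [MonoidalCategory.tensorHom_def, comp_whiskerRight, MonoidalCategory.whiskerLeft_comp,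
    assoc, hg, reassoc_of% hf]

variable {k}

/-- The tensor functor `T : C ⊠ C^rev ⥤ C`: the `k`-linear right exact functor with
`T (A ⊠ B) = A ⊗ B`, with its strong monoidal structure, given by the inverse unit isomorphism
and, on product objects, by `interchange`. -/
structure TensorFunctor (E : DeligneRev k C) where
  T : E.D ⥤ C
  rightExact : IsRightExact k T
  τ : E.box ⋙ T ≅ MonoidalCategory.tensor C
  [monoidal : T.Monoidal]
  unit_eq : Functor.LaxMonoidal.ε T ≫ T.map (Functor.LaxMonoidal.ε E.box) ≫
      τ.hom.app (𝟙_ C, 𝟙_ C) = (λ_ (𝟙_ C)).inv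
  mul_eq : ∀ A B U V : C,
    Functor.LaxMonoidal.μ T (E.box.obj (A, B)) (E.box.obj (U, V)) ≫
        T.map (Functor.LaxMonoidal.μ E.box (A, B) (U, V)) ≫ τ.hom.app (A ⊗ U, B ⊗ V) =
      (τ.hom.app (A, B) ⊗ₘ τ.hom.app (U, V)) ≫ interchange A B U V

attribute [instance] TensorFunctor.monoidal

variable [MonoidalPreadditive C] [MonoidalLinear k C]
  [∀ X : C, PreservesFiniteColimits (tensorLeft X)]
  [∀ X : C, PreservesFiniteColimits (tensorRight X)]

/-- The mixed braiding `φ_{X,U} : T(X) ⊗ U ⟶ U ⊗ T(X)`, as a natural transformation in `X`: the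
extension to `C ⊠ C^rev` of the mixed braiding on product objects. -/
def mixedBraidingNat {E : DeligneRev k C} (T : TensorFunctor E) (U : C) :
    T.T ⋙ tensorRight U ⟶ T.T ⋙ tensorLeft U :=
  E.isDeligneProduct.extend (T.rightExact.comp ⟨inferInstance, inferInstance, inferInstance⟩)
    (T.rightExact.comp ⟨inferInstance, inferInstance, inferInstance⟩)
    { app := fun X => (T.τ.hom.app X ▷ U) ≫ mixedBraidingProd X.1 X.2 U ≫
        (U ◁ T.τ.inv.app X)
      naturality := fun X Y f => by
        have h₁ := T.τ.hom.naturality f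
        have h₂ := T.τ.inv.naturality f
        have h₃ := mixedBraidingProd_natural f.1 f.2 U
        dsimp at h₁ h₂ ⊢
        rw [← comp_whiskerRight_assoc, h₁, comp_whiskerRight_assoc, reassoc_of% h₃, assoc, assoc,
          ← MonoidalCategory.whiskerLeft_comp, ← MonoidalCategory.whiskerLeft_comp, h₂] }

/-- The component `φ_{X,U} : T(X) ⊗ U ⟶ U ⊗ T(X)` of the mixed braiding. -/
def mixedBraiding {E : DeligneRev k C} (T : TensorFunctor E) (X : E.D) (U : C) :
    T.T.obj X ⊗ U ⟶ U ⊗ T.T.obj X :=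
  (mixedBraidingNat T U).app X

theorem mixedBraiding_box {E : DeligneRev k C} (T : TensorFunctor E) (A B U : C) :
    mixedBraiding T (E.box.obj (A, B)) U =
      (T.τ.hom.app (A, B) ▷ U) ≫ mixedBraidingProd A B U ≫ (U ◁ T.τ.inv.app (A, B)) :=
  E.isDeligneProduct.extend_app _ _ _ (A, B)

/-- The centrality condition `μ ∘ (x ⊗ id) = μ ∘ (id ⊗ x) ∘ φ_{X,A}` on `x : T(X) ⟶ A`. -/
def Cent {E : DeligneRev k C} (T : TensorFunctor E) (A : Alg C) {X : E.D}
    (x : T.T.obj X ⟶ A.obj) : Prop :=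
  (x ▷ A.obj) ≫ A.mul = mixedBraiding T X A.obj ≫ (A.obj ◁ x) ≫ A.mul

/-- `(Z, z)` is a full centre of the algebra `A` in `C ⊠ C^rev`: it is terminal among the pairs
`(X, x : T(X) ⟶ A)` satisfying the centrality condition. -/
structure IsFullCentre {E : DeligneRev k C} (T : TensorFunctor E) (A : Alg C) (Z : E.D)
    (z : T.T.obj Z ⟶ A.obj) : Prop where
  cent : Cent T A z
  existsUnique : ∀ (X : E.D) (x : T.T.obj X ⟶ A.obj), Cent T A x →
    ∃! ζ : X ⟶ Z, T.T.map ζ ≫ z = x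

/-- The algebra `R(A)` in `C ⊠ C^rev`, for `R` right adjoint to `T` with the lax monoidal
structure induced by the adjunction and by the monoidal structure of `T`. -/
def adjointAlg {E : DeligneRev k C} (T : TensorFunctor E) {R : C ⥤ E.D} (adj : T.T ⊣ R)
    (A : Alg C) : Alg E.D :=
  letI := adj.rightAdjointLaxMonoidal
  A.map R

end Deligne

end FullCentre

end

/-! The heart of the matter is one equivalence. Under `T ⊣ R` an arrow `u : X ⟶ R(A)` corresponds to
`x = ε_A ∘ T(u)`, and `u` is left central in `R(A)` exactly when `x` satisfies the full centre
condition (`leftCentral_iff_cent`). So a terminal left central arrow is the same thing as a terminal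
pair `(X, x)`. To see the equivalence, apply `T` and then `ε_A` to both sides of left centrality.
The product of `R(A)` turns into that of `A` (`map_mul_counit`), and the braiding turns into the
mixed braiding (`map_braiding`). What results are the two sides of the full centre condition, each
precomposed with `id ⊗ ε_A`. This factor can be cancelled because `ε_A` is split epi: `A ≅ T(A ⊠ 𝟙)`
factors through `T(R(A))` (`exists_section_counit`).

The existence statements rest on an Eilenberg–Watts argument. If `Q` is a projective generator, a
right exact functor `F` is recovered as `Hom(Q, -) ⊗_{End Q} F(Q)`, so functors and transformations
are determined by their values at `Q` with the action of `End Q` (`exists_natTrans`,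
`exists_rightExact`). Consequently a functor `box` is a Deligne product once `P ⊠ P'` is a
projective generator with endomorphism algebra `End P ⊗ End P'` (`isDeligneProduct_of_endTensor`).
Finitely generated modules over `End(P)ᵒᵖ ⊗ End(P')ᵒᵖ` meet this criterion. Every Deligne product of
`C` with itself is equivalent to that model, so `P ⊠ P` is a finite projective generator in all of
them.

The tensor product, the coherence isomorphisms, the braiding and `T` with its monoidal structure are
all extended from product objects. Their axioms are checked there, since transformations of right
exact functors are determined on product objects. Finally, a finite projective generator makes
suitable subfunctors of `Hom(T -, c)` representable (`IsFiniteGenerator.exists_terminal`). Applied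
to all arrows this gives the right adjoint of `T`; applied to left central arrows, with the identity
functor in place of `T`, it gives left centres. -/

noncomputable section

namespace FullCentre

set_option linter.unusedSectionVars false

attribute [local instance] Abelian.hasFiniteBiproducts

/-! ### Generators and right exact functors. -/

section Covers

/-- Every object receives a finite jointly epimorphic family of arrows from `Q`. -/
def Covers {D : Type u} [Category.{v} D] (Q : D) : Prop :=
  ∀ X : D, ∃ (m : ℕ) (p : Fin m → (Q ⟶ X)),
    ∀ ⦃b : D⦄ (f g : X ⟶ b), (∀ i, p i ≫ f = p i ≫ g) → f = g

variable {D : Type u₁} [Category.{v₁} D] [Abelian D] {B : Type u₂} [Category.{v₂} B] [Abelian B]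

theorem Covers.exists_epi {Q : D} (hQ : Covers Q) (X : D) :
    ∃ (m : ℕ) (p : (⨁ fun _ : Fin m => Q) ⟶ X), Epi p := by
  obtain ⟨m, p, hp⟩ := hQ X
  refine ⟨m, biproduct.desc p, ⟨fun f g h => hp f g fun i => ?_⟩⟩
  simpa using congrArg (fun t => biproduct.ι (fun _ : Fin m => Q) i ≫ t) h

theorem covers_of_exists_epi {Q : D}
    (h : ∀ X : D, ∃ (m : ℕ) (p : (⨁ fun _ : Fin m => Q) ⟶ X), Epi p) : Covers Q := by
  intro X
  obtain ⟨m, p, _⟩ := h X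
  refine ⟨m, fun i => biproduct.ι (fun _ : Fin m => Q) i ≫ p, fun b f g hfg => ?_⟩
  rw [← cancel_epi p]
  exact biproduct.hom_ext' _ _ fun i => by simpa using hfg i

/-- `F` preserves the epimorphism from a finite power of `Q` onto `X`, and by additivity the arrows
out of `F(Q^m)` split into components. This replaces reasoning with elements throughout. -/
theorem Covers.hom_ext_map {Q : D} (hQ : Covers Q) (F : D ⥤ B) [F.Additive]
    [PreservesFiniteColimits F] {X : D} {b : B} {f g : F.obj X ⟶ b}
    (h : ∀ q : Q ⟶ X, F.map q ≫ f = F.map q ≫ g) : f = g := by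
  obtain ⟨m, p, hp⟩ := hQ X
  have : Epi (biproduct.desc p) := ⟨fun f g h => hp f g fun i => by
    simpa using congrArg (fun t => biproduct.ι (fun _ : Fin m => Q) i ≫ t) h⟩
  rw [← cancel_epi (F.map (biproduct.desc p)), biproduct.desc_eq, Functor.map_sum]
  simp only [Preadditive.sum_comp, Functor.map_comp, assoc, h]

theorem Covers.hom_ext {Q : D} (hQ : Covers Q) {X b : D} {f g : X ⟶ b}
    (h : ∀ q : Q ⟶ X, q ≫ f = q ≫ g) : f = g :=
  hQ.hom_ext_map (𝟭 D) h

theorem Covers.natTrans_ext {Q : D} (hQ : Covers Q) {F G : D ⥤ B} [F.Additive]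
    [PreservesFiniteColimits F] {α β : F ⟶ G} (h : α.app Q = β.app Q) : α = β := by
  ext X
  exact hQ.hom_ext_map F fun q => by rw [α.naturality, β.naturality, h]

/-- For additive functors cokernels suffice. The universal property is stated for single arrows `g`,
the form in which universal families deliver it. -/
theorem preservesFiniteColimits_of_cokernel (F : D ⥤ B) [F.Additive]
    (h : ∀ {X Y : D} (f : X ⟶ Y) {b : B} (g : F.obj Y ⟶ b), F.map f ≫ g = 0 →
      ∃! g' : F.obj (cokernel f) ⟶ b, F.map (cokernel.π f) ≫ g' = g) :
    PreservesFiniteColimits F := by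
  have : ∀ {X Y : D} (f : X ⟶ Y), PreservesColimit (parallelPair f 0) F := fun f =>
    preservesColimit_of_preserves_colimit_cocone (cokernelIsCokernel f)
      ((CokernelCofork.isColimitMapCoconeEquiv _ F).symm
        (CokernelCofork.IsColimit.ofπ _ (by
            change F.map f ≫ F.map (cokernel.π f) = 0
            rw [← F.map_comp, cokernel.condition, F.map_zero]) (fun g hg => (h f g hg).choose)
          (fun g hg => (h f g hg).choose_spec.1)
          (fun g hg m hm => (h f g hg).choose_spec.2 m hm)))
  exact Functor.preservesFiniteColimits_of_preservesCokernels F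

theorem exists_desc_of_comp_eq_zero (F : D ⥤ B) [F.Additive] [PreservesFiniteColimits F]
    {X Y Z : D} {f : X ⟶ Y} {p : Y ⟶ Z} [Epi p] (w : f ≫ p = 0)
    (hf : ∀ {b : D} (g : Y ⟶ b), f ≫ g = 0 → ∃ g', p ≫ g' = g)
    {b : B} (g : F.obj Y ⟶ b) (hg : F.map f ≫ g = 0) : ∃ g', F.map p ≫ g' = g := by
  have hc : IsColimit (CokernelCofork.ofπ p w) :=
    CokernelCofork.IsColimit.ofπ _ _ (fun g hg => (hf g hg).choose)
      (fun g hg => (hf g hg).choose_spec)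
      (fun g hg m hm => by rw [← cancel_epi p, hm, (hf g hg).choose_spec])
  have hc' := CokernelCofork.mapIsColimit _ hc F
  exact ⟨hc'.desc (CokernelCofork.ofπ g hg), hc'.fac (CokernelCofork.ofπ g hg) .one⟩

end Covers

/-! ### The object `Hom(Q, X) ⊗_{End Q} M`, described by its universal property. -/

section Universal

variable {k : Type w} [Field k]
  {D : Type u₁} [Category.{v₁} D] [Abelian D] [Linear k D]
  {B : Type u₂} [Category.{v₂} B] [Abelian B] [Linear k B]
  {Q : D} {M : B} (ρ : End Q →ₐ[k] End M)

/-- A family of arrows `M ⟶ b` indexed by the arrows `Q ⟶ X`, linear over `ρ`. -/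
structure IsFamily {X : D} {b : B} (s : (Q ⟶ X) → (M ⟶ b)) : Prop where
  add : ∀ x y, s (x + y) = s x + s y
  comp : ∀ (a : Q ⟶ Q) (x : Q ⟶ X), s (a ≫ x) = (show M ⟶ M from ρ a) ≫ s x

/-- The universal family of arrows `M ⟶ Y` indexed by the arrows `Q ⟶ X`. -/
structure IsUniversal {X : D} {Y : B} (t : (Q ⟶ X) → (M ⟶ Y)) : Prop extends IsFamily ρ t where
  existsUnique : ∀ {b : B} (s : (Q ⟶ X) → (M ⟶ b)), IsFamily ρ s → ∃! f : Y ⟶ b, ∀ x, t x ≫ f = s x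

variable {ρ}

/-- The action of a linear functor on endomorphisms, as a homomorphism of algebras. -/
def mapEndAlgHom (k : Type w) [Field k] {D : Type u₁} [Category.{v₁} D] [Preadditive D] [Linear k D]
    {B : Type u₂} [Category.{v₂} B] [Preadditive B] [Linear k B] (F : D ⥤ B) [F.Additive]
    [F.Linear k] (Q : D) : End Q →ₐ[k] End (F.obj Q) where
  toFun f := F.map f
  map_one' := F.map_id Q
  map_mul' f g := F.map_comp g f
  map_zero' := F.map_zero Q Q
  map_add' _ _ := F.map_add
  commutes' a := by
    change F.map (a • 𝟙 Q) = a • 𝟙 (F.obj Q)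
    rw [F.map_smul, F.map_id]

/-- The product of `End` is composition in the opposite order, hence the swapped arguments. -/
theorem algHom_comp (ρ : End Q →ₐ[k] End M) (a b : Q ⟶ Q) :
    (ρ (a ≫ b) : M ⟶ M) = (show M ⟶ M from ρ a) ≫ (show M ⟶ M from ρ b) :=
  map_mul ρ (show End Q from b) (show End Q from a)

namespace IsFamily

variable {X : D} {b : B} {s : (Q ⟶ X) → (M ⟶ b)}

theorem zero (hs : IsFamily ρ s) : s 0 = 0 := by
  have := hs.add 0 0
  simpa using this

theorem sum (hs : IsFamily ρ s) {ι : Type*} (J : Finset ι) (x : ι → (Q ⟶ X)) :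
    s (∑ i ∈ J, x i) = ∑ i ∈ J, s (x i) :=
  map_sum (AddMonoidHom.mk' s hs.add) x J

/-- Linearity over `k` comes for free: `a` acts as the endomorphism `a • 𝟙`, which `ρ` sends to `a •
𝟙`. -/
theorem smul (hs : IsFamily ρ s) (a : k) (x : Q ⟶ X) : s (a • x) = a • s x := by
  have h : a • x = (a • 𝟙 Q) ≫ x := by simp
  have h' : (ρ (a • (1 : End Q)) : M ⟶ M) = a • 𝟙 M := by rw [map_smul, map_one]; rfl
  rw [h, hs.comp]
  change (show M ⟶ M from ρ (a • (1 : End Q))) ≫ s x = _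
  rw [h']
  simp

theorem precomp (hs : IsFamily ρ s) {X' : D} (f : X' ⟶ X) : IsFamily ρ (fun x => s (x ≫ f)) :=
  ⟨fun x y => by rw [Preadditive.add_comp, hs.add], fun a x => by rw [assoc, hs.comp]⟩

theorem postcomp (hs : IsFamily ρ s) {b' : B} (g : b ⟶ b') : IsFamily ρ (fun x => s x ≫ g) :=
  ⟨fun x y => by rw [hs.add, Preadditive.add_comp], fun a x => by rw [hs.comp, assoc]⟩

/-- A family on `X₀` killed by `X₁ ⟶ X₀` descends to the cokernel. -/
theorem exists_descent [Projective Q] {X₁ X₀ : D} {s : (Q ⟶ X₀) → (M ⟶ b)} (hs : IsFamily ρ s)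
    (f : X₁ ⟶ X₀) (p : X₀ ⟶ X) [Epi p]
    (hf : ∀ x : Q ⟶ X₀, x ≫ p = 0 → ∃ x', x' ≫ f = x) (h0 : ∀ x, s (x ≫ f) = 0) :
    ∃ s' : (Q ⟶ X) → (M ⟶ b), IsFamily ρ s' ∧ ∀ x, s' (x ≫ p) = s x := by
  -- Two lifts of the same arrow differ by one killed by `p`, which factors through `f` and is
  -- therefore killed by `s`.
  have key : ∀ x y : Q ⟶ X₀, x ≫ p = y ≫ p → s x = s y := fun x y h => by
    obtain ⟨z, hz⟩ := hf (x - y) (by rw [Preadditive.sub_comp, h, sub_self])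
    have := hs.add y (x - y)
    rwa [← hz, h0, hz, add_sub_cancel, add_zero] at this
  have fac : ∀ x : Q ⟶ X, Projective.factorThru x p ≫ p = x := fun x =>
    Projective.factorThru_comp x p
  refine ⟨fun x => s (Projective.factorThru x p), ⟨fun x y => ?_, fun a x => ?_⟩, fun x => ?_⟩
  · rw [← hs.add]
    exact key _ _ (by rw [Preadditive.add_comp, fac, fac, fac])
  · rw [← hs.comp]
    exact key _ _ (by rw [assoc, fac, fac])
  · exact key _ _ (fac _)

end IsFamily

namespace IsUniversal

variable {X : D} {Y : B} {t : (Q ⟶ X) → (M ⟶ Y)}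

theorem hom_ext (ht : IsUniversal ρ t) {b : B} {f g : Y ⟶ b} (h : ∀ x, t x ≫ f = t x ≫ g) :
    f = g :=
  (ht.existsUnique _ (ht.toIsFamily.postcomp f)).unique (fun _ => rfl) (fun x => (h x).symm)

/-- `Hom(Q, Q^m)` is free over `End Q` on the coordinate inclusions, so tensoring it with `M` gives
`M^m`. -/
theorem biproduct (ρ : End Q →ₐ[k] End M) (m : ℕ) :
    IsUniversal ρ (X := ⨁ fun _ : Fin m => Q) (Y := ⨁ fun _ : Fin m => M)
      (fun x => biproduct.lift fun i => (show M ⟶ M from ρ (x ≫ biproduct.π _ i))) where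
  add x y := by
    refine biproduct.hom_ext _ _ fun i => ?_
    simp only [biproduct.lift_π, Preadditive.add_comp]
    exact map_add ρ _ _
  comp a x := by
    refine biproduct.hom_ext _ _ fun i => ?_
    simp only [biproduct.lift_π, assoc]
    exact algHom_comp ρ _ _
  existsUnique {b} s hs := by
    refine ⟨biproduct.desc fun i => s (biproduct.ι (fun _ : Fin m => Q) i), fun x => ?_,
      fun f hf => ?_⟩
    · simp only [biproduct.lift_desc, ← hs.comp, ← hs.sum]
      congr 1
      simp only [assoc, ← Preadditive.comp_sum, biproduct.total, comp_id]
    · refine biproduct.hom_ext' _ _ fun i => ?_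
      rw [biproduct.ι_desc, ← hf]
      congr 1
      refine biproduct.hom_ext _ _ fun j => ?_
      rw [biproduct.lift_π]
      by_cases h : i = j
      · subst h
        simp only [biproduct.ι_π_self]
        exact (map_one ρ).symm
      · simp only [biproduct.ι_π_ne _ h]
        exact (map_zero ρ).symm

/-- This is right exactness of the tensor product. Projectivity of `Q` and `hf` make `Hom(Q, -)`
send `X₁ ⟶ X₀ ⟶ X` to a presentation, so the object for `X` is the cokernel of the induced `Y₁ ⟶
Y₀`. -/
theorem of_exact [Projective Q] {X₁ X₀ : D} {Y₁ Y₀ : B} {t₁ : (Q ⟶ X₁) → (M ⟶ Y₁)}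
    {t₀ : (Q ⟶ X₀) → (M ⟶ Y₀)} (h₁ : IsUniversal ρ t₁) (h₀ : IsUniversal ρ t₀)
    (f : X₁ ⟶ X₀) (p : X₀ ⟶ X) [Epi p] (w : f ≫ p = 0)
    (hf : ∀ x : Q ⟶ X₀, x ≫ p = 0 → ∃ x', x' ≫ f = x) :
    ∃ (Y : B) (t : (Q ⟶ X) → (M ⟶ Y)), IsUniversal ρ t := by
  obtain ⟨φ, hφ, -⟩ := h₁.existsUnique _ (h₀.toIsFamily.precomp f)
  obtain ⟨t, ht, htp⟩ := (h₀.toIsFamily.postcomp (cokernel.π φ)).exists_descent f p hf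
    (fun x => by simp [← hφ])
  refine ⟨_, t, ht, fun {b} s hs => ?_⟩
  obtain ⟨g, hg, -⟩ := h₀.existsUnique _ (hs.precomp p)
  have hg0 : φ ≫ g = 0 := h₁.hom_ext fun x => by
    rw [reassoc_of% hφ, hg]
    simp [w, hs.zero]
  refine ⟨cokernel.desc φ g hg0, fun x => ?_, fun g' hg' => ?_⟩
  · obtain ⟨x, rfl⟩ : ∃ x', x' ≫ p = x := ⟨_, Projective.factorThru_comp x p⟩
    rw [htp]
    simp [hg]
  · rw [← cancel_epi (cokernel.π φ), cokernel.π_desc]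
    refine h₀.hom_ext fun x => ?_
    rw [← assoc, ← htp, hg', hg]

/-- Take a presentation of `X` by finite powers of `Q`. -/
theorem exists_of_covers [Projective Q] (hQ : Covers Q) (ρ : End Q →ₐ[k] End M) (X : D) :
    ∃ (Y : B) (t : (Q ⟶ X) → (M ⟶ Y)), IsUniversal ρ t := by
  obtain ⟨m, p, _⟩ := hQ.exists_epi X
  obtain ⟨n, q, _⟩ := hQ.exists_epi (kernel p)
  refine of_exact (biproduct ρ n) (biproduct ρ m) (q ≫ kernel.ι p) p (by simp) fun x hx => ?_
  refine ⟨Projective.factorThru (kernel.lift p x hx) q, ?_⟩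
  rw [← assoc, Projective.factorThru_comp, kernel.lift_ι]

/-- A right exact functor is universal among the functors with the same value on `Q`. -/
theorem of_rightExact [Projective Q] (hQ : Covers Q) (F : D ⥤ B) [F.Additive] [F.Linear k]
    [PreservesFiniteColimits F] (X : D) :
    IsUniversal (mapEndAlgHom k F Q) (fun x : Q ⟶ X => F.map x) where
  add x y := F.map_add
  comp a x := F.map_comp a x
  existsUnique {b} s hs := by
    obtain ⟨m, p, _⟩ := hQ.exists_epi X
    -- The sum is the only possible arrow on `F(Q^m)`: it is prescribed by `s` on the coordinates of
    -- `p`.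
    have hs' : ∀ x : Q ⟶ ⨁ fun _ : Fin m => Q,
        F.map x ≫ (∑ i, F.map (biproduct.π _ i) ≫ s (biproduct.ι (fun _ : Fin m => Q) i ≫ p)) =
          s (x ≫ p) := by
      intro x
      simp only [Preadditive.comp_sum, ← F.map_comp_assoc]
      have : ∀ i, F.map (x ≫ biproduct.π _ i) ≫ s (biproduct.ι (fun _ : Fin m => Q) i ≫ p) =
        s ((x ≫ biproduct.π _ i) ≫ biproduct.ι (fun _ : Fin m => Q) i ≫ p) :=
        fun i => (hs.comp _ _).symm
      simp only [this, ← hs.sum]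
      congr 1
      simp only [assoc, ← Preadditive.comp_sum]
      simp only [← assoc, ← Preadditive.sum_comp, biproduct.total, comp_id]
    -- `p` is the cokernel of its kernel and `F` preserves this, so it remains to see that the sum
    -- vanishes on `F(kernel p)`, which is tested on arrows from `Q`.
    obtain ⟨g, hg⟩ := exists_desc_of_comp_eq_zero F (f := kernel.ι p) (p := p) (by simp)
      (fun g hg => ⟨Abelian.epiDesc p g hg, Abelian.comp_epiDesc p g hg⟩)
      (∑ i, F.map (biproduct.π _ i) ≫ s (biproduct.ι (fun _ : Fin m => Q) i ≫ p))
      (hQ.hom_ext_map F fun q => by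
        rw [← F.map_comp_assoc, hs']
        simp [hs.zero])
    refine ⟨g, fun x => ?_, fun g' hg' => hQ.hom_ext_map F fun q => ?_⟩
    · obtain ⟨x, rfl⟩ : ∃ x', x' ≫ p = x := ⟨_, Projective.factorThru_comp x p⟩
      rw [F.map_comp, assoc, hg, hs']
    · obtain ⟨x, rfl⟩ : ∃ x', x' ≫ p = q := ⟨_, Projective.factorThru_comp q p⟩
      rw [hg', F.map_comp, assoc, hg, hs']

end IsUniversal

end Universal

/-! ### Eilenberg–Watts in one variable. -/

section OneVariable

variable {k : Type w} [Field k]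
  {D : Type u₁} [Category.{v₁} D] [Abelian D] [Linear k D]
  {B : Type u₂} [Category.{v₂} B] [Abelian B] [Linear k B]
  {Q : D} [Projective Q]

theorem IsRightExact.of_iso {F G : D ⥤ B} (e : F ≅ G) (hF : IsRightExact k F) :
    IsRightExact k G := by
  obtain ⟨_, _, _⟩ := hF
  have h (X Y : D) (f : X ⟶ Y) : G.map f = e.inv.app X ≫ F.map f ≫ e.hom.app Y := by simp
  have : G.Additive := ⟨fun {X Y f g} => by simp only [h, F.map_add, Preadditive.add_comp,
    Preadditive.comp_add]⟩
  exact ⟨this, ⟨fun f r => by simp only [h, F.map_smul, Linear.smul_comp, Linear.comp_smul]⟩,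
    preservesFiniteColimits_of_natIso e⟩

theorem isRightExact_id : IsRightExact k (𝟭 D) := ⟨inferInstance, inferInstance, inferInstance⟩

/-- The component at `X` is the arrow out of `F(X)` classified by the family `x ↦ φ ≫ G(x)`, and
naturality follows from uniqueness. Universality is used only for `F`, so `G` need only be additive.
-/
theorem exists_natTrans (hQ : Covers Q) {F G : D ⥤ B} (hF : IsRightExact k F) [G.Additive]
    (φ : F.obj Q ⟶ G.obj Q) (hφ : ∀ a : Q ⟶ Q, F.map a ≫ φ = φ ≫ G.map a) :
    ∃ α : F ⟶ G, α.app Q = φ := by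
  obtain ⟨_, _, _⟩ := hF
  have hu := IsUniversal.of_rightExact (k := k) hQ F
  have hs (X : D) : IsFamily (mapEndAlgHom k F Q) (fun x : Q ⟶ X => φ ≫ G.map x) :=
    ⟨fun x y => by rw [G.map_add, Preadditive.comp_add], fun a x => by
      change _ = F.map a ≫ φ ≫ G.map x
      rw [reassoc_of% hφ a, G.map_comp]⟩
  choose α hα _ using fun X => (hu X).existsUnique _ (hs X)
  refine ⟨⟨α, fun X Y f => (hu X).hom_ext fun x => ?_⟩, ?_⟩
  · rw [← F.map_comp_assoc, hα, reassoc_of% hα X, G.map_comp]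
  · simpa using hα Q (𝟙 Q)

/-- Every homomorphism `End Q ⟶ End M` comes from a right exact functor sending `Q` to `M`. -/
theorem exists_rightExact (hQ : Covers Q) {M : B} (ρ : End Q →ₐ[k] End M) :
    ∃ (F : D ⥤ B) (_ : IsRightExact k F) (e : M ≅ F.obj Q),
      ∀ a : Q ⟶ Q, e.hom ≫ F.map a = (show M ⟶ M from ρ a) ≫ e.hom := by
  choose Y t ht using IsUniversal.exists_of_covers hQ ρ
  choose m hm _ using fun {X X' : D} (f : X ⟶ X') =>
    (ht X).existsUnique _ ((ht X').toIsFamily.precomp f)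
  let F : D ⥤ B :=
    { obj := Y
      map := m
      map_id := fun X => (ht X).hom_ext fun x => by simp [hm]
      map_comp := fun f g => (ht _).hom_ext fun x => by
        rw [hm, reassoc_of% hm, hm, assoc] }
  have ht' (X X' : D) (f : X ⟶ X') (x : Q ⟶ X) : t X x ≫ F.map f = t X' (x ≫ f) := hm f x
  have : F.Additive := ⟨fun {X X' f g} => (ht X).hom_ext fun x => by
    rw [Preadditive.comp_add, ht', ht', ht', Preadditive.comp_add, (ht _).add]⟩
  have hlin : F.Linear k := ⟨fun {X X'} f r => (ht X).hom_ext fun x => by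
    rw [Linear.comp_smul, ht', ht', Linear.comp_smul, (ht _).toIsFamily.smul]⟩
  -- An arrow out of `F(X')` killing `F(f)` is a family on `X'` vanishing on arrows through `f`.
  -- Writing `f` as an epimorphism onto the kernel of its cokernel lets projectivity of `Q` supply
  -- the lifts needed to descend the family.
  have hpres : PreservesFiniteColimits F := preservesFiniteColimits_of_cokernel F
    fun {X X'} f {b} g hg => by
      obtain ⟨s, hs, hsp⟩ := ((ht X').toIsFamily.postcomp g).exists_descent
        (Abelian.factorThruImage f ≫ Abelian.image.ι f) (cokernel.π f)
        (fun x hx => ⟨Projective.factorThru (kernel.lift _ x hx) (Abelian.factorThruImage f), by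
          rw [Projective.factorThru_comp_assoc]
          exact kernel.lift_ι _ _ _⟩)
        (fun x => by rw [Abelian.image.fac, ← ht', assoc, hg, comp_zero])
      obtain ⟨g', hg', -⟩ := (ht (cokernel f)).existsUnique s hs
      have hfac : F.map (cokernel.π f) ≫ g' = g := (ht X').hom_ext fun x => by
        rw [← assoc, ht', hg', hsp]
      refine ⟨g', hfac, fun g'' hg'' => (ht _).hom_ext fun x => ?_⟩
      obtain ⟨x, rfl⟩ : ∃ x', x' ≫ cokernel.π f = x := ⟨_, Projective.factorThru_comp x _⟩
      rw [← ht', assoc, assoc, hg'', hfac]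
  -- On `Q` itself `ρ` is a family; the arrow it classifies is the inverse of `t Q (𝟙 Q) : M ⟶
  -- F(Q)`.
  have hρ : IsFamily ρ (fun a : Q ⟶ Q => (show M ⟶ M from ρ a)) :=
    ⟨fun x y => map_add ρ _ _, fun a x => algHom_comp ρ a x⟩
  obtain ⟨i, hi, -⟩ := (ht Q).existsUnique _ hρ
  refine ⟨F, ⟨this, hlin, hpres⟩, ⟨t Q (𝟙 Q), i, ?_, ?_⟩, fun a => ?_⟩
  · rw [hi]
    exact map_one ρ
  · refine (ht Q).hom_ext fun x => ?_
    rw [← assoc, hi, comp_id]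
    rw [← (ht Q).comp, comp_id]
  · change t Q (𝟙 Q) ≫ F.map a = _ ≫ t Q (𝟙 Q)
    rw [ht', ← (ht Q).comp, id_comp, comp_id]

end OneVariable

/-! ### Functors of two variables. -/

section TwoVariables

variable {k : Type w} [Field k]
  {A : Type u₁} [Category.{v₁} A] [Abelian A] [Linear k A]
  {A' : Type u₂} [Category.{v₂} A'] [Abelian A'] [Linear k A']
  {B : Type u₃} [Category.{v₃} B] [Abelian B] [Linear k B]
  {P : A} {P' : A'}

theorem prod_map_eq (H : A × A' ⥤ B) {X Y : A} {X' Y' : A'} (f : X ⟶ Y) (f' : X' ⟶ Y') :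
    H.map (Prod.mkHom f f') = H.map (Prod.mkHom f (𝟙 X')) ≫ H.map (Prod.mkHom (𝟙 Y) f') := by
  rw [← H.map_comp, prod_comp]
  simp

theorem prod_map_eq' (H : A × A' ⥤ B) {X Y : A} {X' Y' : A'} (f : X ⟶ Y) (f' : X' ⟶ Y') :
    H.map (Prod.mkHom f f') = H.map (Prod.mkHom (𝟙 X) f') ≫ H.map (Prod.mkHom f (𝟙 Y')) := by
  rw [← H.map_comp, prod_comp]
  simp

theorem IsBiRightExact.of_iso {F G : A × A' ⥤ B} (e : F ≅ G) (hF : IsBiRightExact k F) :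
    IsBiRightExact k G :=
  ⟨fun Y => (hF.1 Y).of_iso (Functor.isoWhiskerLeft _ e),
    fun X => (hF.2 X).of_iso (Functor.isoWhiskerLeft _ e)⟩

theorem IsBiRightExact.comp {D : Type u} [Category.{v} D] [Abelian D] [Linear k D]
    {F : A × A' ⥤ B} (hF : IsBiRightExact k F) {G : B ⥤ D} (hG : IsRightExact k G) :
    IsBiRightExact k (F ⋙ G) :=
  ⟨fun Y => (hF.1 Y).comp hG, fun X => (hF.2 X).comp hG⟩

theorem natTrans_ext₂ (hP : Covers P) (hP' : Covers P') {H K : A × A' ⥤ B}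
    (hH : IsBiRightExact k H) {α β : H ⟶ K} (h : α.app (P, P') = β.app (P, P')) : α = β := by
  have h₁ (X : A) : α.app (X, P') = β.app (X, P') := by
    obtain ⟨_, _, _⟩ := hH.1 P'
    exact congrArg (fun γ => γ.app X) (hP.natTrans_ext (F := Prod.sectL A P' ⋙ H)
      (G := Prod.sectL A P' ⋙ K) (α := Functor.whiskerLeft _ α) (β := Functor.whiskerLeft _ β) h)
  ext ⟨X, X'⟩
  obtain ⟨_, _, _⟩ := hH.2 X
  exact congrArg (fun γ => γ.app X') (hP'.natTrans_ext (F := Prod.sectR X A' ⋙ H)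
    (G := Prod.sectR X A' ⋙ K) (α := Functor.whiskerLeft _ α) (β := Functor.whiskerLeft _ β) (h₁ X))

variable [Projective P] [Projective P']

/-- Extend along the first variable with `P'` fixed, then along the second. At each stage the
equations still missing are tested on arrows from the generator. -/
theorem exists_natTrans₂ (hP : Covers P) (hP' : Covers P') {H K : A × A' ⥤ B}
    (hH : IsBiRightExact k H) (hK : IsBiRightExact k K) (φ : H.obj (P, P') ⟶ K.obj (P, P'))
    (hφ : ∀ (a : P ⟶ P) (a' : P' ⟶ P'), H.map (Prod.mkHom a a') ≫ φ = φ ≫ K.map (Prod.mkHom a a')) :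
    ∃ α : H ⟶ K, α.app (P, P') = φ := by
  obtain ⟨α, hα, hnat⟩ : ∃ α : ∀ X, H.obj (X, P') ⟶ K.obj (X, P'), α P = φ ∧
      ∀ {X Y : A} (f : X ⟶ Y), H.map (Prod.mkHom f (𝟙 P')) ≫ α Y =
        α X ≫ K.map (Prod.mkHom f (𝟙 P')) := by
    have := (hK.1 P').1
    obtain ⟨α, hα⟩ := exists_natTrans hP (hH.1 P') (G := Prod.sectL A P' ⋙ K) φ
      (fun a => hφ a (𝟙 P'))
    exact ⟨α.app, hα, fun f => α.naturality f⟩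
  -- This equivariance is what the second extension requires. It is pulled back along arrows `P ⟶ X`
  -- to the hypothesis on `φ`.
  have hcomm (X : A) (a' : P' ⟶ P') :
      H.map (Prod.mkHom (𝟙 X) a') ≫ α X = α X ≫ K.map (Prod.mkHom (𝟙 X) a') := by
    obtain ⟨_, _, _⟩ := hH.1 P'
    refine hP.hom_ext_map (Prod.sectL A P' ⋙ H) fun q => ?_
    change H.map (Prod.mkHom q (𝟙 P')) ≫ H.map (Prod.mkHom (𝟙 X) a') ≫ α X =
      H.map (Prod.mkHom q (𝟙 P')) ≫ α X ≫ K.map (Prod.mkHom (𝟙 X) a')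
    rw [reassoc_of% hnat, ← prod_map_eq, ← assoc, ← prod_map_eq, prod_map_eq', assoc, hnat, hα,
      reassoc_of% hφ, ← prod_map_eq']
  obtain ⟨β, hβ, hβ₂⟩ : ∃ β : ∀ X X', H.obj (X, X') ⟶ K.obj (X, X'), (∀ X, β X P' = α X) ∧
      ∀ (X : A) {X' Y' : A'} (f : X' ⟶ Y'), H.map (Prod.mkHom (𝟙 X) f) ≫ β X Y' =
        β X X' ≫ K.map (Prod.mkHom (𝟙 X) f) := by
    choose β hβ using fun X => by
      have := (hK.2 X).1
      exact exists_natTrans hP' (hH.2 X) (G := Prod.sectR X A' ⋙ K) (α X) (hcomm X)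
    exact ⟨fun X => (β X).app, hβ, fun X X' Y' f => (β X).naturality f⟩
  -- The second extension gives naturality in `X'` only; naturality in `X` is tested on arrows `P' ⟶
  -- X'`.
  have hβ₁ {X Y : A} (f : X ⟶ Y) (X' : A') : H.map (Prod.mkHom f (𝟙 X')) ≫ β Y X' =
      β X X' ≫ K.map (Prod.mkHom f (𝟙 X')) := by
    obtain ⟨_, _, _⟩ := hH.2 X
    refine hP'.hom_ext_map (Prod.sectR X A' ⋙ H) fun q => ?_
    change H.map (Prod.mkHom (𝟙 X) q) ≫ H.map (Prod.mkHom f (𝟙 X')) ≫ β Y X' =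
      H.map (Prod.mkHom (𝟙 X) q) ≫ β X X' ≫ K.map (Prod.mkHom f (𝟙 X'))
    rw [reassoc_of% hβ₂, ← prod_map_eq', ← assoc, ← prod_map_eq', prod_map_eq, assoc, hβ₂, hβ, hβ,
      reassoc_of% hnat, ← prod_map_eq]
  refine ⟨⟨fun X => β X.1 X.2, fun X Y f => ?_⟩, by rw [← hα, ← hβ]⟩
  change H.map (Prod.mkHom f.1 f.2) ≫ _ = _ ≫ K.map (Prod.mkHom f.1 f.2)
  rw [prod_map_eq, assoc, hβ₂, reassoc_of% hβ₁, ← prod_map_eq]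

/-- The inverse at `(P, P')` is again equivariant, so it extends; both composites are identities
because they are so at `(P, P')`. -/
theorem isIso_of_isIso_app₂ (hP : Covers P) (hP' : Covers P') {H K : A × A' ⥤ B}
    (hH : IsBiRightExact k H) (hK : IsBiRightExact k K) (α : H ⟶ K) [IsIso (α.app (P, P'))] :
    IsIso α := by
  obtain ⟨β, hβ⟩ := exists_natTrans₂ hP hP' hK hH (inv (α.app (P, P'))) (fun a a' => by
    rw [IsIso.comp_inv_eq, assoc, α.naturality, IsIso.inv_hom_id_assoc])
  exact ⟨β, natTrans_ext₂ hP hP' hH (by simp [hβ]), natTrans_ext₂ hP hP' hK (by simp [hβ])⟩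

variable (P P') in
/-- The algebra homomorphism `End P ⊗ End P' ⟶ End (H (P, P'))` of a bilinear functor `H`. -/
def endTensor {H : A × A' ⥤ B} (hH : IsBiRightExact k H) :
    TensorProduct k (End P) (End P') →ₐ[k] End (H.obj (P, P')) :=
  haveI := (hH.1 P').1
  haveI := (hH.1 P').2.1
  haveI := (hH.2 P).1
  haveI := (hH.2 P).2.1
  let f : End P →ₐ[k] End (H.obj (P, P')) := mapEndAlgHom k (Prod.sectL A P' ⋙ H) P
  let g : End P' →ₐ[k] End (H.obj (P, P')) := mapEndAlgHom k (Prod.sectR P A' ⋙ H) P'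
  Algebra.TensorProduct.lift f g fun a a' => by
      change H.map (Prod.mkHom (𝟙 P) a') ≫ H.map (Prod.mkHom a (𝟙 P')) =
        H.map (Prod.mkHom a (𝟙 P')) ≫ H.map (Prod.mkHom (𝟙 P) a')
      rw [← prod_map_eq, ← prod_map_eq']

theorem endTensor_tmul {H : A × A' ⥤ B} (hH : IsBiRightExact k H) (a : End P) (a' : End P') :
    endTensor P P' hH (TensorProduct.tmul k a a') =
      H.map (Prod.mkHom (show P ⟶ P from a) (show P' ⟶ P' from a')) := by
  simp only [endTensor]
  change H.map (Prod.mkHom (𝟙 P) a') ≫ H.map (Prod.mkHom a (𝟙 P')) = _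
  rw [← prod_map_eq']

end TwoVariables

/-! ### A criterion for Deligne products. -/

section Criterion

variable {k : Type w} [Field k]
  {A : Type u₁} [Category.{v₁} A] [Abelian A] [Linear k A]
  {A' : Type u₂} [Category.{v₂} A'] [Abelian A'] [Linear k A']
  {D : Type u} [Category.{v} D] [Abelian D] [Linear k D]
  {P : A} {P' : A'} [Projective P] [Projective P']

/-- A bilinear functor which induces `End P ⊗ End P' ≅ End (P ⊠ P')` for projective generators
`P`, `P'` and `P ⊠ P'` is a Deligne product. -/
theorem isDeligneProduct_of_endTensor (hP : Covers P) (hP' : Covers P') {box : A × A' ⥤ D}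
    (hbox : IsBiRightExact k box) [Projective (box.obj (P, P'))] (hQ : Covers (box.obj (P, P')))
    (hend : Function.Bijective (endTensor P P' hbox)) : IsDeligneProduct k box where
  biRightExact := hbox
  isEquivalence_restrict B _ _ _ :=
    { faithful :=
        { map_injective := fun {F G} α β h => by
            obtain ⟨_, _, _⟩ := F.property
            exact ObjectProperty.hom_ext _ (hQ.natTrans_ext
              (congrArg (fun γ => γ.hom.app (P, P')) h)) }
      full :=
        { map_surjective := fun {F G} α => by
            have := G.property.1
            have := F.property.1
            -- Endomorphisms of `P ⊠ P'` are sums of images of pure tensors, and for those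
            -- equivariance is naturality of `α`.
            obtain ⟨β, hβ⟩ := exists_natTrans hQ F.property (G := G.obj) (α.hom.app (P, P'))
              (fun a => by
                obtain ⟨x, rfl⟩ := hend.surjective a
                induction x with
                | zero =>
                  rw [map_zero]
                  exact (congrArg (· ≫ _) (F.obj.map_zero _ _)).trans (zero_comp.trans
                    (comp_zero.symm.trans (congrArg (_ ≫ ·) (G.obj.map_zero _ _).symm)))
                | add x y hx hy =>
                  rw [map_add]
                  refine (congrArg (· ≫ _) F.obj.map_add).trans ((Preadditive.add_comp ..).trans
                    ((congrArg₂ _ hx hy).trans ((Preadditive.comp_add ..).symm.trans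
                    (congrArg (_ ≫ ·) G.obj.map_add.symm))))
                | tmul a a' =>
                  rw [endTensor_tmul]
                  exact α.hom.naturality _)
            refine ⟨ObjectProperty.homMk β, ObjectProperty.hom_ext _ ?_⟩
            exact natTrans_ext₂ hP hP' ((restrict k box hbox B).obj F).property hβ }
      essSurj :=
        { mem_essImage := fun H => by
            -- Through `e`, the algebra `End (P ⊠ P')` acts on `H(P, P')`, and Eilenberg–Watts
            -- produces `F` with this value. The comparison of `H` with `box ⋙ F` is invertible at
            -- `(P, P')`, hence everywhere.
            let e := AlgEquiv.ofBijective _ hend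
            obtain ⟨F, hF, i, hi⟩ := exists_rightExact hQ
              ((endTensor P P' H.property).comp e.symm.toAlgHom)
            obtain ⟨α, hα⟩ := exists_natTrans₂ hP hP' H.property (hbox.comp hF) i.hom
              (fun a a' => by
                have h := hi (box.map (Prod.mkHom a a'))
                have h' : e.symm (box.map (Prod.mkHom a a')) = TensorProduct.tmul k a a' :=
                  e.injective (by
                    rw [e.apply_symm_apply]
                    exact (endTensor_tmul hbox a a').symm)
                refine Eq.trans ?_ h.symm
                congr 1
                change _ = endTensor P P' H.property (e.symm (box.map (Prod.mkHom a a')))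
                rw [h', endTensor_tmul])
            have : IsIso (α.app (P, P')) := by rw [hα]; infer_instance
            have := isIso_of_isIso_app₂ hP hP' H.property (hbox.comp hF) α
            let i' : H.obj ≅ box ⋙ F := asIso α
            exact ⟨⟨F, hF⟩, ⟨ObjectProperty.isoMk _ i'.symm⟩⟩ } }

end Criterion

/-! ### Finitely generated modules over a Noetherian ring. -/

section FiniteModules

variable (R : Type v) [Ring R]

/-- The category of finitely generated modules over `R`, with objects in a larger universe. -/
def FinMod : Type (max u (v + 1)) :=
  InducedCategory (FGModuleCat.{v} R) (ULift.down.{u, v + 1} : ULift.{u} (FGModuleCat.{v} R) → _)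

namespace FinMod

instance : Category.{v} (FinMod.{v, u} R) :=
  inferInstanceAs (Category (InducedCategory (FGModuleCat.{v} R) ULift.down))

instance : Preadditive (FinMod.{v, u} R) :=
  inferInstanceAs (Preadditive (InducedCategory (FGModuleCat.{v} R) ULift.down))

/-- The comparison with the category of finitely generated modules. -/
def toFG : FinMod.{v, u} R ⥤ FGModuleCat.{v} R :=
  inducedFunctor (ULift.down : ULift.{u} (FGModuleCat.{v} R) → _)

instance : (toFG.{v, u} R).IsEquivalence where
  faithful := inferInstanceAs (inducedFunctor _).Faithful
  full := inferInstanceAs (inducedFunctor _).Full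
  essSurj := ⟨fun X => ⟨ULift.up X, ⟨Iso.refl _⟩⟩⟩

variable [IsNoetherianRing R]

instance : Abelian (FinMod.{v, u} R) :=
  haveI : HasFiniteProducts (FinMod.{v, u} R) :=
    ⟨fun _ => Adjunction.hasLimitsOfShape_of_equivalence (toFG R)⟩
  abelianOfEquivalence (toFG R)

variable {k : Type w} [Field k] [Algebra k R]

instance : Linear k (FinMod.{v, u} R) :=
  inferInstanceAs (Linear k (InducedCategory (FGModuleCat.{v} R) ULift.down))

variable {R}

/-- The underlying module. -/
def carrier (X : FinMod.{v, u} R) : Type v := ((toFG R).obj X).carrier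

instance (X : FinMod.{v, u} R) : AddCommGroup X.carrier :=
  inferInstanceAs (AddCommGroup ((toFG R).obj X).carrier)

instance (X : FinMod.{v, u} R) : Module R X.carrier :=
  inferInstanceAs (Module R ((toFG R).obj X).carrier)

instance (X : FinMod.{v, u} R) : Module.Finite R X.carrier :=
  inferInstanceAs (Module.Finite R ((toFG R).obj X).carrier)

/-- The object given by a finitely generated module. -/
def of (M : Type v) [AddCommGroup M] [Module R M] [Module.Finite R M] : FinMod.{v, u} R :=
  ULift.up (FGModuleCat.of R M)

/-- The underlying linear map of a morphism. -/
def lin {X Y : FinMod.{v, u} R} (f : X ⟶ Y) : X.carrier →ₗ[R] Y.carrier := f.hom.hom.hom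

/-- The morphism given by a linear map. -/
def ofLin {X Y : FinMod.{v, u} R} (f : X.carrier →ₗ[R] Y.carrier) : X ⟶ Y :=
  ⟨⟨ModuleCat.ofHom f⟩⟩

@[simp] theorem lin_ofLin {X Y : FinMod.{v, u} R} (f : X.carrier →ₗ[R] Y.carrier) :
    lin (ofLin f) = f := rfl

theorem hom_ext {X Y : FinMod.{v, u} R} {f g : X ⟶ Y} (h : ∀ x, lin f x = lin g x) : f = g :=
  InducedCategory.hom_ext (FGModuleCat.hom_ext (LinearMap.ext h))

@[simp] theorem lin_id (X : FinMod.{v, u} R) (x : X.carrier) : lin (𝟙 X) x = x := rfl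

@[simp] theorem lin_comp {X Y Z : FinMod.{v, u} R} (f : X ⟶ Y) (g : Y ⟶ Z) (x : X.carrier) :
    lin (f ≫ g) x = lin g (lin f x) := rfl

@[simp] theorem lin_add {X Y : FinMod.{v, u} R} (f g : X ⟶ Y) (x : X.carrier) :
    lin (f + g) x = lin f x + lin g x := rfl

@[simp] theorem lin_zero {X Y : FinMod.{v, u} R} (x : X.carrier) :
    lin (0 : X ⟶ Y) x = 0 := rfl

theorem surjective_of_epi {X Y : FinMod.{v, u} R} (f : X ⟶ Y) [Epi f] :
    Function.Surjective (lin f) := by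
  have : Epi ((toFG R ⋙ forget₂ (FGModuleCat.{v} R) (ModuleCat.{v} R)).map f) := by
    rw [Functor.comp_map]
    infer_instance
  exact (ModuleCat.epi_iff_surjective _).1 this

section Free

variable {M : FinMod.{v, u} R} (e : M.carrier)
  (he : Function.Bijective (fun r : R => r • e))

-- Bijectivity says that `M` is free of rank one on `e`, so a lift of an arrow is given by a
-- preimage of the image of `e`.
include he in
theorem projective_of_bijective : Projective M where
  factors {Y Z} f g _ := by
    obtain ⟨y, hy⟩ := surjective_of_epi g (lin f e)
    let i := LinearEquiv.ofBijective (LinearMap.toSpanSingleton R M.carrier e) he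
    refine ⟨ofLin (LinearMap.toSpanSingleton R Y.carrier y ∘ₗ i.symm.toLinearMap),
      hom_ext fun x => ?_⟩
    obtain ⟨r, rfl⟩ := he.surjective x
    have h1 : i.symm e = 1 := i.injective (by rw [i.apply_symm_apply]; exact (one_smul R e).symm)
    simp [h1, hy]

include he in
theorem covers_of_bijective : Covers M := by
  intro X
  obtain ⟨n, f, hf⟩ := Module.Finite.exists_fin' R X.carrier
  let i := LinearEquiv.ofBijective (LinearMap.toSpanSingleton R M.carrier e) he
  refine ⟨n, fun j => ofLin (LinearMap.toSpanSingleton R X.carrier (f (Pi.single j 1)) ∘ₗ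
    i.symm.toLinearMap), fun b g h hgh => hom_ext fun x => ?_⟩
  have : lin g ∘ₗ f = lin h ∘ₗ f := by
    refine LinearMap.pi_ext' fun j => LinearMap.ext_ring ?_
    have h1 : i.symm e = 1 := i.injective (by rw [i.apply_symm_apply]; exact (one_smul R e).symm)
    have := congrArg (fun φ => lin φ e) (hgh j)
    simpa [h1] using this
  obtain ⟨y, rfl⟩ := hf x
  exact LinearMap.congr_fun this y

end Free

/-- An additive functor to finitely generated modules which sends cokernels to surjections with
the expected kernel is right exact. -/
theorem preservesFiniteColimits_of_exact {C : Type u₁} [Category.{v₁} C] [Abelian C]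
    (F : C ⥤ FinMod.{v, u} R) [F.Additive]
    (hs : ∀ {X Y : C} (f : X ⟶ Y), Function.Surjective (lin (F.map (cokernel.π f))))
    (he : ∀ {X Y : C} (f : X ⟶ Y) (y : (F.obj Y).carrier), lin (F.map (cokernel.π f)) y = 0 →
      ∃ x, lin (F.map f) x = y) :
    PreservesFiniteColimits F :=
  preservesFiniteColimits_of_cokernel F fun {X Y} f {b} g hg => by
    have hker : LinearMap.ker (lin (F.map (cokernel.π f))) ≤ LinearMap.ker (lin g) := fun y hy => by
      obtain ⟨x, rfl⟩ := he f y hy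
      exact congrArg (fun φ => lin φ x) hg
    let i := (lin (F.map (cokernel.π f))).quotKerEquivOfSurjective (hs f)
    have hi (y) : i.symm (lin (F.map (cokernel.π f)) y) = Submodule.Quotient.mk y :=
      i.injective (by rw [i.apply_symm_apply]; rfl)
    refine ⟨ofLin (Submodule.liftQ _ (lin g) hker ∘ₗ i.symm.toLinearMap),
      hom_ext fun y => ?_, fun g' hg' => hom_ext fun z => ?_⟩
    · simp [hi]
    · obtain ⟨y, rfl⟩ := hs f z
      rw [← lin_comp, hg']
      simp [hi]

end FinMod

end FiniteModules

/-! ### The modules `Hom(P, X) ⊗ Hom(P', X')`. -/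

section BoxModule

open TensorProduct in
/-- The ring acting on the tensor products `Hom(P, X) ⊗ Hom(P', X')`. -/
abbrev boxRing (k : Type w) [Field k] {A : Type u₁} [Category.{v} A] [Preadditive A] [Linear k A]
    {A' : Type u₂} [Category.{v} A'] [Preadditive A'] [Linear k A'] (P : A) (P' : A') : Type v :=
  (End P)ᵐᵒᵖ ⊗[k] (End P')ᵐᵒᵖ

variable (k : Type w) [Field k]
  {A : Type u₁} [Category.{v} A] [Abelian A] [Linear k A]
  {A' : Type u₂} [Category.{v} A'] [Abelian A'] [Linear k A'] (P : A) (P' : A')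

/-- The action of endomorphisms of `P` on `Hom(P, X)`. -/
def precompAlgHom (X : A) : (End P)ᵐᵒᵖ →ₐ[k] Module.End k (P ⟶ X) where
  toFun a := Linear.leftComp k X (show P ⟶ P from a.unop)
  map_one' := LinearMap.ext fun x => id_comp x
  map_mul' a b := LinearMap.ext fun x => assoc (show P ⟶ P from a.unop) (show P ⟶ P from b.unop) x
  map_zero' := LinearMap.ext fun x => zero_comp
  map_add' a b := LinearMap.ext fun x => Preadditive.add_comp _ _ _ _ _ _
  commutes' c := LinearMap.ext fun x => by
    change (c • 𝟙 P) ≫ x = c • x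
    simp

/-- The module `Hom(P, X) ⊗ Hom(P', X')`. -/
def BoxModule (X : A) (X' : A') : Type v := TensorProduct k (P ⟶ X) (P' ⟶ X')

instance (X : A) (X' : A') : AddCommGroup (BoxModule k P P' X X') :=
  inferInstanceAs (AddCommGroup (TensorProduct k (P ⟶ X) (P' ⟶ X')))

instance (X : A) (X' : A') : Module k (BoxModule k P P' X X') :=
  inferInstanceAs (Module k (TensorProduct k (P ⟶ X) (P' ⟶ X')))

/-- The action on `Hom(P, X) ⊗ Hom(P', X')`. -/
def boxAction (X : A) (X' : A') :
    boxRing k P P' →ₐ[k] Module.End k (BoxModule k P P' X X') :=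
  (Module.endTensorEndAlgHom (R := k) (S := k) (A := k) (M := (P ⟶ X)) (N := (P' ⟶ X'))).comp
    (Algebra.TensorProduct.map (precompAlgHom k P X) (precompAlgHom k P' X'))

instance (X : A) (X' : A') : Module (boxRing k P P') (BoxModule k P P' X X') :=
  Module.compHom _ (boxAction k P P' X X').toRingHom

variable {k P P'}

/-- A pure tensor in `Hom(P, X) ⊗ Hom(P', X')`. -/
def BoxModule.tmul {X : A} {X' : A'} (x : P ⟶ X) (x' : P' ⟶ X') : BoxModule k P P' X X' :=
  TensorProduct.tmul k x x'

instance (X : A) (X' : A') : IsScalarTower k (boxRing k P P') (BoxModule k P P' X X') :=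
  ⟨fun c r x => by
    change boxAction k P P' X X' (c • r) x = c • boxAction k P P' X X' r x
    rw [map_smul]
    rfl⟩

theorem BoxModule.induction {X : A} {X' : A'} {p : BoxModule k P P' X X' → Prop}
    (x : BoxModule k P P' X X') (h0 : p 0) (ht : ∀ x x', p (tmul x x'))
    (ha : ∀ x y, p x → p y → p (x + y)) : p x :=
  TensorProduct.induction_on x h0 ht ha

theorem boxRing_induction {p : boxRing k P P' → Prop}
    (r : boxRing k P P') (h0 : p 0)
    (ht : ∀ (a : End P) (a' : End P'), p (TensorProduct.tmul k (MulOpposite.op a) (MulOpposite.op a')))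
    (ha : ∀ x y, p x → p y → p (x + y)) : p r :=
  TensorProduct.induction_on r h0 (fun a a' => ht a.unop a'.unop) ha

/-- Composition on tensor products of spaces of arrows, as a map of vector spaces. -/
def BoxModule.mapAux {X Y : A} {X' Y' : A'} (f : X ⟶ Y) (f' : X' ⟶ Y') :
    BoxModule k P P' X X' →ₗ[k] BoxModule k P P' Y Y' :=
  TensorProduct.map (Linear.rightComp k P f) (Linear.rightComp k P' f')

theorem BoxModule.mapAux_smul {X Y : A} {X' Y' : A'} (f : X ⟶ Y) (f' : X' ⟶ Y')
    (r : boxRing k P P') (x : BoxModule k P P' X X') : mapAux f f' (r • x) = r • mapAux f f' x := by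
  induction x using BoxModule.induction with
  | h0 => simp
  | ha x y hx hy => rw [smul_add, map_add, map_add, hx, hy, ← smul_add]
  | ht x x' =>
    induction r using boxRing_induction with
    | h0 =>
      have h0 (X : A) (X' : A') (y : BoxModule k P P' X X') : (0 : boxRing k P P') • y = 0 :=
        LinearMap.congr_fun (map_zero (boxAction k P P' X X')) y
      exact (congrArg _ (h0 _ _ _)).trans ((LinearMap.map_zero _).trans (h0 _ _ _).symm)
    | ha r s hr hs =>
      have h0 (X : A) (X' : A') (y : BoxModule k P P' X X') : (r + s) • y = r • y + s • y :=
        add_smul _ _ _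
      exact (congrArg _ (h0 _ _ _)).trans ((LinearMap.map_add _ _ _).trans
        ((congrArg₂ _ hr hs).trans (h0 _ _ _).symm))
    | ht a a' =>
      exact congrArg₂ tmul (assoc (show P ⟶ P from a) x f) (assoc (show P' ⟶ P' from a') x' f')

/-- Composition on tensor products of spaces of arrows. -/
def BoxModule.map {X Y : A} {X' Y' : A'} (f : X ⟶ Y) (f' : X' ⟶ Y') :
    BoxModule k P P' X X' →ₗ[boxRing k P P'] BoxModule k P P' Y Y' where
  toFun := mapAux f f'
  map_add' := map_add _
  map_smul' := mapAux_smul f f'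

theorem BoxModule.map_tmul {X Y : A} {X' Y' : A'} (f : X ⟶ Y) (f' : X' ⟶ Y') (x : P ⟶ X)
    (x' : P' ⟶ X') : map (k := k) f f' (tmul x x') = tmul (x ≫ f) (x' ≫ f') := rfl

theorem BoxModule.hom_ext {X : A} {X' : A'} {M : Type*} [AddCommGroup M] [Module (boxRing k P P') M]
    {f g : BoxModule k P P' X X' →ₗ[boxRing k P P'] M} (h : ∀ x x', f (tmul x x') = g (tmul x x')) :
    f = g := by
  ext x
  induction x using BoxModule.induction with
  | h0 => simp
  | ht x x' => exact h x x'
  | ha x y hx hy => rw [map_add, map_add, hx, hy]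

end BoxModule

/-! ### The module model of the Deligne product. -/

section BoxFunctor

variable (k : Type w) [Field k]
  {A : Type u₁} [Category.{v} A] [Abelian A] [Linear k A]
  {A' : Type u₂} [Category.{v} A'] [Abelian A'] [Linear k A'] (P : A) (P' : A')

/-- A finite-dimensional algebra is Noetherian, which makes its finitely generated modules an
abelian category. -/
theorem finite_boxRing [Module.Finite k (P ⟶ P)] [Module.Finite k (P' ⟶ P')] :
    Module.Finite k (boxRing k P P') := by
  have : Module.Finite k (End P)ᵐᵒᵖ :=
    Module.Finite.equiv (MulOpposite.opLinearEquiv k : (P ⟶ P) ≃ₗ[k] _)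
  have : Module.Finite k (End P')ᵐᵒᵖ :=
    Module.Finite.equiv (MulOpposite.opLinearEquiv k : (P' ⟶ P') ≃ₗ[k] _)
  infer_instance

theorem finite_boxModule [∀ X : A, Module.Finite k (P ⟶ X)] [∀ X : A', Module.Finite k (P' ⟶ X)]
    (X : A) (X' : A') : Module.Finite (boxRing k P P') (BoxModule k P P' X X') :=
  have : Module.Finite k (BoxModule k P P' X X') :=
    inferInstanceAs (Module.Finite k (TensorProduct k (P ⟶ X) (P' ⟶ X')))
  Module.Finite.of_restrictScalars_finite k _ _

variable [IsNoetherianRing (boxRing k P P')]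
  [∀ X X', Module.Finite (boxRing k P P') (BoxModule k P P' X X')]

/-- The functor `(X, X') ↦ Hom(P, X) ⊗ Hom(P', X')`. -/
def boxFunctor : A × A' ⥤ FinMod.{v, u} (boxRing k P P') where
  obj X := FinMod.of (BoxModule k P P' X.1 X.2)
  map {X Y} f := FinMod.ofLin (BoxModule.map (k := k) (P := P) (P' := P') f.1 f.2)
  map_id X := FinMod.hom_ext fun x => LinearMap.congr_fun (BoxModule.hom_ext
    (f := BoxModule.map (k := k) (𝟙 X.1) (𝟙 X.2)) (g := LinearMap.id) fun x x' => by
      rw [BoxModule.map_tmul, comp_id, comp_id]; rfl) x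
  map_comp {X Y Z} f g := FinMod.hom_ext fun x => LinearMap.congr_fun (BoxModule.hom_ext
    (f := BoxModule.map (k := k) (f.1 ≫ g.1) (f.2 ≫ g.2))
    (g := BoxModule.map g.1 g.2 ∘ₗ BoxModule.map f.1 f.2) fun x x' => by
      rw [BoxModule.map_tmul, LinearMap.comp_apply, BoxModule.map_tmul, BoxModule.map_tmul,
        assoc, assoc]) x

theorem boxFunctor_hom_ext {X : A} {X' : A'} {M : FinMod.{v, u} (boxRing k P P')}
    {f g : (boxFunctor k P P').obj (X, X') ⟶ M}
    (h : ∀ x x', FinMod.lin f (BoxModule.tmul x x') = FinMod.lin g (BoxModule.tmul x x')) : f = g :=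
  FinMod.hom_ext fun x => LinearMap.congr_fun (BoxModule.hom_ext
    (f := (FinMod.lin f : BoxModule k P P' X X' →ₗ[boxRing k P P'] _)) (g := FinMod.lin g) h) x

theorem rightComp_surjective [Projective P] {X Y : A} (f : X ⟶ Y) [Epi f] :
    Function.Surjective (Linear.rightComp k P f) := fun y =>
  ⟨Projective.factorThru y f, Projective.factorThru_comp y f⟩

/-- An arrow killed by `cokernel.π f` lands in the image of `f`, and projectivity of `P` lifts it
along the epimorphism onto that image. -/
theorem rightComp_exact [Projective P] {X Y : A} (f : X ⟶ Y) :
    Function.Exact (Linear.rightComp k P f) (Linear.rightComp k P (cokernel.π f)) := by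
  refine fun y => ⟨fun h => ⟨Projective.factorThru (kernel.lift (cokernel.π f) y h)
    (Abelian.factorThruImage f), ?_⟩, ?_⟩
  · refine (congrArg (_ ≫ ·) (Abelian.image.fac f).symm).trans ?_
    rw [Projective.factorThru_comp_assoc]
    exact kernel.lift_ι _ _ _
  · rintro ⟨x, rfl⟩
    simp

theorem rightComp_id (X : A) : Linear.rightComp k P (𝟙 X) = LinearMap.id :=
  LinearMap.ext fun x => comp_id x

/-- `Hom(P, -)` is exact because `P` is projective, and tensoring over `k` with a fixed space is
right exact. -/
theorem isBiRightExact_boxFunctor [Projective P] [Projective P'] :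
    IsBiRightExact k (boxFunctor.{w, v, u} k P P') := by
  refine ⟨fun Y => ?_, fun X => ?_⟩
  · have hadd : (Prod.sectL A Y ⋙ boxFunctor.{w, v, u} k P P').Additive :=
      ⟨fun {X X' f g} => boxFunctor_hom_ext k P P' fun x x' =>
        (congrArg (fun t => BoxModule.tmul (k := k) t (x' ≫ 𝟙 Y))
          (Preadditive.comp_add _ _ _ x f g)).trans (TensorProduct.add_tmul _ _ _)⟩
    refine ⟨hadd, ⟨fun {X X'} f r => boxFunctor_hom_ext k P P' fun x x' => ?_⟩,
      FinMod.preservesFiniteColimits_of_exact _ (fun {X X'} f => ?_) (fun {X X'} f => ?_)⟩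
    · exact (congrArg (fun t => BoxModule.tmul (k := k) t (x' ≫ 𝟙 Y))
        (Linear.comp_smul _ _ _ x r f)).trans ((TensorProduct.smul_tmul' _ _ _).symm.trans
        (algebraMap_smul (boxRing k P P') r (BoxModule.tmul (x ≫ f) (x' ≫ 𝟙 Y))).symm)
    · exact TensorProduct.map_surjective (rightComp_surjective k P (cokernel.π f))
        (rightComp_surjective k P' (𝟙 Y))
    · have h := rTensor_exact (P' ⟶ Y) (rightComp_exact k P f) (rightComp_surjective k P _)
      rw [LinearMap.rTensor, LinearMap.rTensor, ← rightComp_id] at h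
      exact fun y hy => (h y).1 hy
  · have hadd : (Prod.sectR X A' ⋙ boxFunctor.{w, v, u} k P P').Additive :=
      ⟨fun {Y Y' f g} => boxFunctor_hom_ext k P P' fun x x' =>
        (congrArg (fun t => BoxModule.tmul (k := k) (x ≫ 𝟙 X) t)
          (Preadditive.comp_add _ _ _ x' f g)).trans (TensorProduct.tmul_add _ _ _)⟩
    refine ⟨hadd, ⟨fun {Y Y'} f r => boxFunctor_hom_ext k P P' fun x x' => ?_⟩,
      FinMod.preservesFiniteColimits_of_exact _ (fun {Y Y'} f => ?_) (fun {Y Y'} f => ?_)⟩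
    · exact (congrArg (fun t => BoxModule.tmul (k := k) (x ≫ 𝟙 X) t)
        (Linear.comp_smul _ _ _ x' r f)).trans ((TensorProduct.tmul_smul _ _ _).trans
        (algebraMap_smul (boxRing k P P') r (BoxModule.tmul (x ≫ 𝟙 X) (x' ≫ f))).symm)
    · exact TensorProduct.map_surjective (rightComp_surjective k P (𝟙 X))
        (rightComp_surjective k P' (cokernel.π f))
    · have h := lTensor_exact (P ⟶ X) (rightComp_exact k P' f) (rightComp_surjective k P' _)
      rw [LinearMap.lTensor, LinearMap.lTensor, ← rightComp_id] at h
      exact fun y hy => (h y).1 hy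

/-- The generator of `Hom(P, P) ⊗ Hom(P', P')`. -/
def boxUnit : ((boxFunctor.{w, v, u} k P P').obj (P, P')).carrier :=
  BoxModule.tmul (k := k) (𝟙 P) (𝟙 P')

/-- Pure tensors of arrows and pure tensors of opposites of endomorphisms agree. -/
def unopTensor : boxRing k P P' ≃ₗ[k] TensorProduct k (End P) (End P') :=
  TensorProduct.congr (MulOpposite.opLinearEquiv k).symm (MulOpposite.opLinearEquiv k).symm

/-- Acting on `𝟙 ⊗ 𝟙` by precomposition returns the acting tensor, so the value at `(P, P')` is free
of rank one. -/
theorem smul_boxUnit (r : boxRing k P P') :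
    (r • boxUnit.{w, v, u} k P P' : BoxModule k P P' P P') = unopTensor k P P' r := by
  induction r using boxRing_induction with
  | h0 => rw [map_zero]; exact zero_smul (boxRing k P P') (boxUnit.{w, v, u} k P P')
  | ht a a' =>
    exact congrArg₂ (BoxModule.tmul (k := k)) (comp_id (show P ⟶ P from a))
      (comp_id (show P' ⟶ P' from a'))
  | ha r s hr hs =>
    rw [map_add, ← hr, ← hs]
    exact add_smul r s (boxUnit.{w, v, u} k P P')

theorem smul_boxUnit_bijective :
    Function.Bijective (fun r : boxRing k P P' => r • boxUnit.{w, v, u} k P P') := by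
  have : (fun r : boxRing k P P' => r • boxUnit.{w, v, u} k P P') = unopTensor k P P' :=
    funext (smul_boxUnit k P P')
  rw [this]
  exact (unopTensor k P P').bijective

theorem endTensor_boxUnit [Projective P] [Projective P']
    (x : TensorProduct k (End P) (End P')) :
    (FinMod.lin (X := (boxFunctor.{w, v, u} k P P').obj (P, P'))
      (endTensor P P' (isBiRightExact_boxFunctor k P P') x) (boxUnit k P P') :
        TensorProduct k (End P) (End P')) = x := by
  induction x with
  | zero => rw [map_zero]; rfl
  | tmul a a' =>
    rw [endTensor_tmul]
    exact congrArg₂ (BoxModule.tmul (k := k)) (id_comp (show P ⟶ P from a))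
      (id_comp (show P' ⟶ P' from a'))
  | add x y hx hy =>
    rw [map_add]
    exact congrArg₂ (· + ·) hx hy

/-- An endomorphism of a free module of rank one is determined by the image of the generator;
evaluation there is the inverse map. -/
theorem endTensor_bijective [Projective P] [Projective P'] :
    Function.Bijective (endTensor P P' (isBiRightExact_boxFunctor.{w, v, u} k P P')) := by
  refine ⟨fun x y h => ?_, fun f => ?_⟩
  · rw [← endTensor_boxUnit k P P' x, h, endTensor_boxUnit]
  · refine ⟨FinMod.lin (X := (boxFunctor.{w, v, u} k P P').obj (P, P')) f (boxUnit k P P'),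
      FinMod.hom_ext fun x => ?_⟩
    obtain ⟨r, rfl⟩ := (smul_boxUnit_bijective.{w, v, u} k P P').surjective x
    rw [map_smul, map_smul]
    exact congrArg (r • ·) (endTensor_boxUnit k P P' _)

/-- The tensor product of finitely generated modules is a Deligne product. -/
theorem isDeligneProduct_boxFunctor [Projective P] [Projective P'] (hP : Covers P)
    (hP' : Covers P') : IsDeligneProduct k (boxFunctor.{w, v, u} k P P') :=
  haveI := FinMod.projective_of_bijective _ (smul_boxUnit_bijective.{w, v, u} k P P')
  isDeligneProduct_of_endTensor hP hP' (isBiRightExact_boxFunctor k P P')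
    (FinMod.covers_of_bijective _ (smul_boxUnit_bijective.{w, v, u} k P P'))
    (endTensor_bijective k P P')

end BoxFunctor

/-! ### Finiteness from a projective generator. -/

section Generators

variable (k : Type w) [Field k]

/-- A projective generator with finite-dimensional endomorphism algebra. -/
structure IsFiniteGenerator {D : Type u₁} [Category.{v₁} D] [Abelian D] [Linear k D] (Q : D) :
    Prop where
  projective : Projective Q
  covers : Covers Q
  finite : Module.Finite k (Q ⟶ Q)

variable {k}

theorem ConditionPF.exists_isFiniteGenerator {C : Type u₁} [Category.{v₁} C] [Abelian C]
    [Linear k C] (h : ConditionPF k C) : ∃ P : C, IsFiniteGenerator k P := by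
  obtain ⟨P, h₁, h₂, h₃⟩ := h
  exact ⟨P, h₁, covers_of_exists_epi h₂, h₃⟩

variable {D : Type u₁} [Category.{v₁} D] [Abelian D] [Linear k D] {Q : D}

/-- A cover `Q^m ⟶ X` and projectivity of `Q` make `Hom(Q, X)` a quotient of `End(Q)^m`. -/
theorem IsFiniteGenerator.finite_hom_left (hQ : IsFiniteGenerator k Q) (X : D) :
    Module.Finite k (Q ⟶ X) := by
  have := hQ.projective
  have := hQ.finite
  obtain ⟨m, p, _⟩ := hQ.covers.exists_epi X
  let φ : (Fin m → (Q ⟶ Q)) →ₗ[k] (Q ⟶ X) :=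
    ∑ i, Linear.rightComp k Q (biproduct.ι (fun _ : Fin m => Q) i ≫ p) ∘ₗ LinearMap.proj i
  refine Module.Finite.of_surjective φ fun x => ?_
  obtain ⟨y, rfl⟩ : ∃ y, y ≫ p = x := ⟨_, Projective.factorThru_comp x p⟩
  refine ⟨fun i => y ≫ biproduct.π _ i, ?_⟩
  have : (∑ i, (y ≫ biproduct.π (fun _ : Fin m => Q) i) ≫
      biproduct.ι (fun _ : Fin m => Q) i ≫ p) = y ≫ p := by
    simp only [assoc, ← Preadditive.comp_sum]
    simp only [← assoc, ← Preadditive.sum_comp, biproduct.total, comp_id]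
  simpa [φ, LinearMap.sum_apply] using this

/-- A cover of `X` by `Q` embeds `Hom(X, Y)` into `Hom(Q, Y)^m`. -/
theorem IsFiniteGenerator.finite_hom (hQ : IsFiniteGenerator k Q) (X Y : D) :
    Module.Finite k (X ⟶ Y) := by
  have := hQ.finite_hom_left Y
  obtain ⟨m, p, hp⟩ := hQ.covers X
  let φ : (X ⟶ Y) →ₗ[k] (Fin m → (Q ⟶ Y)) := LinearMap.pi fun i => Linear.leftComp k Y (p i)
  exact Module.Finite.of_injective φ fun f g h => hp f g fun i => congrFun h i

theorem IsFiniteGenerator.of_equivalence (hQ : IsFiniteGenerator k Q)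
    {D' : Type u₂} [Category.{v₂} D'] [Abelian D'] [Linear k D'] (e : D ≌ D')
    [e.functor.Additive] [e.functor.Linear k] {Q' : D'} (i : e.functor.obj Q ≅ Q') :
    IsFiniteGenerator k Q' where
  projective := by
    have := hQ.projective
    exact Projective.of_iso i ((e.map_projective_iff Q).2 hQ.projective)
  covers X := by
    obtain ⟨m, p, hp⟩ := hQ.covers (e.inverse.obj X)
    refine ⟨m, fun j => i.inv ≫ e.functor.map (p j) ≫ e.counit.app X, fun b f g h => ?_⟩
    refine e.inverse.map_injective (hp _ _ fun j => e.functor.map_injective ?_)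
    have := h j
    simp only [assoc, cancel_epi] at this
    simp [reassoc_of% this]
  finite := by
    have := hQ.finite
    let φ : (Q ⟶ Q) →ₗ[k] (Q' ⟶ Q') :=
      Linear.leftComp k Q' i.inv ∘ₗ Linear.rightComp k _ i.hom ∘ₗ e.functor.mapLinearMap k
    refine Module.Finite.of_surjective φ fun x => ?_
    obtain ⟨y, hy⟩ := e.functor.map_surjective (i.hom ≫ x ≫ i.inv)
    exact ⟨y, by simp [φ, hy]⟩

end Generators

/-! ### Uniqueness of Deligne products. -/

section DeligneEquivalence

variable {k : Type w} [Field k]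
  {A : Type u₁} [Category.{v₁} A] [Abelian A] [Linear k A]
  {A' : Type u₂} [Category.{v₂} A'] [Abelian A'] [Linear k A']
  {D : Type u} [Category.{v} D] [Abelian D] [Linear k D]

namespace IsDeligneProduct

variable {box : A × A' ⥤ D} (h : IsDeligneProduct k box)
include h

theorem hom_ext {B : Type u} [Category.{v} B] [Abelian B] [Linear k B] {F G : D ⥤ B}
    (hF : IsRightExact k F) (hG : IsRightExact k G) {α β : F ⟶ G}
    (hαβ : ∀ X, α.app (box.obj X) = β.app (box.obj X)) : α = β := by
  have := h.isEquivalence_restrict B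
  let F' : (IsRightExact k (D := D) (B := B)).FullSubcategory := ⟨F, hF⟩
  let G' : (IsRightExact k (D := D) (B := B)).FullSubcategory := ⟨G, hG⟩
  have := (restrict k box h.biRightExact B).map_injective (X := F') (Y := G')
    (a₁ := ObjectProperty.homMk α) (a₂ := ObjectProperty.homMk β)
    (ObjectProperty.hom_ext _ (NatTrans.ext (funext hαβ)))
  exact congrArg (fun f => f.hom) this

/-- The extension of a natural isomorphism given on product objects. -/
def extendIso {B : Type u} [Category.{v} B] [Abelian B] [Linear k B] {F G : D ⥤ B}
    (hF : IsRightExact k F) (hG : IsRightExact k G) (e : box ⋙ F ≅ box ⋙ G) : F ≅ G where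
  hom := h.extend hF hG e.hom
  inv := h.extend hG hF e.inv
  hom_inv_id := h.hom_ext hF hF fun X => by
    rw [NatTrans.comp_app, extend_app, extend_app]
    exact e.hom_inv_id_app X
  inv_hom_id := h.hom_ext hG hG fun X => by
    rw [NatTrans.comp_app, extend_app, extend_app]
    exact e.inv_hom_id_app X

theorem exists_factor {B : Type u} [Category.{v} B] [Abelian B] [Linear k B] {H : A × A' ⥤ B}
    (hH : IsBiRightExact k H) : ∃ F : D ⥤ B, IsRightExact k F ∧ Nonempty (box ⋙ F ≅ H) := by
  have := h.isEquivalence_restrict B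
  let H' : (IsBiRightExact k (A := A) (A' := A') (B := B)).FullSubcategory := ⟨H, hH⟩
  let i := (restrict k box h.biRightExact B).objObjPreimageIso H'
  exact ⟨_, ((restrict k box h.biRightExact B).objPreimage H').property,
    ⟨(ObjectProperty.ι _).mapIso i⟩⟩

/-- Each product factors through the other, and the composites agree with the identities on product
objects. Both live in the same universes because the universal property tests only such targets. -/
theorem exists_equivalence {D' : Type u} [Category.{v} D'] [Abelian D'] [Linear k D']
    {box' : A × A' ⥤ D'} (h' : IsDeligneProduct k box') :
    ∃ e : D ≌ D', IsRightExact k e.functor ∧ Nonempty (box ⋙ e.functor ≅ box') := by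
  obtain ⟨F, hF, ⟨i⟩⟩ := h.exists_factor h'.biRightExact
  obtain ⟨G, hG, ⟨j⟩⟩ := h'.exists_factor h.biRightExact
  let η : 𝟭 D ≅ F ⋙ G := h.extendIso isRightExact_id (hF.comp hG)
    (Functor.rightUnitor _ ≪≫ j.symm ≪≫ Functor.isoWhiskerRight i.symm G ≪≫ Functor.associator _ _ _)
  let ε : G ⋙ F ≅ 𝟭 D' := h'.extendIso (hG.comp hF) isRightExact_id
    ((Functor.associator _ _ _).symm ≪≫ Functor.isoWhiskerRight j F ≪≫ i ≪≫
      (Functor.rightUnitor _).symm)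
  exact ⟨CategoryTheory.Equivalence.mk F G η ε, hF, ⟨i⟩⟩

end IsDeligneProduct

end DeligneEquivalence

/-! ### `P ⊠ P` generates every Deligne product. -/

section DeligneGenerator

variable {k : Type w} [Field k]
  {C : Type (max u (v + 1))} [Category.{v} C] [Abelian C] [Linear k C] {P : C}

/-- The universe of `C` is large enough for the lifted category of finitely generated modules to
share it. -/
theorem IsFiniteGenerator.exists_isDeligneProduct (hP : IsFiniteGenerator k P) :
    ∃ (D : Type (max u (v + 1))) (_ : Category.{v} D) (_ : Abelian D) (_ : Linear k D)
      (box : C × C ⥤ D), IsDeligneProduct k box ∧ IsFiniteGenerator k (box.obj (P, P)) := by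
  have := hP.projective
  have := hP.finite_hom_left
  have := finite_boxRing k P P
  have : IsNoetherianRing (boxRing k P P) := IsNoetherianRing.of_finite k _
  have := finite_boxModule k P P
  refine ⟨_, _, _, _, boxFunctor.{w, v, u} k P P,
    isDeligneProduct_boxFunctor k P P hP.covers hP.covers,
    FinMod.projective_of_bijective _ (smul_boxUnit_bijective.{w, v, u} k P P),
    FinMod.covers_of_bijective _ (smul_boxUnit_bijective.{w, v, u} k P P), ?_⟩
  have : Module.Finite k (End P) := hP.finite
  exact Module.Finite.of_surjective (endTensor P P (isBiRightExact_boxFunctor k P P)).toLinearMap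
    (endTensor_bijective k P P).surjective

/-- The property is read off in the module model and carried along the equivalence to an arbitrary
Deligne product. -/
theorem IsDeligneProduct.isFiniteGenerator (hP : IsFiniteGenerator k P)
    {D : Type (max u (v + 1))} [Category.{v} D] [Abelian D] [Linear k D] {box : C × C ⥤ D}
    (h : IsDeligneProduct k box) : IsFiniteGenerator k (box.obj (P, P)) := by
  obtain ⟨D₀, _, _, _, box₀, h₀, hQ⟩ := hP.exists_isDeligneProduct
  obtain ⟨e, he, ⟨i⟩⟩ := h₀.exists_equivalence h
  obtain ⟨_, _, _⟩ := he
  exact hQ.of_equivalence e (i.app (P, P))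

end DeligneGenerator

/-! ### Transformations determined by restriction, with parameters. -/

section Determined

variable {S : Type*} [Category* S] {D : Type*} [Category* D] {B : Type*} [Category* B]
  {J : Type*} [Category* J]

/-- Natural transformations `F ⟶ G` are determined by their restrictions along `box`. -/
def Determined (box : S ⥤ D) (F G : D ⥤ B) : Prop :=
  Function.Bijective fun α : F ⟶ G => Functor.whiskerLeft box α

variable {box : S ⥤ D}

theorem Determined.hom_ext {F G : D ⥤ B} (h : Determined box F G) {α β : F ⟶ G}
    (hαβ : ∀ p, α.app (box.obj p) = β.app (box.obj p)) : α = β :=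
  h.injective (NatTrans.ext (funext hαβ))

theorem Determined.exists_extension {F G : D ⥤ B} (h : Determined box F G)
    (a : ∀ p, F.obj (box.obj p) ⟶ G.obj (box.obj p))
    (ha : ∀ {p q : S} (f : p ⟶ q), F.map (box.map f) ≫ a q = a p ≫ G.map (box.map f)) :
    ∃ α : F ⟶ G, ∀ p, α.app (box.obj p) = a p := by
  obtain ⟨α, hα⟩ := h.surjective { app := a, naturality := fun _ _ f => ha f }
  exact ⟨α, fun p => congrArg (fun γ => γ.app p) hα⟩

/-- Extend for each `j` separately. Naturality in `j` is an equality of transformations from the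
functor at `i` to the functor at `j`, which is why `h` is needed for all pairs. -/
theorem Determined.curried {F G : D ⥤ J ⥤ B}
    (h : ∀ i j, Determined box (F.flip.obj i) (G.flip.obj j)) : Determined box F G := by
  refine ⟨fun α β hαβ => ?_, fun a => ?_⟩
  · ext X j
    have := (h j j).hom_ext (α := (flipFunctor _ _ _).map α |>.app j)
      (β := (flipFunctor _ _ _).map β |>.app j)
      (fun p => congrArg (fun γ => (γ.app p).app j) hαβ)
    exact congrArg (fun γ => γ.app X) this
  · choose α hα using fun j => (h j j).exists_extension (fun p => (a.app p).app j)
      (fun f => congrArg (fun γ => γ.app j) (a.naturality f))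
    have hnat {i j : J} (f : i ⟶ j) : F.flip.map f ≫ α j = α i ≫ G.flip.map f :=
      (h i j).hom_ext fun p => by
        rw [NatTrans.comp_app, NatTrans.comp_app, hα, hα]
        exact (a.app p).naturality f
    refine ⟨{ app := fun X => { app := fun j => (α j).app X
                                naturality := fun i j f => congrArg (fun γ => γ.app X) (hnat f) }
              naturality := fun X Y f => ?_ }, ?_⟩
    · ext j
      exact (α j).naturality f
    · ext p j
      exact hα j p

/-- Natural transformations between functors in the class `W` are determined by their restrictions
along `box`. -/
def Determines (box : S ⥤ D) (W : ObjectProperty (D ⥤ B)) : Prop :=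
  ∀ ⦃F G⦄, W F → W G → Determined box F G

/-- The class of functors in two variables which are in `W` in the first variable. -/
def curriedClass (W : ObjectProperty (D ⥤ B)) (J : Type*) [Category* J] :
    ObjectProperty (D ⥤ J ⥤ B) :=
  fun F => ∀ j, W (F.flip.obj j)

theorem Determines.curried {W : ObjectProperty (D ⥤ B)} (h : Determines box W) (J : Type*)
    [Category* J] : Determines box (curriedClass W J) :=
  fun _ _ hF hG => Determined.curried fun i j => h (hF i) (hG j)

theorem Determines.exists_iso {W : ObjectProperty (D ⥤ B)} (h : Determines box W)
    {F G : D ⥤ B} (hF : W F) (hG : W G) (a : ∀ p, F.obj (box.obj p) ≅ G.obj (box.obj p))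
    (ha : ∀ {p q : S} (f : p ⟶ q), F.map (box.map f) ≫ (a q).hom = (a p).hom ≫ G.map (box.map f)) :
    ∃ α : F ≅ G, ∀ p, α.hom.app (box.obj p) = (a p).hom := by
  obtain ⟨α, hα⟩ := (h hF hG).exists_extension (fun p => (a p).hom) ha
  obtain ⟨β, hβ⟩ := (h hG hF).exists_extension (fun p => (a p).inv)
    (fun f => by rw [Iso.comp_inv_eq, assoc, ha, Iso.inv_hom_id_assoc])
  exact ⟨⟨α, β, (h hF hF).hom_ext fun p => by simp [hα, hβ],
    (h hG hG).hom_ext fun p => by simp [hα, hβ]⟩, hα⟩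

variable {S' : Type*} [Category* S'] {D' : Type*} [Category* D'] {box' : S' ⥤ D'}
  {S'' : Type*} [Category* S''] {D'' : Type*} [Category* D''] {box'' : S'' ⥤ D''}
  {W : ObjectProperty (D ⥤ B)} {W' : ObjectProperty (D' ⥤ B)} {W'' : ObjectProperty (D'' ⥤ B)}

theorem Determines.hom_ext₂ (h : Determines box W) (h' : Determines box' W') {F G : D ⥤ D' ⥤ B}
    (hF : ∀ Y, W (F.flip.obj Y)) (hG : ∀ Y, W (G.flip.obj Y))
    (hF' : ∀ X, W' (F.obj X)) (hG' : ∀ X, W' (G.obj X)) {α β : F ⟶ G}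
    (hαβ : ∀ p q, (α.app (box.obj p)).app (box'.obj q) = (β.app (box.obj p)).app (box'.obj q)) :
    α = β :=
  (h.curried D' hF hG).hom_ext fun p => (h' (hF' _) (hG' _)).hom_ext (hαβ p)

/-- For each `p` extend in the second variable; the resulting isomorphisms of functors are then
extended in the first. -/
theorem Determines.exists_iso₂ (h : Determines box W) (h' : Determines box' W') {F G : D ⥤ D' ⥤ B}
    (hF : ∀ Y, W (F.flip.obj Y)) (hG : ∀ Y, W (G.flip.obj Y))
    (hF' : ∀ X, W' (F.obj X)) (hG' : ∀ X, W' (G.obj X))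
    (a : ∀ p q, (F.obj (box.obj p)).obj (box'.obj q) ≅ (G.obj (box.obj p)).obj (box'.obj q))
    (ha₁ : ∀ {p p' : S} (f : p ⟶ p') (q : S'), (F.map (box.map f)).app (box'.obj q) ≫ (a p' q).hom =
      (a p q).hom ≫ (G.map (box.map f)).app (box'.obj q))
    (ha₂ : ∀ (p : S) {q q' : S'} (f : q ⟶ q'), (F.obj (box.obj p)).map (box'.map f) ≫ (a p q').hom =
      (a p q).hom ≫ (G.obj (box.obj p)).map (box'.map f)) :
    ∃ α : F ≅ G, ∀ p q, (α.hom.app (box.obj p)).app (box'.obj q) = (a p q).hom := by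
  choose α hα using fun p => h'.exists_iso (hF' (box.obj p)) (hG' _) (a p) (ha₂ p)
  obtain ⟨β, hβ⟩ := (h.curried D').exists_iso hF hG α fun f =>
    (h' (hF' _) (hG' _)).hom_ext fun q => by
      rw [NatTrans.comp_app, NatTrans.comp_app, hα, hα, ha₁]
  exact ⟨β, fun p q => by rw [hβ, hα]⟩

theorem Determines.exists_iso₃ (h : Determines box W) (h' : Determines box' W')
    (h'' : Determines box'' W'') {F G : D ⥤ D' ⥤ D'' ⥤ B}
    (hF : ∀ Y Z, W ((F.flip.obj Y).flip.obj Z)) (hG : ∀ Y Z, W ((G.flip.obj Y).flip.obj Z))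
    (hF' : ∀ X Z, W' ((F.obj X).flip.obj Z)) (hG' : ∀ X Z, W' ((G.obj X).flip.obj Z))
    (hF'' : ∀ X Y, W'' ((F.obj X).obj Y)) (hG'' : ∀ X Y, W'' ((G.obj X).obj Y))
    (a : ∀ p q r, ((F.obj (box.obj p)).obj (box'.obj q)).obj (box''.obj r) ≅
      ((G.obj (box.obj p)).obj (box'.obj q)).obj (box''.obj r))
    (ha₁ : ∀ {p p' : S} (f : p ⟶ p') (q : S') (r : S''),
      ((F.map (box.map f)).app (box'.obj q)).app (box''.obj r) ≫ (a p' q r).hom =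
        (a p q r).hom ≫ ((G.map (box.map f)).app (box'.obj q)).app (box''.obj r))
    (ha₂ : ∀ (p : S) {q q' : S'} (f : q ⟶ q') (r : S''),
      ((F.obj (box.obj p)).map (box'.map f)).app (box''.obj r) ≫ (a p q' r).hom =
        (a p q r).hom ≫ ((G.obj (box.obj p)).map (box'.map f)).app (box''.obj r))
    (ha₃ : ∀ (p : S) (q : S') {r r' : S''} (f : r ⟶ r'),
      ((F.obj (box.obj p)).obj (box'.obj q)).map (box''.map f) ≫ (a p q r').hom =
        (a p q r).hom ≫ ((G.obj (box.obj p)).obj (box'.obj q)).map (box''.map f)) :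
    ∃ α : F ≅ G, ∀ p q r, ((α.hom.app (box.obj p)).app (box'.obj q)).app (box''.obj r) =
      (a p q r).hom := by
  choose α hα using fun p => h'.exists_iso₂ h'' (hF' (box.obj p)) (hG' _) (hF'' _) (hG'' _) (a p)
    (ha₂ p) (ha₃ p)
  obtain ⟨β, hβ⟩ := ((h.curried D'').curried D').exists_iso hF hG α fun f =>
    h'.hom_ext₂ h'' (hF' _) (hG' _) (hF'' _) (hG'' _) fun q r => by
      simp only [NatTrans.comp_app, hα, ha₁]
  exact ⟨β, fun p q r => by rw [hβ, hα]⟩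

end Determined

/-! ### A monoidal structure from an extended tensor product. -/

section TensorExtension

variable {S : Type*} [Category* S] [MonoidalCategory S] {D : Type*} [Category* D]

/-- A bifunctor on `D` extending the tensor product of a monoidal category along `box : S ⥤ D`,
which lies in a class of functors determined by their restrictions along `box`. -/
structure TensorExtension (box : S ⥤ D) (W : ObjectProperty (D ⥤ D)) where
  ten : D ⥤ D ⥤ D
  m (p q : S) : (ten.obj (box.obj p)).obj (box.obj q) ≅ box.obj (p ⊗ q)
  m_natural_left {p p' : S} (f : p ⟶ p') (q : S) :
    (ten.map (box.map f)).app (box.obj q) ≫ (m p' q).hom = (m p q).hom ≫ box.map (f ▷ q)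
  m_natural_right (p : S) {q q' : S} (f : q ⟶ q') :
    (ten.obj (box.obj p)).map (box.map f) ≫ (m p q').hom = (m p q).hom ≫ box.map (p ◁ f)
  ten_left (X : D) : W (ten.obj X)
  ten_right (X : D) : W (ten.flip.obj X)
  id_mem : W (𝟭 D)
  comp_mem {F G : D ⥤ D} : W F → W G → W (F ⋙ G)
  determines : Determines box W
  hom_ext {F : D ⥤ D} (hF : W F) {X Y : D} {f g : F.obj X ⟶ Y}
    (h : ∀ (p : S) (x : box.obj p ⟶ X), F.map x ≫ f = F.map x ≫ g) : f = g

namespace TensorExtension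

variable {box : S ⥤ D} {W : ObjectProperty (D ⥤ D)} (t : TensorExtension box W)

/-- The tensor product of objects. -/
def tobj (X Y : D) : D := (t.ten.obj X).obj Y

/-- Whiskering on the left. -/
def tl (X : D) {Y Y' : D} (f : Y ⟶ Y') : t.tobj X Y ⟶ t.tobj X Y' := (t.ten.obj X).map f

/-- Whiskering on the right. -/
def tr {X X' : D} (f : X ⟶ X') (Y : D) : t.tobj X Y ⟶ t.tobj X' Y := (t.ten.map f).app Y

theorem tl_comp (X : D) {Y Y' Y'' : D} (f : Y ⟶ Y') (g : Y' ⟶ Y'') :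
    t.tl X (f ≫ g) = t.tl X f ≫ t.tl X g := (t.ten.obj X).map_comp f g

theorem tr_comp {X X' X'' : D} (f : X ⟶ X') (g : X' ⟶ X'') (Y : D) :
    t.tr (f ≫ g) Y = t.tr f Y ≫ t.tr g Y :=
  congrArg (fun γ => γ.app Y) (t.ten.map_comp f g)

theorem tl_id (X Y : D) : t.tl X (𝟙 Y) = 𝟙 (t.tobj X Y) := (t.ten.obj X).map_id Y

theorem tr_id (X Y : D) : t.tr (𝟙 X) Y = 𝟙 (t.tobj X Y) :=
  congrArg (fun γ => γ.app Y) (t.ten.map_id X)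

theorem tr_tl {X X' Y Y' : D} (f : X ⟶ X') (g : Y ⟶ Y') :
    t.tr f Y ≫ t.tl X' g = t.tl X g ≫ t.tr f Y' := ((t.ten.map f).naturality g).symm

/-- Comparison with the tensor product of `S`. -/
def μ (p q : S) : t.tobj (box.obj p) (box.obj q) ≅ box.obj (p ⊗ q) := t.m p q

theorem μ_natural_left {p p' : S} (f : p ⟶ p') (q : S) :
    t.tr (box.map f) (box.obj q) ≫ (t.μ p' q).hom = (t.μ p q).hom ≫ box.map (f ▷ q) :=
  t.m_natural_left f q

theorem μ_natural_right (p : S) {q q' : S} (f : q ⟶ q') :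
    t.tl (box.obj p) (box.map f) ≫ (t.μ p q').hom = (t.μ p q).hom ≫ box.map (p ◁ f) :=
  t.m_natural_right p f

/-- Whiskering of isomorphisms on the left. -/
def tlIso (X : D) {Y Y' : D} (e : Y ≅ Y') : t.tobj X Y ≅ t.tobj X Y' := (t.ten.obj X).mapIso e

/-- Whiskering of isomorphisms on the right. -/
def trIso {X X' : D} (e : X ≅ X') (Y : D) : t.tobj X Y ≅ t.tobj X' Y := (t.ten.mapIso e).app Y

/-- The associator on objects in the image of `box`. -/
def assocBox (p q r : S) :
    t.tobj (t.tobj (box.obj p) (box.obj q)) (box.obj r) ≅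
      t.tobj (box.obj p) (t.tobj (box.obj q) (box.obj r)) :=
  t.trIso (t.μ p q) _ ≪≫ t.μ _ _ ≪≫ box.mapIso (α_ p q r) ≪≫ (t.μ _ _).symm ≪≫
    t.tlIso _ (t.μ q r).symm

theorem assocBox_hom (p q r : S) : (t.assocBox p q r).hom = t.tr (t.μ p q).hom _ ≫ (t.μ _ _).hom ≫
    box.map (α_ p q r).hom ≫ (t.μ _ _).inv ≫ t.tl _ (t.μ q r).inv := rfl

theorem tl_inv_hom (X : D) {Y Y' : D} (e : Y ≅ Y') : t.tl X e.inv ≫ t.tl X e.hom = 𝟙 _ := by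
  rw [← tl_comp, e.inv_hom_id, tl_id]

/-- A form without inverses: together with `cancel_μ₃` it lets identities of arrows between iterated
products be compared inside the image of `box`. -/
theorem assocBox_hom_comp (p q r : S) :
    (t.assocBox p q r).hom ≫ t.tl _ (t.μ q r).hom ≫ (t.μ _ _).hom =
      t.tr (t.μ p q).hom _ ≫ (t.μ _ _).hom ≫ box.map (α_ p q r).hom := by
  simp [assocBox_hom, reassoc_of% t.tl_inv_hom]

theorem cancel_μ₃ {p q r : S} {X : D}
    {f g : X ⟶ t.tobj (box.obj p) (t.tobj (box.obj q) (box.obj r))}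
    (h : f ≫ t.tl _ (t.μ q r).hom ≫ (t.μ _ _).hom = g ≫ t.tl _ (t.μ q r).hom ≫ (t.μ _ _).hom) :
    f = g := by
  have : IsIso (t.tl (box.obj p) (t.μ q r).hom) := (t.tlIso _ (t.μ q r)).isIso_hom
  rwa [← assoc, ← assoc, cancel_mono, cancel_mono] at h

/-- Both bracketings lie in `W` in each variable separately, so the isomorphism on the image of
`box` extends once it is natural there. -/
theorem exists_assoc : ∃ α : bifunctorComp₁₂ t.ten t.ten ≅ bifunctorComp₂₃ t.ten t.ten,
    ∀ p q r, ((α.hom.app (box.obj p)).app (box.obj q)).app (box.obj r) =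
      (t.assocBox p q r).hom := by
  refine t.determines.exists_iso₃ t.determines t.determines
    (F := bifunctorComp₁₂ t.ten t.ten) (G := bifunctorComp₂₃ t.ten t.ten)
    (fun Y Z => t.comp_mem (t.ten_right Y) (t.ten_right Z))
    (fun Y Z => t.ten_right (t.tobj Y Z))
    (fun X Z => t.comp_mem (t.ten_left X) (t.ten_right Z))
    (fun X Z => t.comp_mem (t.ten_right Z) (t.ten_left X))
    (fun X Y => t.ten_left (t.tobj X Y))
    (fun X Y => t.comp_mem (t.ten_left Y) (t.ten_left X)) t.assocBox
    (fun {p p'} f q r => t.cancel_μ₃ ?_) (fun p {q q'} f r => t.cancel_μ₃ ?_)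
    (fun p q {r r'} f => t.cancel_μ₃ ?_)
  · change (t.tr (t.tr (box.map f) (box.obj q)) (box.obj r) ≫ _) ≫ _ =
      (_ ≫ t.tr (box.map f) (t.tobj (box.obj q) (box.obj r))) ≫ _
    rw [assoc, assocBox_hom_comp, assoc, reassoc_of% t.tr_tl, μ_natural_left,
      ← reassoc_of% t.tr_comp,
      μ_natural_left, reassoc_of% assocBox_hom_comp, ← box.map_comp, reassoc_of% t.tr_comp,
      reassoc_of% t.μ_natural_left, ← box.map_comp, associator_naturality_left]
  · change (t.tr (t.tl (box.obj p) (box.map f)) (box.obj r) ≫ _) ≫ _ =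
      (_ ≫ t.tl (box.obj p) (t.tr (box.map f) (box.obj r))) ≫ _
    rw [assoc, assocBox_hom_comp, assoc, ← reassoc_of% t.tl_comp, μ_natural_left,
      reassoc_of% t.tl_comp,
      μ_natural_right, reassoc_of% assocBox_hom_comp, ← box.map_comp, ← reassoc_of% t.tr_comp,
      μ_natural_right, reassoc_of% t.tr_comp, reassoc_of% t.μ_natural_left, ← box.map_comp,
      associator_naturality_middle]
  · change (t.tl (t.tobj (box.obj p) (box.obj q)) (box.map f) ≫ _) ≫ _ =
      (_ ≫ t.tl (box.obj p) (t.tl (box.obj q) (box.map f))) ≫ _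
    rw [assoc, assocBox_hom_comp, assoc, ← reassoc_of% t.tl_comp, μ_natural_right,
      reassoc_of% t.tl_comp,
      μ_natural_right, reassoc_of% assocBox_hom_comp, ← box.map_comp, ← reassoc_of% t.tr_tl,
      reassoc_of% t.μ_natural_right, ← box.map_comp, associator_naturality_right]

/-- The left unitor on objects in the image of `box`. -/
def luBox (p : S) : t.tobj (box.obj (𝟙_ S)) (box.obj p) ≅ box.obj p :=
  t.μ (𝟙_ S) p ≪≫ box.mapIso (λ_ p)

/-- The right unitor on objects in the image of `box`. -/
def ruBox (p : S) : t.tobj (box.obj p) (box.obj (𝟙_ S)) ≅ box.obj p :=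
  t.μ p (𝟙_ S) ≪≫ box.mapIso (ρ_ p)

theorem exists_leftUnitor : ∃ l : t.ten.obj (box.obj (𝟙_ S)) ≅ 𝟭 D,
    ∀ p, l.hom.app (box.obj p) = (t.luBox p).hom := by
  refine t.determines.exists_iso (t.ten_left _) t.id_mem t.luBox fun {p q} f => ?_
  change t.tl (box.obj (𝟙_ S)) (box.map f) ≫ (t.luBox q).hom = (t.luBox p).hom ≫ box.map f
  simp only [luBox, Iso.trans_hom, Functor.mapIso_hom, assoc, reassoc_of% t.μ_natural_right,
    ← box.map_comp, leftUnitor_naturality]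

theorem exists_rightUnitor : ∃ r : t.ten.flip.obj (box.obj (𝟙_ S)) ≅ 𝟭 D,
    ∀ p, r.hom.app (box.obj p) = (t.ruBox p).hom := by
  refine t.determines.exists_iso (t.ten_right _) t.id_mem t.ruBox fun {p q} f => ?_
  change t.tr (box.map f) (box.obj (𝟙_ S)) ≫ (t.ruBox q).hom = (t.ruBox p).hom ≫ box.map f
  simp only [ruBox, Iso.trans_hom, Functor.mapIso_hom, assoc, reassoc_of% t.μ_natural_left,
    ← box.map_comp, rightUnitor_naturality]

/-- The associator. -/
def as (X Y Z : D) : t.tobj (t.tobj X Y) Z ≅ t.tobj X (t.tobj Y Z) :=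
  ((t.exists_assoc.choose.app X).app Y).app Z

/-- The left unitor. -/
def lu (X : D) : t.tobj (box.obj (𝟙_ S)) X ≅ X := t.exists_leftUnitor.choose.app X

/-- The right unitor. -/
def ru (X : D) : t.tobj X (box.obj (𝟙_ S)) ≅ X := t.exists_rightUnitor.choose.app X

theorem as_box (p q r : S) :
    (t.as (box.obj p) (box.obj q) (box.obj r)).hom ≫ t.tl _ (t.μ q r).hom ≫ (t.μ _ _).hom =
      t.tr (t.μ p q).hom _ ≫ (t.μ _ _).hom ≫ box.map (α_ p q r).hom := by
  rw [← assocBox_hom_comp]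
  exact congrArg (· ≫ _) (t.exists_assoc.choose_spec p q r)

theorem lu_box (p : S) : (t.lu (box.obj p)).hom = (t.μ (𝟙_ S) p).hom ≫ box.map (λ_ p).hom :=
  t.exists_leftUnitor.choose_spec p

theorem ru_box (p : S) : (t.ru (box.obj p)).hom = (t.μ p (𝟙_ S)).hom ≫ box.map (ρ_ p).hom :=
  t.exists_rightUnitor.choose_spec p

theorem lu_natural {X Y : D} (f : X ⟶ Y) :
    t.tl (box.obj (𝟙_ S)) f ≫ (t.lu Y).hom = (t.lu X).hom ≫ f :=
  t.exists_leftUnitor.choose.hom.naturality f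

theorem ru_natural {X Y : D} (f : X ⟶ Y) :
    t.tr f (box.obj (𝟙_ S)) ≫ (t.ru Y).hom = (t.ru X).hom ≫ f :=
  t.exists_rightUnitor.choose.hom.naturality f

theorem as_natural_left {X X' : D} (f : X ⟶ X') (Y Z : D) :
    t.tr (t.tr f Y) Z ≫ (t.as X' Y Z).hom = (t.as X Y Z).hom ≫ t.tr f (t.tobj Y Z) :=
  congrArg (fun γ => (γ.app Y).app Z) (t.exists_assoc.choose.hom.naturality f)

theorem as_natural_middle (X : D) {Y Y' : D} (f : Y ⟶ Y') (Z : D) :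
    t.tr (t.tl X f) Z ≫ (t.as X Y' Z).hom = (t.as X Y Z).hom ≫ t.tl X (t.tr f Z) :=
  congrArg (fun γ => γ.app Z) ((t.exists_assoc.choose.hom.app X).naturality f)

theorem as_natural_right (X Y : D) {Z Z' : D} (f : Z ⟶ Z') :
    t.tl (t.tobj X Y) f ≫ (t.as X Y Z').hom = (t.as X Y Z).hom ≫ t.tl X (t.tl Y f) :=
  ((t.exists_assoc.choose.hom.app X).app Y).naturality f

theorem hom_ext_tl {X Y Z : D} {f g : t.tobj X Y ⟶ Z}
    (h : ∀ (p : S) (y : box.obj p ⟶ Y), t.tl X y ≫ f = t.tl X y ≫ g) : f = g :=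
  t.hom_ext (t.ten_left X) h

/-- Naturality moves test arrows `box.obj p ⟶ X` and `box.obj q ⟶ Y` past both sides; what remains
is the triangle identity of `S`. -/
theorem triangle (X Y : D) : (t.as X (box.obj (𝟙_ S)) Y).hom ≫ t.tl X (t.lu Y).hom =
    t.tr (t.ru X).hom Y := by
  refine t.hom_ext (t.comp_mem (t.ten_right (box.obj (𝟙_ S))) (t.ten_right Y)) fun p x => ?_
  change t.tr (t.tr x _) Y ≫ _ = t.tr (t.tr x _) Y ≫ _
  rw [reassoc_of% t.as_natural_left, tr_tl, ← tr_comp, ru_natural, tr_comp, ← assoc]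
  congr 1
  refine t.hom_ext_tl fun q y => ?_
  rw [reassoc_of% t.as_natural_right, ← tl_comp, lu_natural, ← tr_tl, tl_comp, ← assoc]
  congr 1
  rw [← cancel_mono (t.μ p q).hom, assoc, lu_box, tl_comp, assoc, μ_natural_right,
    reassoc_of% t.as_box,
    ← box.map_comp, MonoidalCategory.triangle, ru_box, tr_comp, assoc, μ_natural_left]

/-- The four variables are replaced by objects `box.obj` one after another, each time sliding a test
arrow through both sides by naturality of the associator. -/
theorem pentagon (W X Y Z : D) :
    t.tr (t.as W X Y).hom Z ≫ (t.as W (t.tobj X Y) Z).hom ≫ t.tl W (t.as X Y Z).hom =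
      (t.as (t.tobj W X) Y Z).hom ≫ (t.as W X (t.tobj Y Z)).hom := by
  refine t.hom_ext (t.comp_mem (t.comp_mem (t.ten_right X) (t.ten_right Y)) (t.ten_right Z))
    fun p w => ?_
  change t.tr (t.tr (t.tr w _) _) Z ≫ _ = t.tr (t.tr (t.tr w _) _) Z ≫ _
  rw [← reassoc_of% t.tr_comp, as_natural_left, reassoc_of% t.tr_comp,
    reassoc_of% t.as_natural_left, tr_tl,
    reassoc_of% t.as_natural_left, as_natural_left, ← assoc, ← assoc, ← assoc]
  congr 1
  refine t.hom_ext (t.comp_mem (t.comp_mem (t.ten_left (box.obj p)) (t.ten_right Y))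
    (t.ten_right Z)) fun q x => ?_
  change t.tr (t.tr (t.tl _ x) _) Z ≫ _ = t.tr (t.tr (t.tl _ x) _) Z ≫ _
  rw [assoc, ← reassoc_of% t.tr_comp, as_natural_middle, reassoc_of% t.tr_comp,
    reassoc_of% t.as_natural_middle, ← tl_comp,
    as_natural_left, tl_comp, reassoc_of% t.as_natural_left, as_natural_middle, ← assoc, ← assoc,
    ← assoc]
  congr 1
  refine t.hom_ext (t.comp_mem (t.ten_left _) (t.ten_right Z)) fun r y => ?_
  change t.tr (t.tl _ y) Z ≫ _ = t.tr (t.tl _ y) Z ≫ _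
  rw [assoc, ← reassoc_of% t.tr_comp, as_natural_right, reassoc_of% t.tr_comp,
    reassoc_of% t.as_natural_middle, ← tl_comp,
    as_natural_middle, tl_comp, reassoc_of% t.as_natural_middle, as_natural_right, ← assoc,
    ← assoc, ← assoc]
  congr 1
  refine t.hom_ext_tl fun s z => ?_
  rw [assoc, ← reassoc_of% t.tr_tl, reassoc_of% t.as_natural_right, ← tl_comp, as_natural_right,
    tl_comp,
    reassoc_of% t.as_natural_right, as_natural_right, ← assoc, ← assoc, ← assoc]
  congr 1
  -- The comparison takes place in `box (p ⊗ (q ⊗ (r ⊗ s)))`, where the claim is the image of the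
  -- pentagon of `S`.
  apply (cancel_mono (t.tlIso (box.obj p) (t.tlIso (box.obj q) (t.μ r s))).hom).1
  apply t.cancel_μ₃
  change (((t.tr _ _ ≫ _) ≫ t.tl _ _) ≫ t.tl _ (t.tl _ _)) ≫ _ =
    ((_ ≫ _) ≫ t.tl _ (t.tl _ _)) ≫ _
  simp only [assoc]
  rw [← reassoc_of% t.tl_comp, ← reassoc_of% t.tl_comp, assoc, as_box, tl_comp, tl_comp, assoc,
    assoc,
    ← reassoc_of% t.as_natural_middle, μ_natural_right, reassoc_of% t.as_box,
    ← reassoc_of% t.tr_comp, ← reassoc_of% t.tr_comp,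
    assoc, as_box, tr_comp, tr_comp, assoc, assoc, reassoc_of% t.μ_natural_left,
    ← reassoc_of% t.as_natural_right, as_box, ← reassoc_of% t.tr_tl,
    ← reassoc_of% t.as_natural_left, reassoc_of% t.as_box,
    ← box.map_comp, ← box.map_comp, ← box.map_comp, MonoidalCategory.pentagon]

/-- The monoidal structure on `D` given by the extension of the tensor product. -/
@[reducible]
def monoidalCategory : MonoidalCategory D where
  tensorObj := t.tobj
  whiskerLeft X _ _ f := t.tl X f
  whiskerRight f Y := t.tr f Y
  tensorHom {_ Y₁ X₂ _} f g := t.tr f X₂ ≫ t.tl Y₁ g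
  tensorUnit := box.obj (𝟙_ S)
  associator := t.as
  leftUnitor := t.lu
  rightUnitor := t.ru
  tensorHom_def _ _ := rfl
  id_tensorHom_id X Y := by rw [tr_id, tl_id, comp_id]
  tensorHom_comp_tensorHom f₁ f₂ g₁ g₂ := by
    rw [tr_comp, tl_comp, assoc, assoc, ← reassoc_of% t.tr_tl]
  whiskerLeft_id := t.tl_id
  id_whiskerRight := t.tr_id
  associator_naturality f₁ f₂ f₃ := by
    rw [tr_comp, tl_comp, assoc, assoc, as_natural_right, reassoc_of% t.as_natural_middle,
      reassoc_of% t.as_natural_left]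
  leftUnitor_naturality := t.lu_natural
  rightUnitor_naturality := t.ru_natural
  pentagon := t.pentagon
  triangle := t.triangle

/-- `box` is strong monoidal. -/
@[reducible]
def boxMonoidal : letI := t.monoidalCategory; box.Monoidal :=
  letI := t.monoidalCategory
  Functor.CoreMonoidal.toMonoidal
    { εIso := Iso.refl _
      μIso := t.μ
      μIso_hom_natural_left := fun f q => t.μ_natural_left f q
      μIso_hom_natural_right := fun p f => t.μ_natural_right p f
      associativity := fun p q r => (t.as_box p q r).symm
      left_unitality := fun p => by
        refine (t.lu_box p).trans ?_
        change _ = t.tr (𝟙 _) _ ≫ _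
        rw [tr_id, id_comp]
      right_unitality := fun p => by
        refine (t.ru_box p).trans ?_
        change _ = t.tl _ (𝟙 _) ≫ _
        rw [tl_id, id_comp] }

end TensorExtension

end TensorExtension

/-! ### Extending braidings and monoidal structures on functors. -/

section MonoidalDetermined

variable {S : Type*} [Category* S] {D : Type*} [Category* D] {B : Type*} [Category* B]

/-- Morphisms out of the values of functors in `W` are detected by the objects `box.obj p`. -/
def Detects (box : S ⥤ D) (W : ObjectProperty (D ⥤ B)) : Prop :=
  ∀ ⦃F : D ⥤ B⦄, W F → ∀ ⦃X : D⦄ ⦃Y : B⦄ ⦃f g : F.obj X ⟶ Y⦄,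
    (∀ (p : S) (x : box.obj p ⟶ X), F.map x ≫ f = F.map x ≫ g) → f = g

variable [MonoidalCategory S] [MonoidalCategory D]

/-- The tensor product of `D` lies in a class of functors which are determined by their
restrictions along `box`. -/
structure TensorDetermined (box : S ⥤ D) (W : ObjectProperty (D ⥤ D)) : Prop where
  left (X : D) : W (tensorLeft X)
  right (X : D) : W (tensorRight X)
  comp_mem {F G : D ⥤ D} : W F → W G → W (F ⋙ G)
  determines : Determines box W
  detects : Detects box W

variable {box : S ⥤ D} {W : ObjectProperty (D ⥤ D)} (t : TensorDetermined box W)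

open Functor.LaxMonoidal Functor.Monoidal

variable [box.Monoidal]

include t in
theorem TensorDetermined.exists_braiding [BraidedCategory S] :
    ∃ b : ∀ X Y : D, X ⊗ Y ≅ Y ⊗ X,
      (∀ (X : D) {Y Z : D} (f : Y ⟶ Z), X ◁ f ≫ (b X Z).hom = (b X Y).hom ≫ f ▷ X) ∧
      (∀ {X Y : D} (f : X ⟶ Y) (Z : D), f ▷ Z ≫ (b Y Z).hom = (b X Z).hom ≫ Z ◁ f) ∧
      ∀ p q, (b (box.obj p) (box.obj q)).hom ≫ μ box q p = μ box p q ≫ box.map (β_ p q).hom := by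
  let a (p q : S) : box.obj p ⊗ box.obj q ≅ box.obj q ⊗ box.obj p :=
    μIso box p q ≪≫ box.mapIso (β_ p q) ≪≫ (μIso box q p).symm
  have ha (p q : S) : (a p q).hom ≫ μ box q p = μ box p q ≫ box.map (β_ p q).hom := by simp [a]
  obtain ⟨β, hβ⟩ := t.determines.exists_iso₂ t.determines
    (F := curriedTensor D) (G := (curriedTensor D).flip)
    (fun Y => t.right Y) (fun Y => t.left Y) (fun X => t.left X) (fun X => t.right X) a
    (fun {p p'} f q => by
      change (box.map f ▷ box.obj q) ≫ _ = _ ≫ (box.obj q ◁ box.map f)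
      rw [← cancel_mono (μ box q p'), assoc, ha, assoc, μ_natural_right, reassoc_of% ha,
        μ_natural_left_assoc, ← box.map_comp, ← box.map_comp,
        BraidedCategory.braiding_naturality_left])
    (fun p {q q'} f => by
      change (box.obj p ◁ box.map f) ≫ _ = _ ≫ (box.map f ▷ box.obj p)
      rw [← cancel_mono (μ box q' p), assoc, ha, assoc, μ_natural_left, reassoc_of% ha,
        μ_natural_right_assoc, ← box.map_comp, ← box.map_comp,
        BraidedCategory.braiding_naturality_right])
  exact ⟨fun X Y => (β.app X).app Y, fun X Y Z f => (β.hom.app X).naturality f,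
    fun f Z => congrArg (fun γ => γ.app Z) (β.hom.naturality f),
    fun p q => (congrArg (· ≫ _) (hβ p q)).trans (ha p q)⟩

include t in
-- Each hexagon is tested on the image of `box` one variable at a time; there the compatibility of
-- the braiding with `μ box` reduces it to the hexagon of `S`.
theorem TensorDetermined.exists_braidedCategory [BraidedCategory S] :
    ∃ _ : BraidedCategory D, ∀ p q, (β_ (box.obj p) (box.obj q)).hom ≫ μ box q p =
      μ box p q ≫ box.map (β_ p q).hom := by
  obtain ⟨b, hr, hl, hb⟩ := t.exists_braiding
  refine ⟨{ braiding := b, braiding_naturality_right := hr, braiding_naturality_left := hl,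
            hexagon_forward := fun X Y Z => ?_, hexagon_reverse := fun X Y Z => ?_ }, hb⟩
  · refine t.detects (t.comp_mem (t.right Y) (t.right Z)) fun p x => ?_
    change (x ▷ Y) ▷ Z ≫ _ = (x ▷ Y) ▷ Z ≫ _
    rw [associator_naturality_left_assoc, reassoc_of% hl, associator_naturality_right,
      ← comp_whiskerRight_assoc, hl, comp_whiskerRight_assoc, associator_naturality_middle_assoc,
      ← MonoidalCategory.whiskerLeft_comp, hl, MonoidalCategory.whiskerLeft_comp, ← assoc, ← assoc,
      ← assoc, ← assoc]
    congr 1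
    refine t.detects (t.comp_mem (t.left _) (t.right Z)) fun q y => ?_
    change (_ ◁ y) ▷ Z ≫ _ = (_ ◁ y) ▷ Z ≫ _
    simp only [assoc]
    rw [associator_naturality_middle_assoc, reassoc_of% hr, associator_naturality_left,
      ← comp_whiskerRight_assoc, hr, comp_whiskerRight_assoc, associator_naturality_left_assoc,
      ← whisker_exchange, ← assoc, ← assoc, ← assoc, ← assoc]
    congr 1
    refine t.detects (t.left _) fun r z => ?_
    change _ ◁ z ≫ _ = _ ◁ z ≫ _
    simp only [assoc]
    rw [associator_naturality_right_assoc, reassoc_of% hr, associator_naturality_middle,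
      whisker_exchange_assoc, associator_naturality_right_assoc,
      ← MonoidalCategory.whiskerLeft_comp, hr, MonoidalCategory.whiskerLeft_comp, ← assoc, ← assoc,
      ← assoc, ← assoc]
    congr 1
    rw [← cancel_mono (box.obj q ◁ μ box r p), ← cancel_mono (μ box _ _)]
    simp only [assoc]
    rw [← associativity, ← reassoc_of% hr, reassoc_of% hb, ← associativity_assoc,
      ← MonoidalCategory.whiskerLeft_comp_assoc, hb, MonoidalCategory.whiskerLeft_comp_assoc,
      μ_natural_right, ← associativity_assoc, ← comp_whiskerRight_assoc, hb,
      comp_whiskerRight_assoc, μ_natural_left_assoc, ← box.map_comp, ← box.map_comp,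
      ← box.map_comp, ← box.map_comp, BraidedCategory.hexagon_forward]
  -- The inverse associators at the outer ends are moved away first, so that the naturality
  -- rewriting runs as for the other hexagon.
  · rw [Iso.inv_comp_eq, ← cancel_mono (α_ Z X Y).hom]
    simp only [assoc, Iso.inv_hom_id, comp_id]
    refine t.detects (t.comp_mem (t.right Y) (t.right Z)) fun p x => ?_
    change (x ▷ Y) ▷ Z ≫ _ = (x ▷ Y) ▷ Z ≫ _
    rw [hl, associator_naturality_left_assoc, ← whisker_exchange_assoc,
      associator_inv_naturality_left_assoc, ← comp_whiskerRight_assoc, hl, comp_whiskerRight_assoc,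
      associator_naturality_middle]
    simp only [← assoc]
    congr 1
    refine t.detects (t.comp_mem (t.left _) (t.right Z)) fun q y => ?_
    change (_ ◁ y) ▷ Z ≫ _ = (_ ◁ y) ▷ Z ≫ _
    simp only [assoc]
    rw [hl, associator_naturality_middle_assoc, ← MonoidalCategory.whiskerLeft_comp_assoc, hl,
      MonoidalCategory.whiskerLeft_comp_assoc, associator_inv_naturality_right_assoc,
      whisker_exchange_assoc, associator_naturality_right]
    simp only [← assoc]
    congr 1
    refine t.detects (t.left _) fun r z => ?_
    change _ ◁ z ≫ _ = _ ◁ z ≫ _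
    simp only [assoc]
    rw [hr, associator_naturality_right_assoc, ← MonoidalCategory.whiskerLeft_comp_assoc, hr,
      MonoidalCategory.whiskerLeft_comp_assoc, associator_inv_naturality_middle_assoc,
      ← comp_whiskerRight_assoc, hr, comp_whiskerRight_assoc, associator_naturality_left]
    simp only [← assoc]
    congr 1
    simp only [assoc]
    rw [← cancel_mono (box.obj r ◁ μ box p q), ← cancel_mono (μ box _ _)]
    simp only [assoc]
    have hα : ∀ p q r : S, box.obj p ◁ μ box q r ≫ μ box p (q ⊗ r) ≫ box.map (α_ p q r).inv =
        (α_ _ _ _).inv ≫ μ box p q ▷ box.obj r ≫ μ box (p ⊗ q) r := fun p q r => by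
      rw [← cancel_mono (box.map (α_ p q r).hom)]
      simp
    have hβ : box.obj p ◁ (b (box.obj q) (box.obj r)).hom ≫ (α_ _ _ _).inv ≫
        μ box p r ▷ box.obj q ≫ μ box (p ⊗ r) q =
        box.obj p ◁ μ box q r ≫ μ box p (q ⊗ r) ≫ box.map (p ◁ (β_ q r).hom ≫ (α_ p r q).inv) := by
      rw [← hα, ← MonoidalCategory.whiskerLeft_comp_assoc, hb,
        MonoidalCategory.whiskerLeft_comp_assoc, μ_natural_right_assoc, ← box.map_comp]
    rw [← reassoc_of% hl, hb, ← associativity, ← comp_whiskerRight_assoc, hb,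
      comp_whiskerRight_assoc, μ_natural_left_assoc, reassoc_of% hβ, ← associativity_assoc,
      ← box.map_comp, ← box.map_comp, ← box.map_comp]
    have := BraidedCategory.hexagon_reverse p q r
    rw [Iso.inv_comp_eq, ← cancel_mono (α_ r p q).hom] at this
    simp only [assoc, Iso.inv_hom_id, comp_id] at this
    rw [this]
    simp only [assoc]

variable {W' : ObjectProperty (D ⥤ B)} [MonoidalCategory B]

include t in
/-- A functor out of `D` is strong monoidal if its restriction along `box` is. -/
theorem TensorDetermined.exists_monoidal (hdet : Determines box W') (hext : Detects box W')
    {T : D ⥤ B} {H : S ⥤ B} [H.Monoidal] (hT : ∀ {F}, W F → W' (F ⋙ T))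
    (hl : ∀ b, W' (T ⋙ tensorLeft b)) (hr : ∀ b, W' (T ⋙ tensorRight b))
    (hrr : ∀ b c, W' (T ⋙ tensorRight b ⋙ tensorRight c))
    (hlr : ∀ b c, W' (T ⋙ tensorLeft b ⋙ tensorRight c))
    (τ : box ⋙ T ≅ H) :
    ∃ _ : T.Monoidal, ε T ≫ T.map (ε box) ≫ τ.hom.app (𝟙_ S) = ε H ∧
      ∀ p q, μ T (box.obj p) (box.obj q) ≫ T.map (μ box p q) ≫ τ.hom.app (p ⊗ q) =
        (τ.hom.app p ⊗ₘ τ.hom.app q) ≫ μ H p q := by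
  let τ' (p : S) : T.obj (box.obj p) ≅ H.obj p := τ.app p
  have hτ {p q : S} (f : p ⟶ q) : T.map (box.map f) ≫ (τ' q).hom = (τ' p).hom ≫ H.map f :=
    τ.hom.naturality f
  -- On product objects the comparison is forced by the compatibility with `τ` and `H`.
  let a (p q : S) : T.obj (box.obj p) ⊗ T.obj (box.obj q) ≅ T.obj (box.obj p ⊗ box.obj q) :=
    (τ' p ⊗ᵢ τ' q) ≪≫ μIso H p q ≪≫ (τ' _).symm ≪≫ T.mapIso (μIso box p q).symm
  have ha (p q : S) : (a p q).hom ≫ T.map (μ box p q) ≫ (τ' (p ⊗ q)).hom =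
      ((τ' p).hom ⊗ₘ (τ' q).hom) ≫ μ H p q := by
    simp [a, ← T.map_comp_assoc]
  have hcancel {p q : S} {X : B} {f g : X ⟶ T.obj (box.obj p ⊗ box.obj q)}
      (h : f ≫ T.map (μ box p q) ≫ (τ' (p ⊗ q)).hom = g ≫ T.map (μ box p q) ≫ (τ' (p ⊗ q)).hom) :
      f = g := by
    rwa [← assoc, ← assoc, cancel_mono, cancel_mono] at h
  obtain ⟨m', hm'⟩ := hdet.exists_iso₂ hdet
    (F := T ⋙ curriedTensor B ⋙ (Functor.whiskeringLeft _ _ _).obj T)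
    (G := curriedTensor D ⋙ (Functor.whiskeringRight _ _ _).obj T)
    (fun Y => hr (T.obj Y)) (fun Y => hT (t.right Y)) (fun X => hl (T.obj X))
    (fun X => hT (t.left X)) a
    (fun {p p'} f q => hcancel <| by
      change (T.map (box.map f) ▷ T.obj (box.obj q) ≫ _) ≫ _ =
        (_ ≫ T.map (box.map f ▷ box.obj q)) ≫ _
      rw [assoc, ha, assoc, ← T.map_comp_assoc, μ_natural_left, T.map_comp_assoc, hτ,
        reassoc_of% ha, ← μ_natural_left, ← tensorHom_id, ← tensorHom_id,
        tensorHom_comp_tensorHom_assoc, tensorHom_comp_tensorHom_assoc, hτ, id_comp, comp_id])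
    (fun p {q q'} f => hcancel <| by
      change (T.obj (box.obj p) ◁ T.map (box.map f) ≫ _) ≫ _ =
        (_ ≫ T.map (box.obj p ◁ box.map f)) ≫ _
      rw [assoc, ha, assoc, ← T.map_comp_assoc, μ_natural_right, T.map_comp_assoc, hτ,
        reassoc_of% ha, ← μ_natural_right, ← id_tensorHom, ← id_tensorHom,
        tensorHom_comp_tensorHom_assoc, tensorHom_comp_tensorHom_assoc, hτ, id_comp, comp_id])
  obtain ⟨m, ml, mr, hm⟩ : ∃ m : ∀ X Y : D, T.obj X ⊗ T.obj Y ≅ T.obj (X ⊗ Y),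
    (∀ {X X' : D} (f : X ⟶ X') (Y : D),
      T.map f ▷ T.obj Y ≫ (m X' Y).hom = (m X Y).hom ≫ T.map (f ▷ Y)) ∧
    (∀ (X : D) {Y Y' : D} (f : Y ⟶ Y'),
      T.obj X ◁ T.map f ≫ (m X Y').hom = (m X Y).hom ≫ T.map (X ◁ f)) ∧
    ∀ p q, (m (box.obj p) (box.obj q)).hom ≫ T.map (μ box p q) ≫ (τ' (p ⊗ q)).hom =
      ((τ' p).hom ⊗ₘ (τ' q).hom) ≫ μ H p q :=
    ⟨fun X Y => (m'.app X).app Y,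
      fun f Y => congrArg (fun γ => γ.app Y) (m'.hom.naturality f),
      fun X Y Y' f => (m'.hom.app X).naturality f,
      fun p q => (congrArg (· ≫ _) (hm' p q)).trans (ha p q)⟩
  let e : 𝟙_ B ≅ T.obj (𝟙_ D) := εIso H ≪≫ (τ' _).symm ≪≫ T.mapIso (εIso box).symm
  have he : e.hom ≫ T.map (ε box) ≫ (τ' (𝟙_ S)).hom = ε H := by
    simp [e, ← T.map_comp_assoc]
  refine ⟨Functor.CoreMonoidal.toMonoidal
    { εIso := e
      μIso := m
      μIso_hom_natural_left := fun f Y => ml f Y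
      μIso_hom_natural_right := fun X f => mr X f
      associativity := fun X Y Z => ?_
      left_unitality := fun X => ?_
      right_unitality := fun X => ?_ }, he, hm⟩
  · refine hext (hrr (T.obj Y) (T.obj Z)) fun p x => ?_
    change (T.map x ▷ _) ▷ _ ≫ _ = (T.map x ▷ _) ▷ _ ≫ _
    rw [← comp_whiskerRight_assoc, ml, comp_whiskerRight_assoc, reassoc_of% ml, ← T.map_comp,
      associator_naturality_left, T.map_comp, associator_naturality_left_assoc,
      ← whisker_exchange_assoc, ml]
    simp only [← assoc]
    congr 1
    refine hext (hlr (T.obj (box.obj p)) (T.obj Z)) fun q y => ?_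
    change (_ ◁ T.map y) ▷ _ ≫ _ = (_ ◁ T.map y) ▷ _ ≫ _
    simp only [assoc]
    rw [← comp_whiskerRight_assoc, mr, comp_whiskerRight_assoc, reassoc_of% ml, ← T.map_comp,
      associator_naturality_middle, T.map_comp, associator_naturality_middle_assoc,
      ← MonoidalCategory.whiskerLeft_comp_assoc, ml, MonoidalCategory.whiskerLeft_comp_assoc, mr]
    simp only [← assoc]
    congr 1
    refine hext (hl (T.obj (box.obj p) ⊗ T.obj (box.obj q))) fun r z => ?_
    change _ ◁ T.map z ≫ _ = _ ◁ T.map z ≫ _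
    simp only [assoc]
    rw [whisker_exchange_assoc, reassoc_of% mr, ← T.map_comp,
      associator_naturality_right, T.map_comp, associator_naturality_right_assoc,
      ← MonoidalCategory.whiskerLeft_comp_assoc, mr, MonoidalCategory.whiskerLeft_comp_assoc, mr]
    simp only [← assoc]
    congr 1
    rw [← cancel_mono (T.map (box.obj p ◁ μ box q r)), ← cancel_mono (T.map (μ box _ _)),
      ← cancel_mono (τ' _).hom]
    simp only [assoc]
    have h₁ : T.map (α_ (box.obj p) (box.obj q) (box.obj r)).hom ≫
        T.map (box.obj p ◁ μ box q r) ≫ T.map (μ box p (q ⊗ r)) ≫ (τ' (p ⊗ q ⊗ r)).hom =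
        T.map (μ box p q ▷ box.obj r) ≫ T.map (μ box (p ⊗ q) r) ≫ (τ' _).hom ≫
          H.map (α_ p q r).hom := by
      rw [← hτ]
      simp only [← T.map_comp_assoc]
      rw [associativity]
    rw [h₁, ← reassoc_of% ml, reassoc_of% hm, ← reassoc_of% mr, hm,
      MonoidalCategory.tensorHom_def, MonoidalCategory.tensorHom_def']
    simp only [assoc]
    simp only [← MonoidalCategory.whiskerLeft_comp_assoc, ← comp_whiskerRight_assoc]
    rw [hm, hm]
    simp only [comp_whiskerRight, MonoidalCategory.whiskerLeft_comp, assoc]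
    rw [← whisker_exchange_assoc, whisker_exchange_assoc (τ' p).hom (μ H q r), associativity,
      ← MonoidalCategory.tensorHom_def_assoc, ← MonoidalCategory.tensorHom_def'_assoc,
      associator_naturality_assoc]
  · refine hext (hl (𝟙_ B)) fun p x => ?_
    change _ ◁ T.map x ≫ _ = _ ◁ T.map x ≫ _
    rw [leftUnitor_naturality, whisker_exchange_assoc, reassoc_of% mr, ← T.map_comp,
      leftUnitor_naturality, T.map_comp]
    simp only [← assoc]
    congr 1
    simp only [assoc]
    rw [← cancel_mono (τ' p).hom, left_unitality box, T.map_comp, T.map_comp,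
      ← leftUnitor_naturality,
      left_unitality H, ← he]
    simp only [assoc]
    rw [hτ, ← reassoc_of% ml, reassoc_of% hm, MonoidalCategory.tensorHom_def]
    simp only [comp_whiskerRight, assoc]
    rw [whisker_exchange_assoc, whisker_exchange_assoc, whisker_exchange_assoc]
  · refine hext (hr (𝟙_ B)) fun p x => ?_
    change T.map x ▷ _ ≫ _ = T.map x ▷ _ ≫ _
    rw [rightUnitor_naturality, ← whisker_exchange_assoc, reassoc_of% ml, ← T.map_comp,
      rightUnitor_naturality, T.map_comp]
    simp only [← assoc]
    congr 1
    simp only [assoc]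
    rw [← cancel_mono (τ' p).hom, right_unitality box, T.map_comp, T.map_comp,
      ← rightUnitor_naturality, right_unitality H, ← he]
    simp only [assoc]
    rw [hτ, ← reassoc_of% mr, reassoc_of% hm, MonoidalCategory.tensorHom_def]
    simp only [MonoidalCategory.whiskerLeft_comp, assoc]
    rw [← whisker_exchange_assoc, ← whisker_exchange_assoc, ← whisker_exchange_assoc]

end MonoidalDetermined

/-! ### Right exactness in parameters. -/

section TensorExtension

variable {k : Type w} [Field k]

section Flip

variable {J : Type u₁} [Category.{v₁} J] [Abelian J] [Linear k J]
  {D : Type u₂} [Category.{v₂} D] [Abelian D] [Linear k D]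
  {B : Type u₃} [Category.{v₃} B] [Abelian B] [Linear k B]

/-- A bifunctor which is right exact in the second variable is right exact in the first variable if
it is so at an object which covers. -/
theorem isRightExact_flip_obj {Q : D} [Projective Q] (hQ : Covers Q) {G : J ⥤ D ⥤ B}
    (hG : ∀ j, IsRightExact k (G.obj j)) (h : IsRightExact k (G.flip.obj Q)) (X : D) :
    IsRightExact k (G.flip.obj X) := by
  obtain ⟨_, _, _⟩ := h
  have (j : J) : (G.obj j).Additive := (hG j).1
  have (j : J) : (G.obj j).Linear k := (hG j).2.1
  have hu (j : J) (X : D) : IsUniversal (mapEndAlgHom k (G.obj j) Q)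
      (fun x : Q ⟶ X => (G.obj j).map x) := by
    have := (hG j).2.2
    exact IsUniversal.of_rightExact hQ (G.obj j) X
  have nat {i j : J} (f : i ⟶ j) (x : Q ⟶ X) :
      (G.obj i).map x ≫ (G.map f).app X = (G.map f).app Q ≫ (G.obj j).map x :=
    (G.map f).naturality x
  have add {i j : J} (f g : i ⟶ j) :
      (G.map (f + g)).app Q = (G.map f).app Q + (G.map g).app Q :=
    (G.flip.obj Q).map_add
  have smul {i j : J} (a : k) (f : i ⟶ j) : (G.map (a • f)).app Q = a • (G.map f).app Q :=
    Functor.Linear.map_smul (F := G.flip.obj Q) f a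
  have : (G.flip.obj X).Additive := ⟨fun {i j f g} => (hu i X).hom_ext fun x => by
    change (G.obj i).map x ≫ (G.map (f + g)).app X =
      (G.obj i).map x ≫ ((G.map f).app X + (G.map g).app X)
    rw [nat, add, Preadditive.comp_add, nat, nat, Preadditive.add_comp]⟩
  refine ⟨this, ⟨fun {i j} f a => (hu i X).hom_ext fun x => ?_⟩,
    preservesFiniteColimits_of_cokernel _ fun {i j} f {b} g hg => ?_⟩
  · change (G.obj i).map x ≫ (G.map (a • f)).app X = (G.obj i).map x ≫ (a • (G.map f).app X)
    rw [nat, smul, Linear.comp_smul, nat, Linear.smul_comp]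
  · change (G.map f).app X ≫ g = 0 at hg
    have hepi : Epi ((G.map (cokernel.π f)).app Q) :=
      inferInstanceAs (Epi ((G.flip.obj Q).map (cokernel.π f)))
    -- Each component `G(j)(x) ≫ g` descends to the cokernel at `Q`. The descended arrows form a
    -- family, and universality at `X` reassembles them.
    choose s hs using fun x : Q ⟶ X => exists_desc_of_comp_eq_zero (G.flip.obj Q) (f := f)
      (p := cokernel.π f) (cokernel.condition f)
      (fun g hg => ⟨cokernel.desc f g hg, cokernel.π_desc _ _ _⟩) ((G.obj j).map x ≫ g) (by
        change (G.map f).app Q ≫ (G.obj j).map x ≫ g = 0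
        rw [← reassoc_of% nat, hg, comp_zero])
    change ∀ x, (G.map (cokernel.π f)).app Q ≫ s x = _ at hs
    obtain ⟨s', hs', -⟩ := (hu (cokernel f) X).existsUnique s
      { add := fun x y => by
          rw [← cancel_epi ((G.map (cokernel.π f)).app Q), hs, Preadditive.comp_add, hs, hs,
            Functor.map_add, Preadditive.add_comp]
        comp := fun a x => by
          change s (a ≫ x) = (G.obj (cokernel f)).map a ≫ s x
          rw [← cancel_epi ((G.map (cokernel.π f)).app Q), hs, ← (G.map _).naturality_assoc, hs,
            Functor.map_comp, assoc] }
    refine ⟨s', (hu j X).hom_ext fun x => ?_, fun s'' hs'' => (hu _ X).hom_ext fun x => ?_⟩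
    · change (G.obj j).map x ≫ (G.map (cokernel.π f)).app X ≫ s' = _
      rw [reassoc_of% nat, hs', hs]
    · change (G.map (cokernel.π f)).app X ≫ s'' = g at hs''
      rw [hs', ← cancel_epi ((G.map (cokernel.π f)).app Q), hs, ← reassoc_of% nat, hs'']

end Flip

variable {A : Type u₁} [Category.{v₁} A] [Abelian A] [Linear k A]
  {A' : Type u₂} [Category.{v₂} A'] [Abelian A'] [Linear k A']
  {D : Type u} [Category.{v} D] [Abelian D] [Linear k D] {box : A × A' ⥤ D}
  {B : Type u} [Category.{v} B] [Abelian B] [Linear k B]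

namespace IsDeligneProduct

theorem determines (h : IsDeligneProduct k box) :
    Determines box (IsRightExact k (D := D) (B := B)) :=
  fun _ _ hF hG => ⟨fun _ _ hαβ => h.hom_ext hF hG fun p => congrArg (fun γ => γ.app p) hαβ,
    fun a => ⟨h.extend hF hG a, NatTrans.ext (funext fun p => h.extend_app hF hG a p)⟩⟩

theorem detects {p : A × A'} (hp : Covers (box.obj p)) :
    Detects box (IsRightExact k (D := D) (B := B)) := fun F hF _ _ _ _ hfg => by
  obtain ⟨_, _, _⟩ := hF
  exact hp.hom_ext_map F (hfg p)

/-- Functors in two variables extend from product objects, with parameters. -/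
theorem exists_factor_functor (h : IsDeligneProduct k box) {J : Type*} [Category* J]
    (H : J ⥤ A × A' ⥤ B) (hH : ∀ j, IsBiRightExact k (H.obj j)) :
    ∃ (N : J ⥤ D ⥤ B) (_ : ∀ j, IsRightExact k (N.obj j))
      (i : ∀ j p, (N.obj j).obj (box.obj p) ≅ (H.obj j).obj p),
      (∀ {j j'} (f : j ⟶ j') p, (N.map f).app (box.obj p) ≫ (i j' p).hom =
        (i j p).hom ≫ (H.map f).app p) ∧
      ∀ j {p q} (g : p ⟶ q), (N.obj j).map (box.map g) ≫ (i j q).hom =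
        (i j p).hom ≫ (H.obj j).map g := by
  choose N hN i using fun j => h.exists_factor (hH j)
  have i := fun j => (i j).some
  let m {j j' : J} (f : j ⟶ j') : N j ⟶ N j' :=
    h.extend (hN j) (hN j') ((i j).hom ≫ H.map f ≫ (i j').inv)
  have hm {j j' : J} (f : j ⟶ j') (p : A × A') : (m f).app (box.obj p) =
      (i j).hom.app p ≫ (H.map f).app p ≫ (i j').inv.app p := h.extend_app _ _ _ p
  refine ⟨{ obj := N, map := m, map_id := fun j => h.hom_ext (hN _) (hN _) fun p => ?_,
            map_comp := fun f g => h.hom_ext (hN _) (hN _) fun p => ?_ }, hN,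
    fun j p => (i j).app p, fun f p => ?_, fun j {p q} g => (i j).hom.naturality g⟩
  · rw [hm]
    simp
  · rw [hm, NatTrans.comp_app, hm, hm]
    simp
  · change (m f).app (box.obj p) ≫ (i _).hom.app p = _
    rw [hm]
    simp

end IsDeligneProduct

end TensorExtension

/-! ### The tensor product on a Deligne product. -/

section DeligneTensor

variable {k : Type w} [Field k] {C : Type u} [Category.{v} C] [Abelian C] [Linear k C]
  [MonoidalCategory C] [MonoidalPreadditive C] [MonoidalLinear k C]
  [∀ X : C, PreservesFiniteColimits (tensorLeft X)]
  [∀ X : C, PreservesFiniteColimits (tensorRight X)]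
  {D : Type u} [Category.{v} D] [Abelian D] [Linear k D] {box : C × C ⥤ D}

variable (k) in
theorem isRightExact_tensorLeft (X : C) : IsRightExact k (tensorLeft X) :=
  ⟨inferInstance, inferInstance, inferInstance⟩

variable (k) in
theorem isRightExact_tensorRight (X : C) : IsRightExact k (tensorRight X) :=
  ⟨inferInstance, inferInstance, inferInstance⟩

variable (k C) in
theorem isBiRightExact_tensor : IsBiRightExact k (tensor C) :=
  ⟨fun Y => IsRightExact.of_iso (F := tensorRight Y)
      (NatIso.ofComponents (fun _ => Iso.refl _) fun f => (comp_id _).trans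
        (Eq.trans ((tensorHom_id f Y).symm) (id_comp _).symm))
      (isRightExact_tensorRight k Y),
    fun X => IsRightExact.of_iso (F := tensorLeft X)
      (NatIso.ofComponents (fun _ => Iso.refl _) fun f => (comp_id _).trans
        (Eq.trans ((id_tensorHom X f).symm) (id_comp _).symm))
      (isRightExact_tensorLeft k X)⟩

theorem IsBiRightExact.tensorLeft_comp (h : IsBiRightExact k box) (p : C × C) :
    IsBiRightExact k (tensorLeft p ⋙ box) :=
  ⟨fun Y => IsRightExact.of_iso (F := tensorLeft p.1 ⋙ Prod.sectL C (p.2 ⊗ Y) ⋙ box)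

      (NatIso.ofComponents (fun _ => Iso.refl _) fun f => (comp_id _).trans
        (Eq.trans (congrArg (fun g => box.map (Prod.mkHom (p.1 ◁ f) g))
          (MonoidalCategory.whiskerLeft_id p.2 Y).symm) (id_comp _).symm))
      ((isRightExact_tensorLeft k p.1).comp (h.1 (p.2 ⊗ Y))),
    fun X => IsRightExact.of_iso (F := tensorLeft p.2 ⋙ Prod.sectR (p.1 ⊗ X) C ⋙ box)

      (NatIso.ofComponents (fun _ => Iso.refl _) fun f => (comp_id _).trans
        (Eq.trans (congrArg (fun g => box.map (Prod.mkHom g (p.2 ◁ f)))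
          (MonoidalCategory.whiskerLeft_id p.1 X).symm) (id_comp _).symm))
      ((isRightExact_tensorLeft k p.2).comp (h.2 (p.1 ⊗ X)))⟩

theorem IsBiRightExact.tensorRight_comp (h : IsBiRightExact k box) (p : C × C) :
    IsBiRightExact k (tensorRight p ⋙ box) :=
  ⟨fun Y => IsRightExact.of_iso (F := tensorRight p.1 ⋙ Prod.sectL C (Y ⊗ p.2) ⋙ box)

      (NatIso.ofComponents (fun _ => Iso.refl _) fun f => (comp_id _).trans
        (Eq.trans (congrArg (fun g => box.map (Prod.mkHom (f ▷ p.1) g))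
          (id_whiskerRight Y p.2).symm) (id_comp _).symm))
      ((isRightExact_tensorRight k p.1).comp (h.1 (Y ⊗ p.2))),
    fun X => IsRightExact.of_iso (F := tensorRight p.2 ⋙ Prod.sectR (X ⊗ p.1) C ⋙ box)

      (NatIso.ofComponents (fun _ => Iso.refl _) fun f => (comp_id _).trans
        (Eq.trans (congrArg (fun g => box.map (Prod.mkHom g (f ▷ p.2)))
          (id_whiskerRight X p.1).symm) (id_comp _).symm))
      ((isRightExact_tensorRight k p.2).comp (h.2 (X ⊗ p.1)))⟩

/-- The functors `p ⊗ -` are extended first, with `p` in `C × C` as a parameter; the result is then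
extended in that parameter. -/
theorem IsDeligneProduct.nonempty_tensorExtension (h : IsDeligneProduct k box) {q₀ : C × C}
    (hQ : IsFiniteGenerator k (box.obj q₀)) :
    Nonempty (TensorExtension box (IsRightExact k (D := D) (B := D))) := by
  have := hQ.projective
  obtain ⟨N, hN, i, hi, hi'⟩ := h.exists_factor_functor
    (curriedTensor (C × C) ⋙ (Functor.whiskeringRight _ _ _).obj box)
    (fun p => h.biRightExact.tensorLeft_comp p)
  -- Exactness in the parameter is visible at `q₀`, where the functor is `p ↦ box (p ⊗ q₀)`. Since
  -- `box.obj q₀` covers, it spreads to every object of `D`.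
  have hN₀ : IsBiRightExact k (N.flip.obj (box.obj q₀)) :=
    (h.biRightExact.tensorRight_comp q₀).of_iso
      (NatIso.ofComponents (fun p => (i p q₀).symm) fun f =>
        Eq.symm ((Iso.eq_comp_inv _).2
          ((assoc _ _ _).trans ((Iso.inv_comp_eq _).2 (hi f q₀)))))
  have hN' (X : D) : IsBiRightExact k (N.flip.obj X) :=
    ⟨fun Y => isRightExact_flip_obj hQ.covers (G := Prod.sectL C Y ⋙ N) (fun _ => hN _) (hN₀.1 Y) X,
      fun Y => isRightExact_flip_obj hQ.covers (G := Prod.sectR Y C ⋙ N) (fun _ => hN _) (hN₀.2 Y) X⟩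
  obtain ⟨N', hN₁, j, hj, hj'⟩ := h.exists_factor_functor N.flip hN'
  exact ⟨{  ten := N'.flip
            m := fun p q => j (box.obj q) p ≪≫ i p q
            m_natural_left := fun f q => by
              change (N'.obj (box.obj q)).map (box.map f) ≫ _ ≫ _ = (_ ≫ _) ≫ _
              rw [reassoc_of% hj', assoc]
              congr 1
              exact hi f q
            m_natural_right := fun p {q q'} f => by
              change (N'.map (box.map f)).app (box.obj p) ≫ _ ≫ _ = (_ ≫ _) ≫ _
              rw [reassoc_of% hj, assoc]
              congr 1
              exact hi' p f
            ten_left := isRightExact_flip_obj hQ.covers hN₁ ((hN q₀).of_iso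
              (NatIso.ofComponents (fun Y => (j Y q₀).symm) fun f =>
                Eq.symm ((Iso.eq_comp_inv _).2
                  ((assoc _ _ _).trans ((Iso.inv_comp_eq _).2 (hj f q₀))))))
            ten_right := hN₁
            id_mem := isRightExact_id
            comp_mem := IsRightExact.comp
            determines := h.determines
            hom_ext := fun hF _ _ _ _ hfg => IsDeligneProduct.detects hQ.covers hF hfg }⟩

end DeligneTensor

/-! ### Existence of `C ⊠ C^rev` and of `T`. -/

section DeligneRev

variable {k : Type w} [Field k]

/-- The product of the braiding of `C` with its reverse. -/
@[reducible]
def revBraiding (C : Type u) [Category.{v} C] [MonoidalCategory C] [BraidedCategory C] :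
    BraidedCategory (C × C) where
  braiding X Y := (β_ X.1 Y.1).prod (β_ Y.2 X.2).symm
  braiding_naturality_right X _ _ f := Prod.ext
    (BraidedCategory.braiding_naturality_right X.1 f.1)
    (BraidedCategory.braiding_inv_naturality_right X.2 f.2)
  braiding_naturality_left f Z := Prod.ext
    (BraidedCategory.braiding_naturality_left f.1 Z.1)
    (BraidedCategory.braiding_inv_naturality_left f.2 Z.2)
  hexagon_forward _ _ _ := Prod.ext (BraidedCategory.hexagon_forward _ _ _)
    ((reverseBraiding C).hexagon_forward _ _ _)
  hexagon_reverse _ _ _ := Prod.ext (BraidedCategory.hexagon_reverse _ _ _)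
    ((reverseBraiding C).hexagon_reverse _ _ _)

theorem IsFiniteGenerator.nonempty_deligneRev {C : Type (max u (v + 1))} [Category.{v} C]
    [Abelian C] [Linear k C] [MonoidalCategory C] [BraidedCategory C] [MonoidalPreadditive C]
    [MonoidalLinear k C] [∀ X : C, PreservesFiniteColimits (tensorLeft X)]
    [∀ X : C, PreservesFiniteColimits (tensorRight X)] {P : C} (hP : IsFiniteGenerator k P) :
    Nonempty (DeligneRev k C) := by
  obtain ⟨D, _, _, _, box, h, hQ⟩ := hP.exists_isDeligneProduct
  obtain ⟨t⟩ := h.nonempty_tensorExtension hQ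
  let _ := t.monoidalCategory
  let _ := t.boxMonoidal
  have hl (X : D) : IsRightExact k (tensorLeft X) := t.ten_left X
  have hr (X : D) : IsRightExact k (tensorRight X) := t.ten_right X
  have (X : D) : (tensorLeft X).Additive := (hl X).1
  have (X : D) : (tensorRight X).Additive := (hr X).1
  have : MonoidalPreadditive D :=
    { whiskerLeft_zero := (tensorLeft _).map_zero _ _
      zero_whiskerRight := (tensorRight _).map_zero _ _
      whiskerLeft_add := fun {X} _ _ _ _ => (tensorLeft X).map_add
      add_whiskerRight := fun {X} _ _ _ _ => (tensorRight X).map_add }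
  have : MonoidalLinear k D :=
    { whiskerLeft_smul := fun X _ _ r f => (hl X).2.1.map_smul f r
      smul_whiskerRight := fun r _ _ f X => (hr X).2.1.map_smul f r }
  have tD : TensorDetermined box (IsRightExact k (D := D) (B := D)) :=
    { left := hl, right := hr, comp_mem := IsRightExact.comp, determines := h.determines
      detects := IsDeligneProduct.detects hQ.covers }
  let _ := revBraiding C
  obtain ⟨b, hb⟩ := tD.exists_braidedCategory
  exact ⟨{  D := D
            tensorLeft_rightExact := fun X => (hl X).2.2
            tensorRight_rightExact := fun X => (hr X).2.2
            box := box
            isDeligneProduct := h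
            braiding_box := fun A B U V => hb (A, B) (U, V) }⟩

variable {C : Type u} [Category.{v} C] [Abelian C] [Linear k C] [MonoidalCategory C]
  [BraidedCategory C] (E : DeligneRev k C)

namespace DeligneRev

theorem isRightExact_tensorLeft (X : E.D) : IsRightExact k (tensorLeft X) :=
  ⟨inferInstance, inferInstance, E.tensorLeft_rightExact X⟩

theorem isRightExact_tensorRight (X : E.D) : IsRightExact k (tensorRight X) :=
  ⟨inferInstance, inferInstance, E.tensorRight_rightExact X⟩

theorem tensorDetermined {p : C × C} (hp : Covers (E.box.obj p)) :
    TensorDetermined E.box (IsRightExact k (D := E.D) (B := E.D)) where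
  left := E.isRightExact_tensorLeft
  right := E.isRightExact_tensorRight
  comp_mem := IsRightExact.comp
  determines := E.isDeligneProduct.determines
  detects := IsDeligneProduct.detects hp

variable [MonoidalPreadditive C] [MonoidalLinear k C]
  [∀ X : C, PreservesFiniteColimits (tensorLeft X)]
  [∀ X : C, PreservesFiniteColimits (tensorRight X)]

theorem nonempty_tensorFunctor {p : C × C} (hp : Covers (E.box.obj p)) :
    Nonempty (TensorFunctor E) := by
  obtain ⟨T, hT, ⟨τ⟩⟩ := E.isDeligneProduct.exists_factor (isBiRightExact_tensor k C)
  -- For the reverse braiding the structure map of `⊗` uses `c_{U,B}⁻¹` in the middle, which is the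
  -- prescribed `interchange`.
  let _ : (tensor C).Monoidal :=
    letI := reverseBraiding C
    inferInstance
  have hl := FullCentre.isRightExact_tensorLeft (C := C) k
  have hr := FullCentre.isRightExact_tensorRight (C := C) k
  obtain ⟨_, h₀, h₂⟩ := (E.tensorDetermined hp).exists_monoidal
    (W' := IsRightExact k (D := E.D) (B := C))
    E.isDeligneProduct.determines (IsDeligneProduct.detects hp) (fun hF => hF.comp hT)
    (fun b => hT.comp (hl b)) (fun b => hT.comp (hr b))
    (fun b c => hT.comp ((hr b).comp (hr c))) (fun b c => hT.comp ((hl b).comp (hr c))) τ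
  exact ⟨{  T := T
            rightExact := hT
            τ := τ
            unit_eq := h₀
            mul_eq := fun A B U V => h₂ (A, B) (U, V) }⟩

end DeligneRev

end DeligneRev

/-! ### Representability, right adjoints and left centres. -/

section Representability

variable {k : Type w} [Field k] {D : Type u₁} [Category.{v₁} D] [Abelian D] [Linear k D]
  {B : Type u₂} [Category.{v₂} B] [Abelian B] [Linear k B] {Q : D}

/-- If `D` has a finite projective generator, then a subfunctor of `X ↦ (T.obj X ⟶ c)` with finite
values and descent along epimorphisms is representable, for `T` right exact. -/
theorem IsFiniteGenerator.exists_terminal (hQ : IsFiniteGenerator k Q) {T : D ⥤ B}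
    (hT : IsRightExact k T) (c : B) [Module.Finite k (T.obj Q ⟶ c)]
    (N : ∀ X, Submodule k (T.obj X ⟶ c))
    (hN : ∀ {X Y : D} (f : X ⟶ Y) {x : T.obj Y ⟶ c}, x ∈ N Y → T.map f ≫ x ∈ N X)
    (hN' : ∀ {X Y : D} (f : X ⟶ Y) [Epi f] {x : T.obj Y ⟶ c}, T.map f ≫ x ∈ N X → x ∈ N Y) :
    ∃ (r : D) (u : T.obj r ⟶ c), u ∈ N r ∧
      ∀ (X : D) (x : T.obj X ⟶ c), x ∈ N X → ∃! f : X ⟶ r, T.map f ≫ u = x := by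
  obtain ⟨_, _, _⟩ := hT
  have := hQ.projective
  -- Generators of the finite-dimensional space `N(Q)` assemble to an element `v` at `F = Q^n` of
  -- which every element of `N(Q)` is a pullback.
  obtain ⟨n, x, hx⟩ := Submodule.fg_iff_exists_fin_generating_family.1
    (IsNoetherian.noetherian (N Q))
  obtain ⟨F, v, hv, hv'⟩ : ∃ (F : D) (v : T.obj F ⟶ c), v ∈ N F ∧
      ∀ y ∈ N Q, ∃ g : Q ⟶ F, T.map g ≫ v = y := by
    refine ⟨⨁ fun _ : Fin n => Q, ∑ i, T.map (biproduct.π _ i) ≫ x i,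
      Submodule.sum_mem _ fun i _ => hN _ ?_, fun y hy => ?_⟩
    · rw [← hx]
      exact Submodule.subset_span ⟨i, rfl⟩
    · rw [← hx, Submodule.mem_span_range_iff_exists_fun] at hy
      obtain ⟨a, rfl⟩ := hy
      refine ⟨biproduct.lift fun i => a i • 𝟙 Q, ?_⟩
      simp [Preadditive.comp_sum, ← T.map_comp_assoc, Functor.map_smul]
  have := hQ.finite_hom_left F
  -- The arrows `Q ⟶ F` that kill `v` are the relations. Dividing `F` by finitely many generators of
  -- them leaves an object whose arrows from `Q` correspond to `N(Q)`.
  obtain ⟨m, g, hg⟩ := Submodule.fg_iff_exists_fin_generating_family.1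
    (IsNoetherian.noetherian
      (LinearMap.ker (Linear.rightComp k (T.obj Q) v ∘ₗ T.mapLinearMap k (X := Q) (Y := F))))
  have hg' (h : Q ⟶ F) : T.map h ≫ v = 0 ↔ ∃ a : Fin m → k, ∑ j, a j • g j = h := by
    rw [← Submodule.mem_span_range_iff_exists_fun, hg]
    rfl
  have hgv (j : Fin m) : T.map (g j) ≫ v = 0 :=
    (hg' _).2 ⟨Pi.single j 1, by simp [Pi.single_apply, ite_smul]⟩
  let d : (⨁ fun _ : Fin m => Q) ⟶ F := biproduct.desc g
  obtain ⟨u, hu⟩ := exists_desc_of_comp_eq_zero T (cokernel.condition d)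
    (fun g hg => ⟨cokernel.desc d g hg, cokernel.π_desc _ _ _⟩) v
    (by
      change T.map (biproduct.desc g) ≫ v = 0
      rw [biproduct.desc_eq, Functor.map_sum, Preadditive.sum_comp]
      exact Finset.sum_eq_zero fun j _ => by rw [T.map_comp, assoc, hgv, comp_zero])
  have hd (h : Q ⟶ F) (hh : T.map h ≫ v = 0) : h ≫ cokernel.π d = 0 := by
    obtain ⟨a, rfl⟩ := (hg' h).1 hh
    have (j : Fin m) : g j ≫ cokernel.π d = 0 := by
      have : g j = biproduct.ι (fun _ : Fin m => Q) j ≫ d := by simp [d]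
      rw [this, assoc, cokernel.condition, comp_zero]
    simp [Preadditive.sum_comp, this]
  -- Here descent along epimorphisms enters: it puts the element induced on the quotient in the
  -- subfunctor.
  have hmem : u ∈ N (cokernel d) := hN' (cokernel.π d) (by rwa [hu])
  refine ⟨cokernel d, u, hmem, fun X y hy => ?_⟩
  have huniq (t : X ⟶ cokernel d) (ht : T.map t ≫ u = 0) : t = 0 := hQ.covers.hom_ext fun q => by
    obtain ⟨h, hh⟩ : ∃ h, h ≫ cokernel.π d = q ≫ t := ⟨_, Projective.factorThru_comp _ _⟩
    rw [comp_zero, ← hh]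
    refine hd h ?_
    rw [← hu, ← T.map_comp_assoc, hh, T.map_comp, assoc, ht, comp_zero]
  -- On a cover `Q^l` of `X` the components of `y` are pullbacks of `v`. The resulting arrow to the
  -- quotient kills `kernel e`, because arrows from `Q` into the kernel pull `v` back to zero.
  obtain ⟨l, e, _⟩ := hQ.covers.exists_epi X
  choose h hh using fun i => hv' _ (hN (biproduct.ι (fun _ : Fin l => Q) i ≫ e) hy)
  have hh' : T.map (biproduct.desc h) ≫ v = T.map e ≫ y := by
    rw [biproduct.desc_eq, Functor.map_sum, Preadditive.sum_comp]
    simp only [T.map_comp, assoc, hh]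
    simp only [← T.map_comp_assoc, ← Preadditive.sum_comp, ← T.map_sum]
    simp only [← assoc, ← Preadditive.sum_comp, biproduct.total, id_comp]
  have hker : kernel.ι e ≫ biproduct.desc h ≫ cokernel.π d = 0 := hQ.covers.hom_ext fun q => by
    rw [comp_zero, ← assoc, ← assoc]
    refine hd _ ?_
    rw [T.map_comp, assoc, hh', ← T.map_comp_assoc, assoc, kernel.condition, comp_zero, T.map_zero,
      zero_comp]
  refine ⟨Abelian.epiDesc e _ hker, ?_, fun t ht => ?_⟩
  · change T.map _ ≫ u = y
    rw [← cancel_epi (T.map e), ← T.map_comp_assoc, Abelian.comp_epiDesc, T.map_comp, assoc, hu,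
      hh']
  · refine sub_eq_zero.1 (huniq _ ?_)
    rw [T.map_sub, Preadditive.sub_comp, ht, sub_eq_zero, ← cancel_epi (T.map e),
      ← T.map_comp_assoc, Abelian.comp_epiDesc, T.map_comp, assoc, hu, hh']

/-- With `N` everything, `exists_terminal` gives a terminal object in each category of arrows from
`T` to `c`. -/
theorem IsFiniteGenerator.isLeftAdjoint (hQ : IsFiniteGenerator k Q) {T : D ⥤ B}
    (hT : IsRightExact k T) (hfin : ∀ c, Module.Finite k (T.obj Q ⟶ c)) : T.IsLeftAdjoint := by
  have (c : B) : HasTerminal (CostructuredArrow T c) := by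
    obtain ⟨r, u, -, h⟩ := hQ.exists_terminal hT c (fun _ => ⊤) (fun _ _ _ => trivial)
      (fun _ _ _ _ => trivial)
    have h (X : D) (x : T.obj X ⟶ c) := h X x trivial
    exact IsTerminal.hasTerminal (X := CostructuredArrow.mk u)
      (IsTerminal.ofUniqueHom
        (fun Y => CostructuredArrow.homMk (h Y.left Y.hom).choose (h Y.left Y.hom).choose_spec.1)
        fun Y f => CostructuredArrow.hom_ext _ _
          ((h Y.left Y.hom).choose_spec.2 _ (CostructuredArrow.w f)))
  exact isLeftAdjoint_of_costructuredArrowTerminals T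

theorem LeftCentral.precomp [MonoidalCategory D] [BraidedCategory D] {A : Alg D} {X Y : D}
    {u : Y ⟶ A.obj} (hu : LeftCentral A u) (f : X ⟶ Y) : LeftCentral A (f ≫ u) := by
  rw [LeftCentral] at hu ⊢
  rw [comp_whiskerRight_assoc, hu, MonoidalCategory.whiskerLeft_comp_assoc,
    BraidedCategory.braiding_naturality_left_assoc]

/-- Tensoring with `A` on the right is right exact, so `f ⊗ A` is an epimorphism and can be
cancelled. -/
theorem LeftCentral.of_epi [MonoidalCategory D] [BraidedCategory D] {A : Alg D}
    [PreservesFiniteColimits (tensorRight A.obj)] {X Y : D} (f : X ⟶ Y) [Epi f] {u : Y ⟶ A.obj}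
    (hu : LeftCentral A (f ≫ u)) : LeftCentral A u := by
  have : Epi (f ▷ A.obj) := inferInstanceAs (Epi ((tensorRight A.obj).map f))
  rw [LeftCentral] at hu ⊢
  rw [← cancel_epi (f ▷ A.obj), BraidedCategory.braiding_naturality_left_assoc,
    ← comp_whiskerRight_assoc, hu, MonoidalCategory.whiskerLeft_comp_assoc]

/-- Left central arrows form a linear subfunctor of `Hom(-, A)` that descends along epimorphisms, so
`exists_terminal` applies with the identity functor. -/
theorem IsFiniteGenerator.exists_isLeftCentre [MonoidalCategory D] [BraidedCategory D]
    [MonoidalPreadditive D] [MonoidalLinear k D] (hQ : IsFiniteGenerator k Q) (A : Alg D)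
    [PreservesFiniteColimits (tensorRight A.obj)] :
    ∃ (L : D) (e : L ⟶ A.obj), IsLeftCentre A e := by
  have := hQ.finite_hom_left A.obj
  have : Module.Finite k ((𝟭 D).obj Q ⟶ A.obj) := this
  obtain ⟨L, e, he, h⟩ := hQ.exists_terminal isRightExact_id A.obj
    (fun X =>
      { carrier := {u | LeftCentral A u}
        zero_mem' := by simp [LeftCentral]
        add_mem' := fun {u v} hu hv => by
          change _ = _ at hu hv
          change _ = _
          rw [MonoidalPreadditive.add_whiskerRight, Preadditive.add_comp, hu, hv,
            MonoidalPreadditive.whiskerLeft_add, Preadditive.add_comp, Preadditive.comp_add]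
        smul_mem' := fun a u hu => by
          change _ = _ at hu
          change _ = _
          rw [MonoidalLinear.smul_whiskerRight, Linear.smul_comp, hu,
            MonoidalLinear.whiskerLeft_smul, Linear.smul_comp, Linear.comp_smul] })
    (fun f _ hu => hu.precomp f) (fun f _ _ hu => hu.of_epi f)
  exact ⟨L, e, he, fun {U} u hu => h U u hu⟩

end Representability

/-! ### Left centres of `R(A)` and full centres of `A`. -/

section FullCentre

variable {k : Type w} [Field k] {C : Type u} [Category.{v} C] [MonoidalCategory C]
  [BraidedCategory C]

theorem mixedBraidingProd_natural_right (A B : C) {U V : C} (g : U ⟶ V) :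
    (A ⊗ B) ◁ g ≫ mixedBraidingProd A B V = mixedBraidingProd A B U ≫ g ▷ (A ⊗ B) := by
  simp only [mixedBraidingProd, assoc]
  rw [associator_naturality_right_assoc, ← MonoidalCategory.whiskerLeft_comp_assoc,
    BraidedCategory.braiding_inv_naturality_right, MonoidalCategory.whiskerLeft_comp_assoc,
    associator_inv_naturality_middle_assoc, ← comp_whiskerRight_assoc,
    BraidedCategory.braiding_naturality_right, comp_whiskerRight_assoc,
    associator_naturality_left]

/-- The mixed braiding past a product `U ⊗ V` is compatible with the braiding of `C ⊠ C^rev`. -/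
theorem mixedBraidingProd_interchange (A B U V : C) :
    mixedBraidingProd A B (U ⊗ V) ≫ interchange U V A B =
      interchange A B U V ≫ ((β_ A U).hom ⊗ₘ (β_ V B).inv) := by
  simp only [mixedBraidingProd, interchange, BraidedCategory.braiding_tensor_left_inv,
    BraidedCategory.braiding_tensor_right_hom, MonoidalCategory.tensorHom_def]
  -- The hexagon braids `A` past `V` and `interchange` undoes this crossing. The two crossings that
  -- remain are disjoint and commute.
  calc _ = 𝟙 _ ⊗≫ A ◁ (β_ U B).inv ▷ V ⊗≫ ((A ⊗ U) ◁ (β_ V B).inv ≫ (β_ A U).hom ▷ (V ⊗ B)) ⊗≫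
        U ◁ ((β_ A V).hom ≫ (β_ A V).inv) ▷ B ⊗≫ 𝟙 _ := by monoidal
    _ = 𝟙 _ ⊗≫ A ◁ (β_ U B).inv ▷ V ⊗≫ ((β_ A U).hom ▷ (B ⊗ V) ≫ (U ⊗ A) ◁ (β_ V B).inv) ⊗≫
        𝟙 _ := by
      rw [Iso.hom_inv_id, whisker_exchange]
      monoidal
    _ = _ := by monoidal

variable [Abelian C] [Linear k C] [MonoidalPreadditive C] [MonoidalLinear k C]
  [∀ X : C, PreservesFiniteColimits (tensorLeft X)]
  [∀ X : C, PreservesFiniteColimits (tensorRight X)]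
  {E : DeligneRev k C} (T : TensorFunctor E)

namespace TensorFunctor

open Functor.LaxMonoidal Functor.OplaxMonoidal Functor.Monoidal

theorem mixedBraiding_natural_left {X Y : E.D} (f : X ⟶ Y) (U : C) :
    T.T.map f ▷ U ≫ mixedBraiding T Y U = mixedBraiding T X U ≫ U ◁ T.T.map f :=
  (mixedBraidingNat T U).naturality f

theorem isRightExact_tensorRight (U : C) : IsRightExact k (T.T ⋙ tensorRight U) :=
  T.rightExact.comp (FullCentre.isRightExact_tensorRight k U)

theorem isRightExact_tensorLeft (U : C) : IsRightExact k (T.T ⋙ tensorLeft U) :=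
  T.rightExact.comp (FullCentre.isRightExact_tensorLeft k U)

/-- The isomorphism `T (A ⊠ B) ≅ A ⊗ B`. -/
def boxIso (A B : C) : T.T.obj (E.box.obj (A, B)) ≅ A ⊗ B := T.τ.app (A, B)

theorem mixedBraiding_boxIso (A B U : C) : mixedBraiding T (E.box.obj (A, B)) U =
    (T.boxIso A B).hom ▷ U ≫ mixedBraidingProd A B U ≫ U ◁ (T.boxIso A B).inv :=
  mixedBraiding_box T A B U

theorem boxIso_natural {A A' B B' : C} (f : A ⟶ A') (g : B ⟶ B') :
    T.T.map (E.box.map (Prod.mkHom f g)) ≫ (T.boxIso A' B').hom =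
      (T.boxIso A B).hom ≫ (f ⊗ₘ g) :=
  T.τ.hom.naturality (X := (A, B)) (Y := (A', B')) (Prod.mkHom f g)

theorem μ_boxIso (A B U V : C) :
    μ T.T (E.box.obj (A, B)) (E.box.obj (U, V)) ≫ T.T.map (μ E.box (A, B) (U, V)) ≫
        (T.boxIso (A ⊗ U) (B ⊗ V)).hom =
      ((T.boxIso A B).hom ⊗ₘ (T.boxIso U V).hom) ≫ interchange A B U V :=
  T.mul_eq A B U V

variable {R : C ⥤ E.D} (adj : T.T ⊣ R)

/-- The counit of the adjunction. -/
def counit (A : C) : T.T.obj (R.obj A) ⟶ A := adj.counit.app A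

/-- The multiplication of the algebra `R(A)`. -/
def mulR (A : Alg C) : R.obj A.obj ⊗ R.obj A.obj ⟶ R.obj A.obj := (adjointAlg T adj A).mul

theorem exists_comp_counit {X : E.D} {A : C} (x : T.T.obj X ⟶ A) :
    ∃ u : X ⟶ R.obj A, T.T.map u ≫ counit T adj A = x :=
  ⟨adj.homEquiv _ _ x, (adj.homEquiv_counit _ _ _).symm.trans (Equiv.symm_apply_apply _ _)⟩

theorem comp_counit_injective {X : E.D} {A : C} {u v : X ⟶ R.obj A}
    (h : T.T.map u ≫ counit T adj A = T.T.map v ≫ counit T adj A) : u = v :=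
  (adj.homEquiv _ _).symm.injective
    ((adj.homEquiv_counit _ _ _).trans (h.trans (adj.homEquiv_counit _ _ _).symm))

/-- `A ≅ T(A ⊠ 𝟙)` lies in the image of `T`, and every arrow from such an object to `A` factors
through the counit. -/
theorem exists_section_counit (A : C) : ∃ s : A ⟶ T.T.obj (R.obj A), s ≫ counit T adj A = 𝟙 A := by
  let j : T.T.obj (E.box.obj (A, 𝟙_ C)) ≅ A := T.boxIso A (𝟙_ C) ≪≫ ρ_ A
  obtain ⟨u, hu⟩ := T.exists_comp_counit adj j.hom
  exact ⟨j.inv ≫ T.T.map u, by rw [assoc, hu, Iso.inv_hom_id]⟩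

/-- The lax structure of `R` is by definition the adjunct of `ε ⊗ ε` composed with the inverse
structure map of `T`. -/
theorem map_mul_counit (A : Alg C) :
    T.T.map (mulR T adj A) ≫ counit T adj A.obj =
      δ T.T _ _ ≫ (counit T adj A.obj ⊗ₘ counit T adj A.obj) ≫ A.mul := by
  change T.T.map (adj.homEquiv _ _ (δ T.T _ _ ≫ (adj.counit.app A.obj ⊗ₘ adj.counit.app A.obj)) ≫
    R.map A.mul) ≫ adj.counit.app A.obj = _
  rw [← adj.homEquiv_naturality_right]
  refine (adj.homEquiv_counit _ _ _).symm.trans ((Equiv.symm_apply_apply _ _).trans ?_)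
  rw [assoc]
  rfl

variable {p : C × C} (hp : Covers (E.box.obj p))
include hp

/-- The mixed braiding was extended for each `U` separately, so naturality in `U` has to be tested
on product objects. -/
theorem mixedBraiding_natural_right (X : E.D) {U V : C} (g : U ⟶ V) :
    T.T.obj X ◁ g ≫ mixedBraiding T X V = mixedBraiding T X U ≫ g ▷ T.T.obj X := by
  refine IsDeligneProduct.detects hp (T.isRightExact_tensorRight U) fun p x => ?_
  change T.T.map x ▷ U ≫ _ = T.T.map x ▷ U ≫ _
  rw [← whisker_exchange_assoc, mixedBraiding_natural_left,
    reassoc_of% T.mixedBraiding_natural_left, whisker_exchange]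
  simp only [← assoc]
  congr 1
  rw [mixedBraiding_boxIso, mixedBraiding_boxIso]
  simp only [assoc]
  rw [whisker_exchange_assoc, reassoc_of% mixedBraidingProd_natural_right, whisker_exchange]

/-- The mixed braiding corresponds to the braiding of `C ⊠ C^rev` under `T`. -/
theorem map_braiding (X Y : E.D) : μ T.T X Y ≫ T.T.map (β_ X Y).hom =
    mixedBraiding T X (T.T.obj Y) ≫ μ T.T Y X := by
  refine IsDeligneProduct.detects hp (T.isRightExact_tensorRight (T.T.obj Y)) fun p x => ?_
  change T.T.map x ▷ _ ≫ _ = T.T.map x ▷ _ ≫ _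
  rw [μ_natural_left_assoc, ← T.T.map_comp, BraidedCategory.braiding_naturality_left, T.T.map_comp,
    reassoc_of% T.mixedBraiding_natural_left, μ_natural_right]
  simp only [← assoc]
  congr 1
  refine IsDeligneProduct.detects hp (T.isRightExact_tensorLeft _) fun q y => ?_
  change _ ◁ T.T.map y ≫ _ = _ ◁ T.T.map y ≫ _
  rw [μ_natural_right_assoc, ← T.T.map_comp, BraidedCategory.braiding_naturality_right,
    T.T.map_comp, reassoc_of% T.mixedBraiding_natural_right hp, μ_natural_left]
  simp only [← assoc]
  congr 1
  obtain ⟨A, B⟩ := p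
  obtain ⟨U, V⟩ := q
  rw [← cancel_mono (T.T.map (μ E.box (U, V) (A, B))), ← cancel_mono (T.boxIso (U ⊗ A) (V ⊗ B)).hom]
  simp only [assoc]
  have hβ : (T.T.map (β_ (E.box.obj (A, B)) (E.box.obj (U, V))).hom ≫
      T.T.map (μ E.box (U, V) (A, B))) ≫ (T.boxIso (U ⊗ A) (V ⊗ B)).hom =
      T.T.map (μ E.box (A, B) (U, V)) ≫ (T.boxIso (A ⊗ U) (B ⊗ V)).hom ≫
        ((β_ A U).hom ⊗ₘ (β_ V B).inv) := by
    rw [← T.T.map_comp, E.braiding_box, T.T.map_comp, assoc, ← boxIso_natural]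
  rw [assoc] at hβ
  rw [μ_boxIso, hβ, reassoc_of% T.μ_boxIso, mixedBraiding_boxIso, ← mixedBraidingProd_interchange,
    MonoidalCategory.tensorHom_def, MonoidalCategory.tensorHom_def']
  simp only [assoc]
  rw [← MonoidalCategory.whiskerLeft_comp_assoc, Iso.inv_hom_id, MonoidalCategory.whiskerLeft_id,
    id_comp, reassoc_of% mixedBraidingProd_natural_right]

/-- Transposed along the adjunction, the two sides of left centrality become the two sides of the
centrality condition, both precomposed with `δ` and `id ⊗ ε`. The first is invertible and the second
is split epi. -/
theorem leftCentral_iff_cent (A : Alg C) {X : E.D} (u : X ⟶ R.obj A.obj) :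
    LeftCentral (adjointAlg T adj A) u ↔ Cent T A (T.T.map u ≫ counit T adj A.obj) := by
  change u ▷ R.obj A.obj ≫ mulR T adj A = (β_ X _).hom ≫ R.obj A.obj ◁ u ≫ mulR T adj A ↔ _
  obtain ⟨s, hs⟩ := T.exists_section_counit adj A.obj
  have : Epi (T.T.obj X ◁ counit T adj A.obj) :=
    (SplitEpi.mk (T.T.obj X ◁ s) (by
      rw [← MonoidalCategory.whiskerLeft_comp, hs, MonoidalCategory.whiskerLeft_id])).epi
  have h₁ : T.T.map (u ▷ R.obj A.obj ≫ mulR T adj A) ≫ counit T adj A.obj =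
      δ T.T X (R.obj A.obj) ≫ T.T.obj X ◁ counit T adj A.obj ≫
        (T.T.map u ≫ counit T adj A.obj) ▷ A.obj ≫ A.mul := by
    rw [T.T.map_comp, assoc, map_mul_counit, ← δ_natural_left_assoc,
      MonoidalCategory.tensorHom_def, comp_whiskerRight, assoc, assoc, whisker_exchange_assoc,
      whisker_exchange_assoc]
  have h₂ : T.T.map ((β_ X _).hom ≫ R.obj A.obj ◁ u ≫ mulR T adj A) ≫ counit T adj A.obj =
      δ T.T X (R.obj A.obj) ≫ T.T.obj X ◁ counit T adj A.obj ≫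
        mixedBraiding T X A.obj ≫ A.obj ◁ (T.T.map u ≫ counit T adj A.obj) ≫ A.mul := by
    have hb : T.T.map (β_ X (R.obj A.obj)).hom ≫ δ T.T _ _ =
        δ T.T _ _ ≫ mixedBraiding T X (T.T.obj (R.obj A.obj)) := by
      rw [← cancel_epi (μ T.T X (R.obj A.obj)), reassoc_of% T.map_braiding hp]
      simp
    rw [T.T.map_comp, T.T.map_comp, assoc, assoc, map_mul_counit, ← δ_natural_right_assoc,
      reassoc_of% hb, reassoc_of% T.mixedBraiding_natural_right hp, MonoidalCategory.tensorHom_def,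
      MonoidalCategory.whiskerLeft_comp, assoc, assoc, whisker_exchange_assoc]
  constructor
  · intro h
    rw [Cent, ← cancel_epi (T.T.obj X ◁ counit T adj A.obj), ← cancel_epi (δ T.T X (R.obj A.obj)),
      ← h₁, ← h₂, h]
  · intro h
    refine T.comp_counit_injective adj ?_
    rw [h₁, h₂, h]

/-- The adjunction bijection restricts to central arrows on both sides and is compatible with
precomposition, so it carries one terminal property to the other. -/
theorem isFullCentre_of_isLeftCentre (A : Alg C) {L : E.D} (e : L ⟶ R.obj A.obj)
    (he : IsLeftCentre (adjointAlg T adj A) e) :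
    IsFullCentre T A L (T.T.map e ≫ counit T adj A.obj) where
  cent := (T.leftCentral_iff_cent adj hp A e).1 he.central
  existsUnique X x hx := by
    obtain ⟨u, rfl⟩ := T.exists_comp_counit adj x
    obtain ⟨ζ, hζ, huniq⟩ := he.existsUnique u ((T.leftCentral_iff_cent adj hp A u).2 hx)
    change ζ ≫ e = u at hζ
    refine ⟨ζ, ?_, fun ξ hξ => huniq ξ (T.comp_counit_injective adj ?_)⟩
    · change T.T.map ζ ≫ _ = _
      rw [← T.T.map_comp_assoc, hζ]
    · change T.T.map ((ξ : X ⟶ L) ≫ (e : L ⟶ R.obj A.obj)) ≫ _ = _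
      rw [T.T.map_comp, assoc]
      exact hξ

end TensorFunctor

end FullCentre

end FullCentre

end

/-! ### The theorem. -/

theorem mainTheorem1 (k : Type w) [Field k] [CharZero k]
    (C : Type (max u (v + 1))) [Category.{v} C] [Abelian C] [Linear k C]
    [MonoidalCategory C] [BraidedCategory C] [MonoidalPreadditive C] [MonoidalLinear k C]
    [∀ X : C, PreservesFiniteColimits (tensorLeft X)]
    [∀ X : C, PreservesFiniteColimits (tensorRight X)]
    (hPF : FullCentre.ConditionPF k C) (conj : FullCentre.Conjugates k C) :
    Nonempty (FullCentre.DeligneRev k C) ∧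
    ∀ E : FullCentre.DeligneRev k C,
      Nonempty (FullCentre.TensorFunctor E) ∧
      ∀ T : FullCentre.TensorFunctor E,
        T.T.IsLeftAdjoint ∧
        ∀ A : FullCentre.Alg C,
          (∃ (Z : E.D) (z : T.T.obj Z ⟶ A.obj), FullCentre.IsFullCentre T A Z z) ∧
          ∀ (R : C ⥤ E.D) (adj : T.T ⊣ R),
            (∃ (L : E.D) (e : L ⟶ (FullCentre.adjointAlg T adj A).obj),
              FullCentre.IsLeftCentre (FullCentre.adjointAlg T adj A) e) ∧
            ∀ (L : E.D) (e : L ⟶ (FullCentre.adjointAlg T adj A).obj),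
              FullCentre.IsLeftCentre (FullCentre.adjointAlg T adj A) e →
                FullCentre.IsFullCentre T A L (T.T.map e ≫ adj.counit.app A.obj) := by
  obtain ⟨P, hP⟩ := hPF.exists_isFiniteGenerator
  refine ⟨hP.nonempty_deligneRev, fun E => ?_⟩
  have hQ : FullCentre.IsFiniteGenerator k (E.box.obj (P, P)) :=
    E.isDeligneProduct.isFiniteGenerator hP
  refine ⟨E.nonempty_tensorFunctor hQ.covers, fun T => ?_⟩
  -- `T(P ⊠ P)` is an object of `C`, whose spaces of arrows are finite-dimensional by (PF).
  have hadj : T.T.IsLeftAdjoint := hQ.isLeftAdjoint T.rightExact fun c => hP.finite_hom _ c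
  have hlc (A : FullCentre.Alg C) {R : C ⥤ E.D} (adj : T.T ⊣ R) :
      ∃ (L : E.D) (e : L ⟶ (FullCentre.adjointAlg T adj A).obj),
        FullCentre.IsLeftCentre (FullCentre.adjointAlg T adj A) e := by
    have := E.tensorRight_rightExact (FullCentre.adjointAlg T adj A).obj
    exact hQ.exists_isLeftCentre _
  refine ⟨hadj, fun A => ⟨?_, fun R adj => ⟨hlc A adj, fun L e he =>
    T.isFullCentre_of_isLeftCentre adj hQ.covers A e he⟩⟩⟩
  have adj := Adjunction.ofIsLeftAdjoint T.T
  obtain ⟨L, e, he⟩ := hlc A adj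
  exact ⟨L, _, T.isFullCentre_of_isLeftCentre adj hQ.covers A e he⟩
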